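/- Let $k$ be a field of characteristic $0$ and $n\ge 1$. Let $V=\{x\in k^{n+1}:\sum_i x_i=0\}$ be the geometric representation of $\mathcal W=S_{n+1}$ (acting by permutation of coordinates), with simple transpositions $s_i=(i,i+1)$, $1\le i\le n$, and for a transposition $t$ let $H_t\subset V$ be its fixed hyperplane. A Weyl line is a $1$-dimensional subspace of $V$ which is an intersection of reflecting hyperplanes (for $n=1$, $V$ itself, the empty intersection). Let $Z$ be the union of all Weyl lines and $V_i$ the union of the Weyl lines not contained in $H_{s_i}$. For a nonempty sequence of indices in $\{1,\dots,n\}$ put $W_i=V_i$ and $W_{i_1\cdots i_m}=V_{i_1}\cap(W_{i_2\cdots i_m}\cup s_{i_1}W_{i_2\cdots i_m})$. For $X\subseteq V$ let $\mathcal O(X)$ be the algebra of regular functions on $X$, i.e. polynomial functions modulo those vanishing on $X$; it is $\mathbb Z$-graded with linear forms in degree $2$ when $X$ is stable under scalars. Put $\bar R=\mathcal O(Z)$, $R_i=\mathcal O(V_i)$ and $B_i=R_i\otimes_{R_i^{s_i}}R_i$, a graded $(\bar R,\bar R)$-bimodule. For graded $(\bar R,\bar R)$-bimodules $B,B'$ let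 $V_B^r\subseteq Z$ and $V_{B'}^\ell\subseteq Z$ be the zero loci of the right annihilator of $B$ and of the left annihilator of $B'$, and set $$B\ast B'=B\otimes_{\bar R}\mathcal O(V_B^r\cap V_{B'}^\ell)\otimes_{\bar R}B'.$$ Define $B_{i_k\cdots i_1}$ inductively by $B_{i_k\cdots i_1}=B_{i_k}\ast B_{i_{k-1}\cdots i_1}$ (and $B_{i_1}$ as above if $k=1$). A bimodule is associated to the sequence $i_k\cdots i_1$ if it is obtained from $B_{i_k},\dots,B_{i_1}$ by $\ast$-multiplication in this order with some choice of brackets. Theorem. Let $i_k\cdots i_1$ ($k\ge1$) be a sequence of indices in $\{1,\dots,n\}$. (1) Any two bimodules associated to this sequence are isomorphic as graded $(\bar R,\bar R)$-bimodules (by an isomorphism homogeneous of degree $0$). (2) The left action of $\bar R$ on $B_{i_k\cdots i_1}$ factors through $\mathcal O(W_{i_k\cdots i_1})$, over which $B_{i_k\cdots i_1}$ is free, and the right action of $\bar R$ factors through $\mathcal O(W_{i_1\cdots i_k})$, over which $B_{i_k\cdots i_1}$ is free. -/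

import Mathlib

universe u

namespace WeylBimod

open DirectSum TensorProduct

/-! ## Generalities on graded abelian groups -/

theorem isInternal_of_split {M : Type*} [AddCommGroup M] (ℳ : ℤ → AddSubgroup M)
    (D : M →+ (ℤ →₀ M)) (hD : ∀ d, ∀ m ∈ ℳ d, D m = Finsupp.single d m)
    (hsup : ∀ m, m ∈ ⨆ d, ℳ d) : DirectSum.IsInternal ℳ := by
  have key : ∀ x : ⨁ d, ℳ d, ∀ d, D (DirectSum.coeAddMonoidHom ℳ x) d = x d := by
    intro x d
    induction x using DirectSum.induction_on with
    | zero => simp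
    | of i y =>
      rw [DirectSum.coeAddMonoidHom_of, hD i y y.2, DirectSum.coe_of_apply, Finsupp.single_apply]
      split_ifs <;> simp_all
    | add x y hx hy => simp [hx, hy]
  constructor
  · intro x y hxy
    ext d
    rw [← key x d, ← key y d, hxy]
  · intro m
    have : (⨆ d, ℳ d) ≤ (DirectSum.coeAddMonoidHom ℳ).range := by
      refine iSup_le fun d m hm => ⟨DirectSum.of (fun i => ℳ i) d ⟨m, hm⟩, ?_⟩
      exact DirectSum.coeAddMonoidHom_of _ _ _
    exact this (hsup m)

theorem exists_split_of_isInternal {M S : Type*} [AddCommGroup M] [SetLike S M]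
    [AddSubmonoidClass S M] (ℳ : ℤ → S) (h : DirectSum.IsInternal ℳ) :
    ∃ D : M →+ (ℤ →₀ M), (∀ d, ∀ m ∈ ℳ d, D m = Finsupp.single d m) := by
  let := h.chooseDecomposition
  let E : (⨁ d, ℳ d) →+ (ℤ →₀ M) :=
    DirectSum.toAddMonoid fun d => (Finsupp.singleAddHom d).comp (AddSubmonoidClass.subtype (ℳ d))
  refine ⟨E.comp (DirectSum.decomposeAddEquiv ℳ).toAddMonoidHom, fun d m hm => ?_⟩
  have : DirectSum.decompose ℳ m = DirectSum.of (fun i => ℳ i) d ⟨m, hm⟩ :=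
    DirectSum.decompose_of_mem ℳ hm
  simp [E, this]

theorem iSup_of_isInternal {M : Type*} [AddCommGroup M] {ℳ : ℤ → AddSubgroup M}
    (h : DirectSum.IsInternal ℳ) (m : M) : m ∈ ⨆ d, ℳ d := by
  obtain ⟨x, rfl⟩ := h.2 m
  induction x using DirectSum.induction_on with
  | zero => simp
  | of i y =>
    rw [DirectSum.coeAddMonoidHom_of]
    exact (le_iSup ℳ i) y.2
  | add x y hx hy => rw [map_add]; exact add_mem hx hy

/-- The induced grading of a tensor product. -/
def tensorDeg {B M N : Type*} [CommRing B] [AddCommGroup M] [Module B M] [AddCommGroup N]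
    [Module B N] (ℳ : ℤ → AddSubgroup M) (𝒩 : ℤ → AddSubgroup N) (d : ℤ) :
    AddSubgroup (M ⊗[B] N) :=
  AddSubgroup.closure {x | ∃ i j m n, i + j = d ∧ m ∈ ℳ i ∧ n ∈ 𝒩 j ∧ m ⊗ₜ[B] n = x}

theorem tensorDeg_isInternal {B M N : Type*} [CommRing B] [AddCommGroup M] [Module B M]
    [AddCommGroup N] [Module B N] {ℬ : ℤ → AddSubgroup B} {ℳ : ℤ → AddSubgroup M}
    {𝒩 : ℤ → AddSubgroup N} (hB : DirectSum.IsInternal ℬ) (hM : DirectSum.IsInternal ℳ)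
    (hN : DirectSum.IsInternal 𝒩) (hBM : ∀ i j, ∀ b ∈ ℬ i, ∀ m ∈ ℳ j, b • m ∈ ℳ (i + j))
    (hBN : ∀ i j, ∀ b ∈ ℬ i, ∀ n ∈ 𝒩 j, b • n ∈ 𝒩 (i + j)) :
    DirectSum.IsInternal (tensorDeg (B := B) ℳ 𝒩) := by
  obtain ⟨DM, hDM⟩ := exists_split_of_isInternal ℳ hM
  obtain ⟨DN, hDN⟩ := exists_split_of_isInternal 𝒩 hN
  let t : M →+ N →+ M ⊗[B] N :=
    AddMonoidHom.mk' (fun m => (TensorProduct.mk B M N m).toAddMonoidHom) (by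
      intro a b; ext n; simp)
  have ht : ∀ m n, t m n = m ⊗ₜ[B] n := fun _ _ => rfl
  let F : (ℤ →₀ M) →+ (ℤ →₀ N) →+ (ℤ →₀ M ⊗[B] N) :=
    Finsupp.liftAddHom fun i => AddMonoidHom.flip (Finsupp.liftAddHom fun j =>
      AddMonoidHom.flip (((Finsupp.singleAddHom (i + j)).compHom).comp t))
  have hF : ∀ i m j n, F (Finsupp.single i m) (Finsupp.single j n)
      = Finsupp.single (i + j) (m ⊗ₜ[B] n) := by
    intro i m j n
    simp [F, ht]
  let f : M →+ N →+ (ℤ →₀ M ⊗[B] N) := ((AddMonoidHom.compHom.flip DN).comp F).comp DM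
  have hf : ∀ m n, f m n = F (DM m) (DN n) := fun _ _ => rfl
  have hbal : ∀ (b : B) (m : M) (n : N), f (b • m) n = f m (b • n) := by
    intro b m n
    induction iSup_of_isInternal hB b using AddSubgroup.iSup_induction' with
    | h1 => simp
    | hadd x y _ _ hx hy => simp [add_smul, hx, hy]
    | hp i b hb =>
    induction iSup_of_isInternal hM m using AddSubgroup.iSup_induction' with
    | h1 => simp
    | hadd x y _ _ hx hy => simp only [smul_add, map_add, AddMonoidHom.add_apply, hx, hy]
    | hp j m hm =>
    induction iSup_of_isInternal hN n using AddSubgroup.iSup_induction' with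
    | h1 => simp
    | hadd x y _ _ hx hy => simp only [smul_add, map_add, hx, hy]
    | hp l n hn =>
    rw [hf, hf, hDM _ _ (hBM i j b hb m hm), hDM _ _ hm, hDN _ _ hn,
      hDN _ _ (hBN i l b hb n hn), hF, hF, TensorProduct.smul_tmul]
    congr 1
    ring
  refine isInternal_of_split _ (TensorProduct.liftAddHom f hbal) ?_ ?_
  · intro d x hx
    induction hx using AddSubgroup.closure_induction with
    | zero => simp
    | add x y _ _ hx hy => simp [hx, hy]
    | neg x _ hx => simp [hx]
    | mem x hx =>
      obtain ⟨i, j, m, n, rfl, hm, hn, rfl⟩ := hx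
      rw [TensorProduct.liftAddHom_tmul, hf, hDM _ _ hm, hDN _ _ hn, hF]
  · intro x
    induction x using TensorProduct.induction_on with
    | zero => exact zero_mem _
    | add x y hx hy => exact add_mem hx hy
    | tmul m n =>
    induction iSup_of_isInternal hM m using AddSubgroup.iSup_induction' with
    | h1 => simp
    | hadd x y _ _ hx hy => rw [TensorProduct.add_tmul]; exact add_mem hx hy
    | hp j m hm =>
    induction iSup_of_isInternal hN n using AddSubgroup.iSup_induction' with
    | h1 => simp
    | hadd x y _ _ hx hy => rw [TensorProduct.tmul_add]; exact add_mem hx hy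
    | hp l n hn =>
    exact (le_iSup (tensorDeg (B := B) ℳ 𝒩) (j + l))
      (AddSubgroup.subset_closure ⟨j, l, m, n, rfl, hm, hn, rfl⟩)

/-! ## Graded bimodules -/

/-- A graded `(A, B)`-bimodule for commutative `ℤ`-graded rings `A = ⨁ 𝒜 i`, `B = ⨁ ℬ i`. -/
structure GrBimod {A B : Type u} [CommRing A] [CommRing B]
    (𝒜 : ℤ → AddSubgroup A) (ℬ : ℤ → AddSubgroup B) where
  carrier : Type u
  [addCommGroup : AddCommGroup carrier]
  [left : Module A carrier]
  [right : Module Bᵐᵒᵖ carrier]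
  [comm : SMulCommClass A Bᵐᵒᵖ carrier]
  deg : ℤ → AddSubgroup carrier
  isInternal : DirectSum.IsInternal deg
  smul_mem : ∀ i j, ∀ a ∈ 𝒜 i, ∀ m ∈ deg j, a • m ∈ deg (i + j)
  op_smul_mem : ∀ i j, ∀ b ∈ ℬ i, ∀ m ∈ deg j, MulOpposite.op b • m ∈ deg (i + j)

namespace GrBimod

attribute [instance] addCommGroup left right comm

variable {A B C : Type u} [CommRing A] [CommRing B] [CommRing C]
  {𝒜 : ℤ → AddSubgroup A} {ℬ : ℤ → AddSubgroup B} {𝒞 : ℤ → AddSubgroup C}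

/-- Isomorphisms of graded bimodules: bijective bimodule morphisms, homogeneous of degree zero
in both directions. -/
structure Iso (M N : GrBimod 𝒜 ℬ) extends M.carrier ≃+ N.carrier where
  map_smul : ∀ (a : A) (m : M.carrier), toFun (a • m) = a • toFun m
  map_op_smul : ∀ (b : B) (m : M.carrier),
    toFun (MulOpposite.op b • m) = MulOpposite.op b • toFun m
  map_deg : ∀ (i : ℤ) (m : M.carrier), m ∈ M.deg i ↔ toFun m ∈ N.deg i

/-- The bimodule `M` viewed as a right module only. As `B` is commutative, this is written
as a `B`-module. -/
def Rt (M : GrBimod 𝒜 ℬ) : Type u := M.carrier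

instance (M : GrBimod 𝒜 ℬ) : AddCommGroup M.Rt := M.addCommGroup

instance (M : GrBimod 𝒜 ℬ) : Module B M.Rt :=
  Module.compHom M.carrier (RingEquiv.toOpposite B).toRingHom

/-- The left action of `A` on `M` by endomorphisms of the right module `M`. -/
def lmul (M : GrBimod 𝒜 ℬ) : A →+* Module.End B M.Rt where
  toFun a :=
    { toFun := fun (m : M.carrier) => a • m
      map_add' := fun (x y : M.carrier) => smul_add a x y
      map_smul' := fun b (x : M.carrier) => smul_comm a (MulOpposite.op b) x }
  map_one' := LinearMap.ext fun (x : M.carrier) => one_smul A x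
  map_mul' a b := LinearMap.ext fun (x : M.carrier) => mul_smul a b x
  map_zero' := LinearMap.ext fun (x : M.carrier) => zero_smul A x
  map_add' a b := LinearMap.ext fun (x : M.carrier) => add_smul a b x

/-- The right action of `B` on `M` by endomorphisms of the left module `M`. -/
def rmul (M : GrBimod 𝒜 ℬ) : Bᵐᵒᵖ →+* Module.End A M.carrier where
  toFun b :=
    { toFun := fun m => b • m
      map_add' := smul_add b
      map_smul' := fun a x => (smul_comm a b x).symm }
  map_one' := by ext x; exact one_smul _ x
  map_mul' a b := by ext x; exact mul_smul a b x
  map_zero' := by ext x; exact zero_smul _ x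
  map_add' a b := by ext x; exact add_smul a b x

/-- The tensor product `M ⊗_B N` of graded bimodules: `A` acts through `M`, `C` acts
through `N`, and the degree `d` part is spanned by the `m ⊗ n` with `m` and `n` homogeneous
and `deg m + deg n = d`. -/
noncomputable def tensor [GradedRing ℬ] (M : GrBimod 𝒜 ℬ) (N : GrBimod ℬ 𝒞) : GrBimod 𝒜 𝒞 :=
  letI l : Module A (M.Rt ⊗[B] N.carrier) := Module.compHom _
    ((Module.End.rTensorAlgHom B M.Rt N.carrier).toRingHom.comp M.lmul)
  letI r : Module Cᵐᵒᵖ (M.Rt ⊗[B] N.carrier) := Module.compHom _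
    ((Module.End.lTensorAlgHom B N.carrier M.Rt).toRingHom.comp N.rmul)
  { carrier := M.Rt ⊗[B] N.carrier
    left := l
    right := r
    comm := ⟨fun a c x => by
      change LinearMap.rTensor _ (M.lmul a) (LinearMap.lTensor _ (N.rmul c) x)
        = LinearMap.lTensor _ (N.rmul c) (LinearMap.rTensor _ (M.lmul a) x)
      rw [← LinearMap.comp_apply, ← LinearMap.comp_apply, LinearMap.rTensor_comp_lTensor,
        LinearMap.lTensor_comp_rTensor]⟩
    deg := tensorDeg (B := B) (M := M.Rt) M.deg N.deg
    isInternal := tensorDeg_isInternal (M := M.Rt) (DirectSum.Decomposition.isInternal ℬ)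
      M.isInternal N.isInternal M.op_smul_mem N.smul_mem
    smul_mem := by
      intro i j a ha x hx
      change LinearMap.rTensor _ (M.lmul a) x ∈ _
      induction hx using AddSubgroup.closure_induction with
      | zero => rw [map_zero]; exact zero_mem _
      | add x y _ _ hx hy => rw [map_add]; exact add_mem hx hy
      | neg x _ hx => rw [map_neg]; exact neg_mem hx
      | mem x hx =>
        obtain ⟨p, q, m, n, rfl, hm, hn, rfl⟩ := hx
        exact AddSubgroup.subset_closure ⟨i + p, q, M.lmul a m, n, by ring,
          M.smul_mem i p a ha m hm, hn, (LinearMap.rTensor_tmul _ _ _ _).symm⟩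
    op_smul_mem := by
      intro i j c hc x hx
      change LinearMap.lTensor _ (N.rmul (MulOpposite.op c)) x ∈ _
      induction hx using AddSubgroup.closure_induction with
      | zero => rw [map_zero]; exact zero_mem _
      | add x y _ _ hx hy => rw [map_add]; exact add_mem hx hy
      | neg x _ hx => rw [map_neg]; exact neg_mem hx
      | mem x hx =>
        obtain ⟨p, q, m, n, rfl, hm, hn, rfl⟩ := hx
        exact AddSubgroup.subset_closure ⟨p, i + q, m, N.rmul (MulOpposite.op c) n, by ring,
          hm, N.op_smul_mem i q c hc n hn, (LinearMap.lTensor_tmul _ _ _ _).symm⟩ }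

/-- A graded ring `C` as a graded `(A, B)`-bimodule through graded ring homomorphisms
`f : A → C` and `g : B → C`. -/
def ofHoms [SetLike.GradedMonoid 𝒞] (hC : DirectSum.IsInternal 𝒞) (f : A →+* C) (g : B →+* C)
    (hf : ∀ i, ∀ a ∈ 𝒜 i, f a ∈ 𝒞 i) (hg : ∀ i, ∀ b ∈ ℬ i, g b ∈ 𝒞 i) : GrBimod 𝒜 ℬ :=
  letI l : Module A C := Module.compHom C f
  letI r : Module Bᵐᵒᵖ C := Module.compHom C (g.comp (RingEquiv.toOpposite B).symm.toRingHom)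
  { carrier := C
    left := l
    right := r
    comm := ⟨fun a b x => mul_left_comm (f a) (g b.unop) x⟩
    deg := 𝒞
    isInternal := hC
    smul_mem := fun i _ a ha _ hm => SetLike.GradedMul.mul_mem (hf i a ha) hm
    op_smul_mem := fun i _ b hb _ hm => SetLike.GradedMul.mul_mem (hg i b hb) hm }

/-- Homogeneous components of an element annihilating `M` on the left annihilate `M`. -/
theorem decompose_mem_leftAnn [GradedRing 𝒜] (M : GrBimod 𝒜 ℬ) {a : A}
    (ha : a ∈ Module.annihilator A M.carrier) (i : ℤ) :
    (DirectSum.decompose 𝒜 a i : A) ∈ Module.annihilator A M.carrier := by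
  obtain ⟨D, hD⟩ := exists_split_of_isInternal _ M.isInternal
  rw [Module.mem_annihilator] at ha ⊢
  intro m
  induction iSup_of_isInternal M.isInternal m using AddSubgroup.iSup_induction' with
  | h1 => simp
  | hadd x y _ _ hx hy => rw [smul_add, hx, hy, add_zero]
  | hp j m hm =>
  have h : ∀ a : A, D (a • m) (i + j) = (DirectSum.decompose 𝒜 a i : A) • m := by
    intro a
    induction a using DirectSum.Decomposition.inductionOn 𝒜 with
    | zero => simp
    | add x y hx hy => simp [add_smul, hx, hy]
    | @homogeneous e a =>
      rw [hD _ _ (M.smul_mem e j a a.2 m hm), Finsupp.single_apply]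
      by_cases he : e = i
      · subst he; simp
      · rw [DirectSum.decompose_of_mem_ne _ a.2 he]; simp [he]
  rw [← h, ha m]; simp

/-- Exchanging the two sides of a bimodule. -/
def flip (M : GrBimod 𝒜 ℬ) : GrBimod ℬ 𝒜 :=
  letI l : Module B M.carrier := Module.compHom M.carrier (RingEquiv.toOpposite B).toRingHom
  letI r : Module Aᵐᵒᵖ M.carrier :=
    Module.compHom M.carrier (RingEquiv.toOpposite A).symm.toRingHom
  { carrier := M.carrier
    left := l
    right := r
    comm := ⟨fun b a x => (smul_comm a.unop (MulOpposite.op b) x).symm⟩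
    deg := M.deg
    isInternal := M.isInternal
    smul_mem := M.op_smul_mem
    op_smul_mem := M.smul_mem }

theorem decompose_mem_rightAnn [GradedRing ℬ] (M : GrBimod 𝒜 ℬ) {b : B}
    (hb : b ∈ Module.annihilator B M.Rt) (i : ℤ) :
    (DirectSum.decompose ℬ b i : B) ∈ Module.annihilator B M.Rt :=
  M.flip.decompose_mem_leftAnn hb i

end GrBimod

/-! ## Weyl lines in type `A_n` -/

section Geometry

variable (k : Type u) [Field k] (n : ℕ)

/-- The affine space `k^(n+1)`, on which `S_{n+1}` acts by permuting coordinates. -/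
abbrev Amb : Type u := Fin (n + 1) → k

/-- The geometric representation of type `A_n`: the hyperplane `x_0 + ... + x_n = 0` of
`k^(n+1)`. -/
def geomRep : Submodule k (Amb k n) where
  carrier := {x | ∑ i, x i = 0}
  zero_mem' := by simp
  add_mem' {x y} hx hy := by
    simp only [Set.mem_ofPred_eq, Pi.add_apply, Finset.sum_add_distrib] at *
    rw [hx, hy, add_zero]
  smul_mem' c x hx := by
    simp only [Set.mem_ofPred_eq, Pi.smul_apply, smul_eq_mul, ← Finset.mul_sum] at *
    rw [hx, mul_zero]

variable {n}

/-- The action of a permutation `w`: `(w x)_i = x_{w⁻¹ i}`. -/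
def permAct (w : Equiv.Perm (Fin (n + 1))) : Amb k n ≃ₗ[k] Amb k n :=
  LinearEquiv.funCongrLeft k k w⁻¹

/-- The hyperplane of `geomRep k n` fixed by `t`, when `t` is a reflection (transposition). -/
def hyperplane (t : Equiv.Perm (Fin (n + 1))) : Submodule k (Amb k n) :=
  geomRep k n ⊓ LinearMap.eqLocus (permAct k t).toLinearMap LinearMap.id

/-- A Weyl line: a line in the geometric representation which is the intersection of a set
of reflection hyperplanes. (For `n = 1` the geometric representation itself, an empty
intersection, is the unique Weyl line.) -/
def IsWeylLine (L : Submodule k (Amb k n)) : Prop :=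
  Module.finrank k L = 1 ∧ ∃ S : Set (Equiv.Perm (Fin (n + 1))), (∀ t ∈ S, t.IsSwap) ∧
    L = geomRep k n ⊓ ⨅ t ∈ S, hyperplane k t

variable (n) in
/-- `Z`, the union of all Weyl lines. -/
def weylUnion : Set (Amb k n) :=
  {x | ∃ L, IsWeylLine k L ∧ x ∈ L}

/-- `V_t`, the union of the Weyl lines transverse to `t`. -/
def transverse (t : Equiv.Perm (Fin (n + 1))) : Set (Amb k n) :=
  {x | ∃ L, IsWeylLine k L ∧ ¬ L ≤ hyperplane k t ∧ x ∈ L}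

/-- The simple transposition `s_i`; the `n` indices are numbered `0, ..., n - 1`. -/
def simple (i : Fin n) : Equiv.Perm (Fin (n + 1)) := Equiv.swap i.castSucc i.succ

/-- The variety `W_{i_1 ⋯ i_m}` of a sequence of indices, of length at least one. (By
convention the empty sequence gives `Z`.) -/
def seqVariety : List (Fin n) → Set (Amb k n)
  | [] => weylUnion k n
  | [i] => transverse k (simple i)
  | i :: j :: l => transverse k (simple i) ∩
      (seqVariety (j :: l) ∪ permAct k (simple i) '' seqVariety (j :: l))

/-! ## Regular functions -/

variable {k}

/-- The algebra `𝒪(X)` of regular functions on a subvariety `X` of affine space. -/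
abbrev Reg (X : Set (Amb k n)) : Type u :=
  MvPolynomial (Fin (n + 1)) k ⧸ MvPolynomial.vanishingIdeal k X

/-- The regular function on `X` given by a polynomial. -/
noncomputable abbrev toReg (X : Set (Amb k n)) : MvPolynomial (Fin (n + 1)) k →+* Reg X :=
  Ideal.Quotient.mk _

/-- Restriction of regular functions to a smaller variety. -/
noncomputable def restrict {X Y : Set (Amb k n)} (h : Y ⊆ X) : Reg X →+* Reg Y :=
  Ideal.Quotient.factor (MvPolynomial.vanishingIdeal_anti_mono h)

/-- The grading of `𝒪(X)`, with linear forms in degree `2`. -/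
noncomputable def regDeg (X : Set (Amb k n)) (d : ℤ) : AddSubgroup (Reg X) :=
  (MvPolynomial.weightedHomogeneousSubmodule k (fun _ : Fin (n + 1) => (2 : ℤ)) d).toAddSubgroup.map
    (toReg X).toAddMonoidHom

/-- Stable under the scalars; unions of lines through the origin have this property. -/
def IsCone (X : Set (Amb k n)) : Prop := ∀ x ∈ X, ∀ c : k, c • x ∈ X

instance (X : Set (Amb k n)) : SetLike.GradedMonoid (regDeg X) where
  one_mem := ⟨1, MvPolynomial.isWeightedHomogeneous_one _ _, map_one (toReg X)⟩
  mul_mem := by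
    rintro i j _ _ ⟨p, hp, rfl⟩ ⟨q, hq, rfl⟩
    exact ⟨p * q, MvPolynomial.IsWeightedHomogeneous.mul hp hq, map_mul (toReg X) _ _⟩

/-- `p(u² x)` as a polynomial in `u`: its coefficients are the values at `x` of the
homogeneous components of `p`. -/
theorem coeff_scale (x : Amb k n) (p : MvPolynomial (Fin (n + 1)) k) (m : ℕ) :
    (MvPolynomial.aeval (fun i => Polynomial.C (x i) * Polynomial.X ^ 2) p).coeff m =
      MvPolynomial.aeval x (MvPolynomial.weightedHomogeneousComponent
        (fun _ : Fin (n + 1) => (2 : ℤ)) (m : ℤ) p) := by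
  induction p using MvPolynomial.induction_on' with
  | add p q hp hq => simp [hp, hq]
  | monomial s c =>
    have h := MvPolynomial.isWeightedHomogeneous_monomial (fun _ : Fin (n + 1) => (2 : ℤ)) s c rfl
    have hw : Finsupp.weight (fun _ : Fin (n + 1) => (2 : ℤ)) s
        = ((2 * ∑ i, s i : ℕ) : ℤ) := by
      rw [Finsupp.weight_apply, Finsupp.sum_fintype _ _ (by simp)]
      push_cast
      rw [Finset.mul_sum]
      refine Finset.sum_congr rfl fun i _ => ?_
      simp [mul_comm]
    have hl : MvPolynomial.aeval (fun i => Polynomial.C (x i) * (Polynomial.X : Polynomial k) ^ 2)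
        (MvPolynomial.monomial s c)
        = Polynomial.C (MvPolynomial.aeval x (MvPolynomial.monomial s c))
          * Polynomial.X ^ (2 * ∑ i, s i) := by
      rw [MvPolynomial.aeval_monomial, MvPolynomial.aeval_monomial,
        Finsupp.prod_fintype _ _ (by simp), Finsupp.prod_fintype _ _ (by simp)]
      simp only [mul_pow, Finset.prod_mul_distrib, ← pow_mul, Finset.prod_pow_eq_pow_sum,
        map_mul, map_prod, map_pow, ← Finset.mul_sum]
      simp [mul_assoc]
    rw [hl, Polynomial.coeff_C_mul_X_pow]
    rw [hw] at h
    split_ifs with hm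
    · rw [hm, h.weightedHomogeneousComponent_same]
    · rw [h.weightedHomogeneousComponent_ne _ (by exact_mod_cast hm), map_zero]

theorem component_neg (p : MvPolynomial (Fin (n + 1)) k) {d : ℤ} (hd : d < 0) :
    MvPolynomial.weightedHomogeneousComponent (fun _ : Fin (n + 1) => (2 : ℤ)) d p = 0 := by
  refine MvPolynomial.weightedHomogeneousComponent_eq_zero' _ _ fun s _ h => ?_
  rw [Finsupp.weight_apply, Finsupp.sum_fintype _ _ (by simp)] at h
  have : (0 : ℤ) ≤ ∑ i, s i • (2 : ℤ) := Finset.sum_nonneg fun i _ => by positivity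
  omega

theorem component_mem_vanishingIdeal [CharZero k] {X : Set (Amb k n)} (hX : IsCone X)
    {p : MvPolynomial (Fin (n + 1)) k} (hp : p ∈ MvPolynomial.vanishingIdeal k X) (d : ℤ) :
    MvPolynomial.weightedHomogeneousComponent (fun _ : Fin (n + 1) => (2 : ℤ)) d p
      ∈ MvPolynomial.vanishingIdeal k X := by
  rcases lt_or_ge d 0 with hd | hd
  · rw [component_neg p hd]; exact zero_mem _
  · lift d to ℕ using hd
    intro x hx
    rw [← coeff_scale]
    have : MvPolynomial.aeval (fun i => Polynomial.C (x i) * Polynomial.X ^ 2) p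
        = (0 : Polynomial k) := by
      refine Polynomial.funext fun c => ?_
      rw [Polynomial.eval_zero, ← hp _ (hX x hx (c ^ 2)), ← Polynomial.coe_aeval_eq_eval,
        ← AlgHom.comp_apply]
      refine DFunLike.congr_fun (MvPolynomial.algHom_ext fun i => ?_) p
      rw [AlgHom.comp_apply, MvPolynomial.aeval_X, MvPolynomial.aeval_X]
      simp only [map_mul, map_pow, Polynomial.aeval_C, Polynomial.aeval_X, Pi.smul_apply,
        smul_eq_mul, Algebra.algebraMap_self, RingHom.id_apply]
      ring
    rw [this, Polynomial.coeff_zero]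

theorem regDeg_isInternal [CharZero k] {X : Set (Amb k n)} (hX : IsCone X) :
    DirectSum.IsInternal (regDeg X) := by
  obtain ⟨D, hD⟩ := exists_split_of_isInternal
    (MvPolynomial.weightedHomogeneousSubmodule k (fun _ : Fin (n + 1) => (2 : ℤ)))
    (@DirectSum.Decomposition.isInternal _ _ _ _ _ _ _ _
      (MvPolynomial.weightedDecomposition k (fun _ : Fin (n + 1) => (2 : ℤ))))
  have hc : ∀ p d, D p d = MvPolynomial.weightedHomogeneousComponent
      (fun _ : Fin (n + 1) => (2 : ℤ)) d p := by
    intro p d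
    induction p using MvPolynomial.induction_on' with
    | add p q hp hq => simp [hp, hq]
    | monomial s c =>
      have h := MvPolynomial.isWeightedHomogeneous_monomial
        (fun _ : Fin (n + 1) => (2 : ℤ)) s c rfl
      rw [hD _ _ h, Finsupp.single_apply]
      split_ifs with hm
      · subst hm; rw [h.weightedHomogeneousComponent_same]
      · rw [h.weightedHomogeneousComponent_ne _ (Ne.symm hm)]
  let E : Reg X →+ (ℤ →₀ Reg X) := QuotientAddGroup.lift _
    ((Finsupp.mapRange.addMonoidHom (toReg X).toAddMonoidHom).comp D) (by
      intro p hp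
      ext d
      simp only [AddMonoidHom.comp_apply, Finsupp.mapRange.addMonoidHom_apply,
        Finsupp.mapRange_apply, hc, Finsupp.coe_zero, Pi.zero_apply]
      exact Ideal.Quotient.eq_zero_iff_mem.2 (component_mem_vanishingIdeal hX hp d))
  have hE : ∀ p, E (toReg X p) = Finsupp.mapRange.addMonoidHom (toReg X).toAddMonoidHom (D p) :=
    fun _ => rfl
  refine isInternal_of_split _ E ?_ ?_
  · rintro d _ ⟨p, hp, rfl⟩
    refine (hE p).trans ?_
    rw [hD d p hp]
    simp
  · intro f
    obtain ⟨p, rfl⟩ := Ideal.Quotient.mk_surjective f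
    induction p using MvPolynomial.induction_on' with
    | add p q hp hq => rw [map_add]; exact add_mem hp hq
    | monomial s c =>
      exact (le_iSup (regDeg X) _) ⟨_, MvPolynomial.isWeightedHomogeneous_monomial
        (fun _ : Fin (n + 1) => (2 : ℤ)) s c rfl, rfl⟩

theorem restrict_mem {X Y : Set (Amb k n)} (h : Y ⊆ X) (d : ℤ) (f : Reg X)
    (hf : f ∈ regDeg X d) : restrict h f ∈ regDeg Y d := by
  obtain ⟨p, hp, rfl⟩ := hf
  exact ⟨p, hp, rfl⟩

/-- The action of a permutation `w` on the regular functions on a `w`-stable variety: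
`(w f)(x) = f (w⁻¹ x)`. -/
noncomputable def regAct (w : Equiv.Perm (Fin (n + 1))) {X : Set (Amb k n)}
    (h : ∀ x ∈ X, permAct k w⁻¹ x ∈ X) : Reg X →+* Reg X :=
  Ideal.quotientMap _ (MvPolynomial.rename w).toRingHom (by
    intro p hp x hx
    have : MvPolynomial.aeval (x ∘ w) p = 0 := hp _ (h x hx)
    change MvPolynomial.aeval x (MvPolynomial.rename w p) = 0
    rw [MvPolynomial.aeval_rename]
    exact this)

theorem regAct_mem (w : Equiv.Perm (Fin (n + 1))) {X : Set (Amb k n)}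
    (h : ∀ x ∈ X, permAct k w⁻¹ x ∈ X) (d : ℤ) (f : Reg X) (hf : f ∈ regDeg X d) :
    regAct w h f ∈ regDeg X d := by
  obtain ⟨p, hp, rfl⟩ := hf
  refine ⟨MvPolynomial.rename w p, ?_, rfl⟩
  intro s hs
  obtain ⟨r, rfl, hr⟩ := MvPolynomial.coeff_rename_ne_zero _ _ _ hs
  rw [← hp hr, Finsupp.weight_apply, Finsupp.weight_apply, Finsupp.sum_mapDomain_index]
  · simp
  · intro _ a b; rw [add_smul]

/-- The subring of invariants `𝒪(X)^w`. -/
noncomputable def invariants (w : Equiv.Perm (Fin (n + 1))) {X : Set (Amb k n)}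
    (h : ∀ x ∈ X, permAct k w⁻¹ x ∈ X) : Subring (Reg X) :=
  (regAct w h).eqLocus (RingHom.id _)

/-- The induced grading of `𝒪(X)^w`. -/
noncomputable def invDeg (w : Equiv.Perm (Fin (n + 1))) {X : Set (Amb k n)}
    (h : ∀ x ∈ X, permAct k w⁻¹ x ∈ X) (d : ℤ) : AddSubgroup (invariants w h) :=
  (regDeg X d).comap (invariants w h).subtype.toAddMonoidHom

theorem invDeg_isInternal [CharZero k] (w : Equiv.Perm (Fin (n + 1))) {X : Set (Amb k n)}
    (hX : IsCone X) (h : ∀ x ∈ X, permAct k w⁻¹ x ∈ X) :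
    DirectSum.IsInternal (invDeg w h) := by
  classical
  let := (regDeg_isInternal hX).chooseDecomposition
  have hdec : ∀ f : Reg X, ∀ d, regAct w h (DirectSum.decompose (regDeg X) f d)
      = DirectSum.decompose (regDeg X) (regAct w h f) d := by
    intro f d
    induction f using DirectSum.Decomposition.inductionOn (regDeg X) with
    | zero => simp
    | add x y hx hy => simp [hx, hy]
    | @homogeneous e f =>
      by_cases he : e = d
      · subst he
        rw [DirectSum.decompose_of_mem_same _ f.2,
          DirectSum.decompose_of_mem_same _ (regAct_mem w h _ _ f.2)]
      · rw [DirectSum.decompose_of_mem_ne _ f.2 he,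
          DirectSum.decompose_of_mem_ne _ (regAct_mem w h _ _ f.2) he, map_zero]
  constructor
  · intro x y hxy
    have hinj := (regDeg_isInternal hX).1
    let ι : (⨁ d, invDeg w h d) →+ ⨁ d, regDeg X d :=
      DirectSum.map fun d =>
        ((invariants w h).subtype.toAddMonoidHom.comp (invDeg w h d).subtype).codRestrict
          (regDeg X d) (fun f => f.2)
    have hι : ∀ x, DirectSum.coeAddMonoidHom (regDeg X) (ι x)
        = (DirectSum.coeAddMonoidHom (invDeg w h) x : invariants w h) := by
      intro x
      induction x using DirectSum.induction_on with
      | zero => simp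
      | of i y =>
        simp only [ι, DirectSum.map_of, DirectSum.coeAddMonoidHom_of]
        rfl
      | add x y hx hy => simp [hx, hy]
    have h2 : ι x = ι y := hinj (by rw [hι, hι, hxy])
    ext d
    have := congrArg (fun z => (z d : Reg X)) h2
    simpa [ι, DirectSum.map_apply] using this
  · intro f
    have hmem : ∀ d, (DirectSum.decompose (regDeg X) (f : Reg X) d : Reg X)
        ∈ invariants w h := by
      intro d
      refine (hdec f d).trans ?_
      rw [show regAct w h (f : Reg X) = f from f.2]
      rfl
    have hf : f = ∑ d ∈ (DirectSum.decompose (regDeg X) (f : Reg X)).support,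
        (⟨_, hmem d⟩ : invariants w h) := by
      apply Subtype.ext
      refine (DirectSum.sum_support_decompose (regDeg X) (f : Reg X)).symm.trans ?_
      rw [AddSubmonoidClass.coe_finsetSum]
    rw [hf]
    refine ⟨∑ d ∈ (DirectSum.decompose (regDeg X) (f : Reg X)).support,
      DirectSum.of (fun d => invDeg w h d) d ⟨⟨_, hmem d⟩,
        SetLike.coe_mem (DirectSum.decompose (regDeg X) (f : Reg X) d)⟩, ?_⟩
    rw [map_sum]
    exact Finset.sum_congr rfl fun d _ => DirectSum.coeAddMonoidHom_of _ _ _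

/-! ## The product of bimodules -/

theorem weylUnion_isCone : IsCone (weylUnion k n) := by
  rintro x ⟨L, hL, hx⟩ c
  exact ⟨L, hL, L.smul_mem c hx⟩

theorem transverse_isCone (t : Equiv.Perm (Fin (n + 1))) : IsCone (transverse k t) := by
  rintro x ⟨L, hL, hL', hx⟩ c
  exact ⟨L, hL, hL', L.smul_mem c hx⟩

theorem transverse_subset (t : Equiv.Perm (Fin (n + 1))) : transverse k t ⊆ weylUnion k n := by
  rintro x ⟨L, hL, _, hx⟩
  exact ⟨L, hL, hx⟩

theorem permAct_mul (v w : Equiv.Perm (Fin (n + 1))) (x : Amb k n) :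
    permAct k (v * w) x = permAct k v (permAct k w x) := by
  ext i
  simp [permAct, LinearEquiv.funCongrLeft, LinearMap.funLeft]

theorem permAct_mem_geomRep (w : Equiv.Perm (Fin (n + 1))) (x : Amb k n) :
    permAct k w x ∈ geomRep k n ↔ x ∈ geomRep k n := by
  change ∑ i, x (w⁻¹ i) = 0 ↔ ∑ i, x i = 0
  rw [Equiv.sum_comp]

theorem permAct_mem_hyperplane (w t : Equiv.Perm (Fin (n + 1))) (x : Amb k n) :
    permAct k w x ∈ hyperplane k (w * t * w⁻¹) ↔ x ∈ hyperplane k t := by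
  change (permAct k w x ∈ geomRep k n ∧ permAct k _ _ = permAct k w x) ↔
    (x ∈ geomRep k n ∧ permAct k t x = x)
  rw [permAct_mem_geomRep, ← permAct_mul, inv_mul_cancel_right, permAct_mul,
    (permAct k w).injective.eq_iff]

theorem IsWeylLine.map {L : Submodule k (Amb k n)} (hL : IsWeylLine k L)
    (w : Equiv.Perm (Fin (n + 1))) : IsWeylLine k (L.map (permAct k w).toLinearMap) := by
  obtain ⟨h1, S, hS, rfl⟩ := hL
  refine ⟨(LinearEquiv.finrank_map_eq _ _).trans h1,
    (fun t => w * t * w⁻¹) '' S, ?_, ?_⟩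
  · rintro _ ⟨t, ht, rfl⟩
    obtain ⟨a, b, hab, rfl⟩ := hS t ht
    exact ⟨w a, w b, w.injective.ne hab, (Equiv.swap_apply_apply w a b).symm⟩
  · ext x
    obtain ⟨y, rfl⟩ := (permAct k w).surjective x
    have : permAct k w y ∈ Submodule.map (permAct k w).toLinearMap
        (geomRep k n ⊓ ⨅ t ∈ S, hyperplane k t) ↔ y ∈ geomRep k n ⊓ ⨅ t ∈ S, hyperplane k t :=
      ⟨fun ⟨z, hz, hzy⟩ => (permAct k w).injective hzy ▸ hz, fun h => ⟨y, h, rfl⟩⟩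
    refine Iff.trans this ?_
    simp [Submodule.mem_iInf, permAct_mem_geomRep, permAct_mem_hyperplane]

/-- `V_t` is stable under `t`. -/
theorem transverse_stable (t : Equiv.Perm (Fin (n + 1))) :
    ∀ x ∈ transverse k t, permAct k t⁻¹ x ∈ transverse k t := by
  rintro x ⟨L, hL, hL', hx⟩
  refine ⟨L.map (permAct k t⁻¹).toLinearMap, hL.map _, fun h => hL' fun y hy => ?_,
    Submodule.mem_map_of_mem hx⟩
  have := h (Submodule.mem_map_of_mem hy)
  have h2 := (permAct_mem_hyperplane (k := k) t⁻¹ t y)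
  simp only [inv_mul_cancel, one_mul, inv_inv] at h2
  exact h2.1 this

variable (k n) in
/-- The grading of `R̄ = 𝒪(Z)`. -/
noncomputable abbrev barDeg : ℤ → AddSubgroup (Reg (weylUnion k n)) := regDeg (weylUnion k n)

noncomputable instance [CharZero k] : GradedRing (barDeg k n) where
  toDecomposition := (regDeg_isInternal weylUnion_isCone).chooseDecomposition

variable (k n) in
/-- Graded `(R̄, R̄)`-bimodules. -/
abbrev BarBimod : Type (u + 1) := GrBimod (barDeg k n) (barDeg k n)

/-- The closed subvariety of `Z` defined by an ideal of `R̄`. -/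
def locus (I : Ideal (Reg (weylUnion k n))) : Set (Amb k n) :=
  weylUnion k n ∩ MvPolynomial.zeroLocus k (I.comap (toReg (weylUnion k n)))

/-- `V_B^ℓ`, the variety of the left annihilator of `B`. -/
def leftVariety (B : BarBimod k n) : Set (Amb k n) :=
  locus (Module.annihilator (Reg (weylUnion k n)) B.carrier)

/-- `V_B^r`, the variety of the right annihilator of `B`. -/
def rightVariety (B : BarBimod k n) : Set (Amb k n) :=
  locus (Module.annihilator (Reg (weylUnion k n)) B.Rt)

theorem decompose_toReg [CharZero k] (p : MvPolynomial (Fin (n + 1)) k) (d : ℤ) :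
    (DirectSum.decompose (barDeg k n) (toReg _ p) d : Reg (weylUnion k n)) =
      toReg _ (MvPolynomial.weightedHomogeneousComponent (fun _ : Fin (n + 1) => (2 : ℤ)) d p) := by
  induction p using MvPolynomial.induction_on' with
  | add p q hp hq => simp only [map_add, DirectSum.decompose_add, DirectSum.add_apply,
      AddSubgroup.coe_add, hp, hq]
  | monomial s c =>
    have h := MvPolynomial.isWeightedHomogeneous_monomial
      (fun _ : Fin (n + 1) => (2 : ℤ)) s c rfl
    have h' : toReg (weylUnion k n) (MvPolynomial.monomial s c) ∈ barDeg k n _ := ⟨_, h, rfl⟩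
    by_cases hd : Finsupp.weight (fun _ : Fin (n + 1) => (2 : ℤ)) s = d
    · subst hd
      rw [DirectSum.decompose_of_mem_same _ h', h.weightedHomogeneousComponent_same]
    · rw [DirectSum.decompose_of_mem_ne _ h' hd,
        h.weightedHomogeneousComponent_ne _ (Ne.symm hd), map_zero]

theorem locus_isCone [CharZero k] {I : Ideal (Reg (weylUnion k n))}
    (hI : ∀ f ∈ I, ∀ d, (DirectSum.decompose (barDeg k n) f d : Reg (weylUnion k n)) ∈ I) :
    IsCone (locus I) := by
  rintro x ⟨hxZ, hx⟩ c
  refine ⟨weylUnion_isCone x hxZ c, fun p hp => ?_⟩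
  have hcomp : ∀ d, MvPolynomial.aeval x (MvPolynomial.weightedHomogeneousComponent
      (fun _ : Fin (n + 1) => (2 : ℤ)) d p) = 0 := by
    intro d
    refine hx _ (?_ : toReg _ _ ∈ I)
    rw [← decompose_toReg]
    exact hI _ hp d
  have hscale : ∀ d, MvPolynomial.aeval (c • x) (MvPolynomial.weightedHomogeneousComponent
      (fun _ : Fin (n + 1) => (2 : ℤ)) d p) = 0 := by
    intro d
    set q := MvPolynomial.weightedHomogeneousComponent (fun _ : Fin (n + 1) => (2 : ℤ)) d p
      with hq
    have hqw : q.IsWeightedHomogeneous (fun _ : Fin (n + 1) => (2 : ℤ)) d :=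
      MvPolynomial.weightedHomogeneousComponent_isWeightedHomogeneous _ _
    have : MvPolynomial.aeval (c • x) q = c ^ (d.toNat / 2) * MvPolynomial.aeval x q := by
      rw [MvPolynomial.aeval_def, MvPolynomial.aeval_def, MvPolynomial.eval₂_eq',
        MvPolynomial.eval₂_eq', Finset.mul_sum]
      refine Finset.sum_congr rfl fun s hs => ?_
      have hw := hqw (MvPolynomial.mem_support_iff.1 hs)
      rw [Finsupp.weight_apply, Finsupp.sum_fintype _ _ (by simp)] at hw
      have hw' : ((2 * ∑ i, s i : ℕ) : ℤ) = d := by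
        rw [← hw]
        push_cast
        rw [Finset.mul_sum]
        exact Finset.sum_congr rfl fun i _ => by simp [mul_comm]
      have : d.toNat / 2 = ∑ i, s i := by omega
      rw [this]
      simp only [Pi.smul_apply, smul_eq_mul, mul_pow, Finset.prod_mul_distrib,
        Finset.prod_pow_eq_pow_sum]
      ring
    rw [this, hcomp, mul_zero]
  rw [← MvPolynomial.sum_weightedHomogeneousComponent (fun _ : Fin (n + 1) => (2 : ℤ)) p,
    finsum_eq_sum _ (MvPolynomial.weightedHomogeneousComponent_finsupp p), map_sum]
  exact Finset.sum_eq_zero fun d _ => hscale d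

theorem leftVariety_isCone [CharZero k] (B : BarBimod k n) : IsCone (leftVariety B) :=
  locus_isCone fun _ hf d => B.decompose_mem_leftAnn hf d

theorem rightVariety_isCone [CharZero k] (B : BarBimod k n) : IsCone (rightVariety B) :=
  locus_isCone fun _ hf d => B.decompose_mem_rightAnn hf d

/-- `𝒪(X)` as a graded `(R̄, R̄)`-bimodule, for a conical subvariety `X` of `Z`. -/
noncomputable def regBimod [CharZero k] {X : Set (Amb k n)} (hX : IsCone X)
    (h : X ⊆ weylUnion k n) : BarBimod k n :=
  GrBimod.ofHoms (regDeg_isInternal hX) (restrict h) (restrict h) (restrict_mem h)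
    (restrict_mem h)

/-- The product `B ∗ B' = B ⊗_R̄ 𝒪(V_B^r ∩ V_{B'}^ℓ) ⊗_R̄ B'`. -/
noncomputable def star [CharZero k] (B B' : BarBimod k n) : BarBimod k n :=
  (B.tensor (regBimod (X := rightVariety B ∩ leftVariety B')
    (fun x hx c => ⟨rightVariety_isCone B x hx.1 c, leftVariety_isCone B' x hx.2 c⟩)
    (fun _ hx => hx.1.1))).tensor B'

/-- The grading of the ring of invariants `R_i^{s_i}`, where `R_i = 𝒪(V_i)`. -/
noncomputable abbrev simpleInvDeg (i : Fin n) :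
    ℤ → AddSubgroup (invariants (simple i) (transverse_stable (k := k) (simple i))) :=
  invDeg (simple i) (transverse_stable (k := k) (simple i))

noncomputable instance [CharZero k] (i : Fin n) : GradedRing (simpleInvDeg (k := k) i) where
  one_mem := SetLike.GradedOne.one_mem (A := regDeg (transverse k (simple i)))
  mul_mem _ _ _ _ hf hg :=
    SetLike.GradedMul.mul_mem (A := regDeg (transverse k (simple i))) hf hg
  toDecomposition :=
    (invDeg_isInternal _ (transverse_isCone _) (transverse_stable _)).chooseDecomposition

variable (k) in
/-- `B_i = R_i ⊗_{R_i^{s_i}} R_i`. -/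
noncomputable def simpleBimod [CharZero k] (i : Fin n) : BarBimod k n :=
  GrBimod.tensor (ℬ := simpleInvDeg i)
    (GrBimod.ofHoms (regDeg_isInternal (transverse_isCone (simple i)))
      (restrict (transverse_subset _)) (Subring.subtype _) (restrict_mem _) (fun _ _ hb => hb))
    (GrBimod.ofHoms (regDeg_isInternal (transverse_isCone (simple i)))
      (Subring.subtype _) (restrict (transverse_subset _)) (fun _ _ hb => hb) (restrict_mem _))

variable (k) in
/-- `B_{i_k ⋯ i_1} = B_{i_k} ∗ B_{i_{k-1} ⋯ i_1}`, for a nonempty sequence of indices. (By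
convention the empty sequence gives `R̄`.) -/
noncomputable def seqBimod [CharZero k] : List (Fin n) → BarBimod k n
  | [] => regBimod weylUnion_isCone subset_rfl
  | [i] => simpleBimod k i
  | i :: j :: l => star (simpleBimod k i) (seqBimod (j :: l))

/-- `IsAssociated l B`: the bimodule `B` is a `∗`-product of the `B_i`, with `i` running through
the nonempty sequence `l` in order, for some choice of brackets. -/
inductive IsAssociated [CharZero k] : List (Fin n) → BarBimod k n → Prop
  | single (i : Fin n) : IsAssociated [i] (simpleBimod k i)
  | mul {l l' : List (Fin n)} {B B' : BarBimod k n} :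
      IsAssociated l B → IsAssociated l' B' → IsAssociated (l ++ l') (star B B')

/-- For an `𝒪(X)`-module `M`: the action factors through `𝒪(Y)` (both `𝒪(X)` and `𝒪(Y)` being
quotients of the polynomial ring), and `M` is free over `𝒪(Y)`. -/
def IsFreeOver {X : Set (Amb k n)} (Y : Set (Amb k n)) (M : Type u) [AddCommGroup M]
    [Module (Reg X) M] : Prop :=
  ∃ _ : Module (Reg Y) M,
    (∀ (p : MvPolynomial (Fin (n + 1)) k) (m : M), toReg Y p • m = toReg X p • m) ∧
      Module.Free (Reg Y) M

end Geometry
end WeylBimod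

/-! A Weyl line of type `A_n` amounts to a partition of the coordinates into two nonempty blocks,
that is, to a nonconstant colouring by `±1` up to a global sign. Twisting the colouring by `(-1)^j`
gives a sign vector `η`, and the line is transverse to the simple transposition of two adjacent
places exactly when `η` agrees at these places. On such lines the transposition acts by changing
both signs. It follows that each `V_i`, and by induction each `W`, is a union of lines whose sign
vector is constant along a set `E` of pairs (`transverse_eq`, `mem_signings_stepEdges`,
`seqVariety_cons_eq`). The geometry thus becomes combinatorics of the varieties `edgeVar k E`.

Associativity of `∗`. Both bracketings of a triple product are to be compared with `B ⊗ 𝒪 ⊗ N ⊗ 𝒪 ⊗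
M`, whose middle terms are cut out by the supports of neighbouring factors only. Passing from the
support of a product to that of one factor costs nothing as long as the scheme-theoretic
intersections of supports are reduced. For varieties `edgeVar k E` and `edgeVar k F` whose edge sets
share a pair of opposite parity this is `vanishingIdeal_union_le`: the edges of `F` are added one at
a time, and each costs a single linear form. The result is `starAssoc`.

Freeness. Multiplying `N`, free over `𝒪(W)`, by `B_i` on the left gives `R_i ⊗_{R_i^{s_i}} (𝒪(Y) ⊗
N)` with `Y = V_i ∩ W`, and the claim is freeness over `𝒪(Y')` with `Y' = V_i ∩ (W ∪ s_i W)`. Two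
cases suffice (`splitting_stepEdges`). If no edge joins the two places of `s_i` to other places,
then `Y = Y'` is stable, `𝒪(Y)` splits into invariants and the root times invariants, and the rank
doubles. If some edge does, every function on `Y` is the restriction of an invariant function that
is unique on `Y'`, and the rank is unchanged.

These two threads are tied by a strong induction on the length of the sequence (`coherent`).
Freeness identifies left supports; right supports come from the isomorphism between the flipped
bimodule of a sequence and the bimodule of the reversed sequence, which itself uses associativity
for that length and both statements for shorter lengths. -/

namespace WeylBimod

open DirectSum TensorProduct

/-! ### Isomorphisms, tensor products, flips and associators of graded bimodules. -/

namespace GrBimod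

variable {A B C D : Type u} [CommRing A] [CommRing B] [CommRing C] [CommRing D]
  {𝒜 : ℤ → AddSubgroup A} {ℬ : ℤ → AddSubgroup B} {𝒞 : ℤ → AddSubgroup C}
  {𝒟 : ℤ → AddSubgroup D}

namespace Iso

/-- An isomorphism of graded bimodules from two mutually inverse homogeneous maps. -/
def ofInverse {M N : GrBimod 𝒜 ℬ} (f : M.carrier →+ N.carrier) (g : N.carrier →+ M.carrier)
    (hgf : ∀ m, g (f m) = m) (hfg : ∀ n, f (g n) = n)
    (hs : ∀ (a : A) (m : M.carrier), f (a • m) = a • f m)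
    (ho : ∀ (b : B) (m : M.carrier), f (MulOpposite.op b • m) = MulOpposite.op b • f m)
    (hf : ∀ i, ∀ m ∈ M.deg i, f m ∈ N.deg i) (hg : ∀ i, ∀ n ∈ N.deg i, g n ∈ M.deg i) :
    Iso M N where
  toFun := f
  invFun := g
  left_inv := hgf
  right_inv := hfg
  map_add' := f.map_add
  map_smul := hs
  map_op_smul := ho
  map_deg := fun i m => ⟨hf i m, fun h => hgf m ▸ hg i _ h⟩

/-- The identity isomorphism. -/
def refl (M : GrBimod 𝒜 ℬ) : Iso M M :=
  ofInverse (AddMonoidHom.id _) (AddMonoidHom.id _) (fun _ => rfl) (fun _ => rfl)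
    (fun _ _ => rfl) (fun _ _ => rfl) (fun _ _ h => h) (fun _ _ h => h)

/-- Composition of isomorphisms. -/
def trans {M N P : GrBimod 𝒜 ℬ} (e : Iso M N) (f : Iso N P) : Iso M P where
  toAddEquiv := e.toAddEquiv.trans f.toAddEquiv
  map_smul := fun a m => (congrArg f.toFun (e.map_smul a m)).trans (f.map_smul a _)
  map_op_smul := fun b m => (congrArg f.toFun (e.map_op_smul b m)).trans (f.map_op_smul b _)
  map_deg := fun i m => (e.map_deg i m).trans (f.map_deg i _)

/-- The inverse of an isomorphism. -/
def symm {M N : GrBimod 𝒜 ℬ} (e : Iso M N) : Iso N M where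
  toAddEquiv := e.toAddEquiv.symm
  map_smul := fun a n => e.injective <| by
    refine Eq.trans ?_ (e.map_smul a _).symm
    refine (e.right_inv _).trans (congrArg (a • ·) (e.right_inv n).symm)
  map_op_smul := fun b n => e.injective <| by
    refine Eq.trans ?_ (e.map_op_smul b _).symm
    refine (e.right_inv _).trans (congrArg (MulOpposite.op b • ·) (e.right_inv n).symm)
  map_deg := fun i n => by
    refine Iff.trans ?_ (e.map_deg i _).symm
    rw [show e.toFun (e.toAddEquiv.symm.toFun n) = n from e.right_inv n]

/-- Exchanging the two sides of an isomorphism. -/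
def flip {M N : GrBimod 𝒜 ℬ} (e : Iso M N) : Iso M.flip N.flip where
  toAddEquiv := e.toAddEquiv
  map_smul := e.map_op_smul
  map_op_smul := e.map_smul
  map_deg := e.map_deg

/-- Exchanging the two sides twice. -/
def flipFlip (M : GrBimod 𝒜 ℬ) : Iso M.flip.flip M :=
  ofInverse (M := M.flip.flip) (N := M) (AddMonoidHom.id M.carrier) (AddMonoidHom.id M.carrier)
    (fun _ => rfl) (fun _ => rfl) (fun _ _ => rfl) (fun _ _ => rfl) (fun _ _ h => h)
    (fun _ _ h => h)

theorem leftAnn_eq {M N : GrBimod 𝒜 ℬ} (e : Iso M N) :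
    Module.annihilator A M.carrier = Module.annihilator A N.carrier := by
  ext a
  rw [Module.mem_annihilator, Module.mem_annihilator]
  constructor
  · intro h n
    obtain ⟨m, rfl⟩ := e.surjective n
    exact (e.map_smul a m).symm.trans ((congrArg e.toFun (h m)).trans e.map_zero)
  · intro h m
    exact e.injective ((e.map_smul a m).trans ((h _).trans e.map_zero.symm))

theorem rightAnn_eq {M N : GrBimod 𝒜 ℬ} (e : Iso M N) :
    Module.annihilator B M.Rt = Module.annihilator B N.Rt :=
  e.flip.leftAnn_eq

end Iso

section Tensor

variable [GradedRing ℬ]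

/-- The pure tensors of a tensor product of graded bimodules. -/
noncomputable def tmul (M : GrBimod 𝒜 ℬ) (N : GrBimod ℬ 𝒞) (m : M.carrier) (n : N.carrier) :
    (M.tensor N).carrier :=
  TensorProduct.tmul B (M := M.Rt) (N := N.carrier) m n

variable {M : GrBimod 𝒜 ℬ} {N : GrBimod ℬ 𝒞}

theorem add_tmul (m m' : M.carrier) (n : N.carrier) :
    tmul M N (m + m') n = tmul M N m n + tmul M N m' n :=
  TensorProduct.add_tmul (M := M.Rt) (N := N.carrier) m m' n

theorem tmul_add (m : M.carrier) (n n' : N.carrier) :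
    tmul M N m (n + n') = tmul M N m n + tmul M N m n' :=
  TensorProduct.tmul_add (M := M.Rt) (N := N.carrier) m n n'

theorem tmul_zero (m : M.carrier) : tmul M N m 0 = 0 :=
  TensorProduct.tmul_zero (M := M.Rt) N.carrier m

theorem op_smul_tmul (b : B) (m : M.carrier) (n : N.carrier) :
    tmul M N (MulOpposite.op b • m) n = tmul M N m (b • n) :=
  TensorProduct.smul_tmul (M := M.Rt) (N := N.carrier) b m n

theorem smul_tmul (a : A) (m : M.carrier) (n : N.carrier) :
    a • tmul M N m n = tmul M N (a • m) n :=
  LinearMap.rTensor_tmul (R := B) N.carrier (M.lmul a) n m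

theorem op_smul_tmul_right (c : C) (m : M.carrier) (n : N.carrier) :
    MulOpposite.op c • tmul M N m n = tmul M N m (MulOpposite.op c • n) :=
  LinearMap.lTensor_tmul (R := B) M.Rt (N.rmul (MulOpposite.op c)) m n

theorem tmul_mem {i j d : ℤ} (h : i + j = d) {m : M.carrier} {n : N.carrier} (hm : m ∈ M.deg i)
    (hn : n ∈ N.deg j) : tmul M N m n ∈ (M.tensor N).deg d :=
  AddSubgroup.subset_closure ⟨i, j, m, n, h, hm, hn, rfl⟩

theorem tensor_induction {p : (M.tensor N).carrier → Prop} (x : (M.tensor N).carrier)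
    (zero : p 0) (tmul : ∀ m n, p (tmul M N m n)) (add : ∀ x y, p x → p y → p (x + y)) : p x :=
  TensorProduct.induction_on (R := B) (M := M.Rt) (N := N.carrier) x zero tmul add

/-- Additive maps out of a tensor product of graded bimodules. -/
noncomputable def lift {P : Type*} [AddCommGroup P] (f : M.carrier →+ N.carrier →+ P)
    (hf : ∀ (b : B) (m : M.carrier) (n : N.carrier), f (MulOpposite.op b • m) n = f m (b • n)) :
    (M.tensor N).carrier →+ P :=
  TensorProduct.liftAddHom (R := B) (M := M.Rt) (N := N.carrier) f hf

@[simp]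
theorem lift_tmul {P : Type*} [AddCommGroup P] (f : M.carrier →+ N.carrier →+ P)
    (hf : ∀ (b : B) (m : M.carrier) (n : N.carrier), f (MulOpposite.op b • m) n = f m (b • n))
    (m : M.carrier) (n : N.carrier) : lift f hf (tmul M N m n) = f m n :=
  TensorProduct.liftAddHom_tmul (R := B) (M := M.Rt) (N := N.carrier) f hf m n

theorem tensor_hom_ext {P : Type*} [AddCommGroup P] {f g : (M.tensor N).carrier →+ P}
    (h : ∀ m n, f (tmul M N m n) = g (tmul M N m n)) : f = g := by
  ext x
  induction x using tensor_induction with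
  | zero => rw [map_zero, map_zero]
  | tmul m n => exact h m n
  | add x y hx hy => rw [map_add, map_add, hx, hy]

/-- The homogeneous parts of a tensor product are generated by pure tensors of homogeneous elements,
so homogeneity of a map can be tested on those. -/
theorem map_tensor_deg_le {P : Type*} [AddCommGroup P] (f : (M.tensor N).carrier →+ P)
    (𝒬 : ℤ → AddSubgroup P)
    (h : ∀ i j, ∀ m ∈ M.deg i, ∀ n ∈ N.deg j, f (tmul M N m n) ∈ 𝒬 (i + j)) (d : ℤ)
    (x : (M.tensor N).carrier) (hx : x ∈ (M.tensor N).deg d) : f x ∈ 𝒬 d := by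
  have : (M.tensor N).deg d ≤ (𝒬 d).comap f := by
    refine (AddSubgroup.closure_le _).2 ?_
    rintro _ ⟨i, j, m, n, rfl, hm, hn, rfl⟩
    exact h i j m hm n hn
  exact this hx

/-- The biadditive map of pure tensors. -/
noncomputable def tmulHom (M : GrBimod 𝒜 ℬ) (N : GrBimod ℬ 𝒞) :
    M.carrier →+ N.carrier →+ (M.tensor N).carrier :=
  AddMonoidHom.mk' (fun m => AddMonoidHom.mk' (tmul M N m) (tmul_add m))
    fun m m' => AddMonoidHom.ext (add_tmul m m')

@[simp]
theorem tmulHom_apply (m : M.carrier) (n : N.carrier) : tmulHom M N m n = tmul M N m n := rfl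

/-- An isomorphism out of a tensor product, checked on pure tensors. -/
noncomputable def isoOfLift {P : GrBimod 𝒜 𝒞} (f : M.carrier →+ N.carrier →+ P.carrier)
    (hf : ∀ (b : B) (m : M.carrier) (n : N.carrier), f (MulOpposite.op b • m) n = f m (b • n))
    (g : P.carrier →+ (M.tensor N).carrier)
    (hgf : ∀ m n, g (f m n) = tmul M N m n) (hfg : ∀ p, lift f hf (g p) = p)
    (hs : ∀ (a : A) m n, f (a • m) n = a • f m n)
    (ho : ∀ (c : C) m n, f m (MulOpposite.op c • n) = MulOpposite.op c • f m n)
    (hfd : ∀ i j, ∀ m ∈ M.deg i, ∀ n ∈ N.deg j, f m n ∈ P.deg (i + j))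
    (hgd : ∀ i, ∀ p ∈ P.deg i, g p ∈ (M.tensor N).deg i) : Iso (M.tensor N) P :=
  Iso.ofInverse (lift f hf) g
    (DFunLike.congr_fun (f := g.comp (lift f hf)) (g := AddMonoidHom.id _)
      (tensor_hom_ext fun m n => by simp [hgf]))
    hfg
    (fun a x => by
      induction x using tensor_induction with
      | zero => simp
      | tmul m n => simp [smul_tmul, hs]
      | add x y hx hy => simp [hx, hy])
    (fun c x => by
      induction x using tensor_induction with
      | zero => simp
      | tmul m n => simp [op_smul_tmul_right, ho]
      | add x y hx hy => simp [hx, hy])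
    (map_tensor_deg_le _ _ fun i j m hm n hn => by simpa using hfd i j m hm n hn)
    hgd

/-- The map of tensor products induced by a pair of isomorphisms. -/
noncomputable def congrHom {M' : GrBimod 𝒜 ℬ} {N' : GrBimod ℬ 𝒞} (e : Iso M M')
    (f : Iso N N') : M.carrier →+ N.carrier →+ (M'.tensor N').carrier :=
  AddMonoidHom.mk' (fun m => (tmulHom M' N' (e.toAddEquiv m)).comp f.toAddEquiv.toAddMonoidHom)
    fun m m' => by ext; simp

theorem congrHom_apply {M' : GrBimod 𝒜 ℬ} {N' : GrBimod ℬ 𝒞} (e : Iso M M') (f : Iso N N')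
    (m : M.carrier) (n : N.carrier) :
    congrHom e f m n = tmul M' N' (e.toFun m) (f.toFun n) := rfl

theorem congrHom_balanced {M' : GrBimod 𝒜 ℬ} {N' : GrBimod ℬ 𝒞} (e : Iso M M') (f : Iso N N')
    (b : B) (m : M.carrier) (n : N.carrier) :
    congrHom e f (MulOpposite.op b • m) n = congrHom e f m (b • n) := by
  rw [congrHom_apply, congrHom_apply, e.map_op_smul, f.map_smul, op_smul_tmul]

/-- Functoriality of the tensor product for isomorphisms. -/
noncomputable def tensorCongr {M' : GrBimod 𝒜 ℬ} {N' : GrBimod ℬ 𝒞} (e : Iso M M')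
    (f : Iso N N') : Iso (M.tensor N) (M'.tensor N') :=
  isoOfLift (congrHom e f) (congrHom_balanced e f)
    (lift (congrHom e.symm f.symm) (congrHom_balanced e.symm f.symm))
    (fun m n => by
      rw [congrHom_apply, lift_tmul, congrHom_apply]
      exact congrArg₂ (tmul M N) (e.left_inv m) (f.left_inv n))
    (fun x => by
      induction x using tensor_induction with
      | zero => rw [map_zero, map_zero]
      | tmul m n =>
        rw [lift_tmul, congrHom_apply, lift_tmul, congrHom_apply]
        exact congrArg₂ (tmul M' N') (e.right_inv m) (f.right_inv n)
      | add x y hx hy => rw [map_add, map_add, hx, hy])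
    (fun a m n => by rw [congrHom_apply, congrHom_apply, e.map_smul, smul_tmul])
    (fun c m n => by rw [congrHom_apply, congrHom_apply, f.map_op_smul, op_smul_tmul_right])
    (fun i j m hm n hn => tmul_mem rfl ((e.map_deg i m).1 hm) ((f.map_deg j n).1 hn))
    (map_tensor_deg_le _ _ fun i j m hm n hn => by
      rw [lift_tmul]
      exact tmul_mem rfl ((e.symm.map_deg i m).1 hm) ((f.symm.map_deg j n).1 hn))

/-- Exchanging the two sides of a tensor product, as an additive map. -/
noncomputable def swapHom (M : GrBimod 𝒜 ℬ) (N : GrBimod ℬ 𝒞) :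
    (M.tensor N).carrier →+ (N.flip.tensor M.flip).carrier :=
  lift (tmulHom N.flip M.flip).flip
    fun b m n => (op_smul_tmul (M := N.flip) (N := M.flip) b n m).symm

/-- The inverse of `swapHom`. -/
noncomputable def swapInv (M : GrBimod 𝒜 ℬ) (N : GrBimod ℬ 𝒞) :
    (N.flip.tensor M.flip).carrier →+ (M.tensor N).carrier :=
  lift (M := N.flip) (N := M.flip) (tmulHom M N).flip
    fun b n m => (op_smul_tmul (M := M) (N := N) b m n).symm

theorem swapHom_tmul (m : M.carrier) (n : N.carrier) :
    swapHom M N (tmul M N m n) = tmul N.flip M.flip n m := lift_tmul _ _ _ _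

theorem swapInv_tmul (m : M.carrier) (n : N.carrier) :
    swapInv M N (tmul N.flip M.flip n m) = tmul M N m n :=
  lift_tmul (M := N.flip) (N := M.flip) _ _ _ _

theorem swapInv_swapHom (x : (M.tensor N).carrier) : swapInv M N (swapHom M N x) = x := by
  induction x using tensor_induction with
  | zero => rw [map_zero, map_zero]
  | tmul m n => rw [swapHom_tmul, swapInv_tmul]
  | add x y hx hy => rw [map_add, map_add, hx, hy]

theorem swapHom_swapInv (x : (N.flip.tensor M.flip).carrier) :
    swapHom M N (swapInv M N x) = x := by
  induction x using tensor_induction (M := N.flip) (N := M.flip) with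
  | zero => rw [map_zero, map_zero]
  | tmul n m => exact congrArg (swapHom M N) (swapInv_tmul (M := M) (N := N) m n) |>.trans <|
      swapHom_tmul (M := M) (N := N) m n
  | add x y hx hy => rw [map_add, map_add, hx, hy]

theorem swapHom_op_smul (c : C) (x : (M.tensor N).carrier) :
    swapHom M N (MulOpposite.op c • x) = c • swapHom M N x := by
  induction x using tensor_induction with
  | zero => rw [smul_zero, map_zero, smul_zero]
  | tmul m n =>
    rw [op_smul_tmul_right, swapHom_tmul, swapHom_tmul]
    exact (smul_tmul (M := N.flip) (N := M.flip) c n m).symm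
  | add x y hx hy => rw [smul_add, map_add, map_add, smul_add, hx, hy]

theorem swapHom_smul (a : A) (x : (M.tensor N).carrier) :
    swapHom M N (a • x) = MulOpposite.op a • swapHom M N x := by
  induction x using tensor_induction with
  | zero => rw [smul_zero, map_zero, smul_zero]
  | tmul m n =>
    rw [smul_tmul, swapHom_tmul, swapHom_tmul]
    exact (op_smul_tmul_right (M := N.flip) (N := M.flip) a n m).symm
  | add x y hx hy => rw [smul_add, map_add, map_add, smul_add, hx, hy]

variable (M N) in
/-- Exchanging the two sides of a tensor product. -/
noncomputable def flipTensor : Iso (M.tensor N).flip (N.flip.tensor M.flip) :=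
  Iso.ofInverse (M := (M.tensor N).flip) (swapHom M N) (swapInv M N)
    swapInv_swapHom swapHom_swapInv swapHom_op_smul swapHom_smul
    (map_tensor_deg_le _ _ fun i j m hm n hn => by
      rw [swapHom_tmul]
      exact tmul_mem (M := N.flip) (N := M.flip) (add_comm j i) hn hm)
    (map_tensor_deg_le (M := N.flip) (N := M.flip) (swapInv M N) (M.tensor N).deg
      fun i j n hn m hm => (iff_of_eq (congrArg
        (· ∈ (M.tensor N).deg (i + j)) (swapInv_tmul (M := M) (N := N) m n))).2
          (tmul_mem (M := M) (N := N) (add_comm j i) hm hn))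

end Tensor

section Assoc

variable [GradedRing ℬ] [GradedRing 𝒞] (M : GrBimod 𝒜 ℬ) (N : GrBimod ℬ 𝒞) (P : GrBimod 𝒞 𝒟)

/-- The triadditive map `(m, n, p) ↦ m ⊗ (n ⊗ p)`. -/
noncomputable def assocAux :
    (M.tensor N).carrier →+ P.carrier →+ (M.tensor (N.tensor P)).carrier :=
  lift (AddMonoidHom.mk' (fun m => AddMonoidHom.mk'
      (fun n => (tmulHom M (N.tensor P) m).comp (tmulHom N P n))
      fun n n' => by ext; simp [tmul_add]) fun m m' => by ext; simp)
    (fun b m n => by ext p; simp [op_smul_tmul, smul_tmul])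

theorem assocAux_tmul (m : M.carrier) (n : N.carrier) (p : P.carrier) :
    assocAux M N P (tmul M N m n) p = tmul M (N.tensor P) m (tmul N P n p) := by
  rw [assocAux, lift_tmul]; rfl

theorem assocAux_balanced (c : C) (x : (M.tensor N).carrier) (p : P.carrier) :
    assocAux M N P (MulOpposite.op c • x) p = assocAux M N P x (c • p) := by
  induction x using tensor_induction with
  | zero => rw [smul_zero, map_zero, AddMonoidHom.zero_apply, AddMonoidHom.zero_apply]
  | tmul m n => rw [op_smul_tmul_right, assocAux_tmul, assocAux_tmul, op_smul_tmul]
  | add x y hx hy =>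
    rw [smul_add, map_add, map_add, AddMonoidHom.add_apply, AddMonoidHom.add_apply, hx, hy]

/-- The triadditive map `(m, n, p) ↦ (m ⊗ n) ⊗ p`. -/
noncomputable def assocInvAux (m : M.carrier) :
    (N.tensor P).carrier →+ ((M.tensor N).tensor P).carrier :=
  lift ((tmulHom (M.tensor N) P).comp (tmulHom M N m)) fun c n p => by
    simp only [AddMonoidHom.comp_apply, tmulHom_apply]
    rw [← op_smul_tmul_right, op_smul_tmul]

theorem assocInvAux_tmul (m : M.carrier) (n : N.carrier) (p : P.carrier) :
    assocInvAux M N P m (tmul N P n p) = tmul (M.tensor N) P (tmul M N m n) p := by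
  rw [assocInvAux, lift_tmul]; rfl

/-- The map `m ⊗ (n ⊗ p) ↦ (m ⊗ n) ⊗ p`. -/
noncomputable def assocInv :
    (M.tensor (N.tensor P)).carrier →+ ((M.tensor N).tensor P).carrier :=
  lift (AddMonoidHom.mk' (assocInvAux M N P) fun m m' => tensor_hom_ext fun n p => by
      rw [AddMonoidHom.add_apply, assocInvAux_tmul, assocInvAux_tmul, assocInvAux_tmul, add_tmul,
        add_tmul])
    (fun b m x => by
      simp only [AddMonoidHom.mk'_apply]
      induction x using tensor_induction with
      | zero => rw [smul_zero, map_zero, map_zero]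
      | tmul n p => rw [smul_tmul, assocInvAux_tmul, assocInvAux_tmul, op_smul_tmul]
      | add x y hx hy => rw [smul_add, map_add, map_add, hx, hy])

theorem assocInv_tmul (m : M.carrier) (n : N.carrier) (p : P.carrier) :
    assocInv M N P (tmul M (N.tensor P) m (tmul N P n p))
      = tmul (M.tensor N) P (tmul M N m n) p := by
  rw [assocInv, lift_tmul]
  exact assocInvAux_tmul M N P m n p

/-- Associativity of the tensor product. -/
noncomputable def tensorAssoc : Iso ((M.tensor N).tensor P) (M.tensor (N.tensor P)) :=
  isoOfLift (assocAux M N P) (assocAux_balanced M N P) (assocInv M N P)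
    (fun x p => by
      induction x using tensor_induction with
      | zero =>
        rw [map_zero, AddMonoidHom.zero_apply, map_zero, ← tmulHom_apply, map_zero,
          AddMonoidHom.zero_apply]
      | tmul m n => rw [assocAux_tmul, assocInv_tmul]
      | add x y hx hy => rw [map_add, AddMonoidHom.add_apply, map_add, hx, hy, add_tmul])
    (fun z => by
      induction z using tensor_induction with
      | zero => rw [map_zero, map_zero]
      | tmul m x =>
        induction x using tensor_induction with
        | zero => rw [tmul_zero, map_zero, map_zero]
        | tmul n p => rw [assocInv_tmul, lift_tmul, assocAux_tmul]
        | add x y hx hy => rw [tmul_add, map_add, map_add, hx, hy]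
      | add x y hx hy => rw [map_add, map_add, hx, hy])
    (fun a x p => by
      induction x using tensor_induction with
      | zero => rw [smul_zero, map_zero, AddMonoidHom.zero_apply, smul_zero]
      | tmul m n => rw [smul_tmul, assocAux_tmul, assocAux_tmul, smul_tmul]
      | add x y hx hy =>
        rw [smul_add, map_add, map_add, AddMonoidHom.add_apply, AddMonoidHom.add_apply, smul_add,
          hx, hy])
    (fun d x p => by
      induction x using tensor_induction with
      | zero => rw [map_zero, AddMonoidHom.zero_apply, AddMonoidHom.zero_apply, smul_zero]
      | tmul m n =>
        rw [assocAux_tmul, assocAux_tmul, op_smul_tmul_right, op_smul_tmul_right]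
      | add x y hx hy =>
        rw [map_add, AddMonoidHom.add_apply, AddMonoidHom.add_apply, smul_add, hx, hy])
    (fun i j x hx p hp =>
      map_tensor_deg_le ((AddMonoidHom.eval p).comp (assocAux M N P))
        (fun d => (M.tensor (N.tensor P)).deg (d + j)) (fun s t m hm n hn => by
          rw [AddMonoidHom.comp_apply, AddMonoidHom.eval_apply_apply, assocAux_tmul]
          exact tmul_mem (by ring) hm (tmul_mem rfl hn hp)) i x hx)
    (map_tensor_deg_le _ _ fun i j m hm x hx =>
      map_tensor_deg_le ((assocInv M N P).comp (tmulHom M (N.tensor P) m))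
        (fun d => ((M.tensor N).tensor P).deg (i + d)) (fun s t n hn p hp => by
          rw [AddMonoidHom.comp_apply, tmulHom_apply, assocInv_tmul]
          exact tmul_mem (by ring) (tmul_mem rfl hm hn) hp) j x hx)

end Assoc

end GrBimod
-- Sign vectors, two-colourings and the lines they define.
section Colourings

variable {n : ℕ}

/-- The sign `(-1)^j`. -/
def parity (j : Fin (n + 1)) : ℤˣ := (-1) ^ (j : ℕ)

theorem parity_succ (i : Fin n) : parity i.succ = -parity i.castSucc := by
  simp [parity, pow_succ]

theorem units_mul_self (e : ℤˣ) : e * e = 1 := by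
  rcases Int.units_eq_one_or e with h | h <;> simp [h]

variable (k : Type u) [Field k]

/-- The two-colouring of the coordinates with values `(-1)^j η_j`. -/
def colour (η : Fin (n + 1) → ℤˣ) (j : Fin (n + 1)) : k := (((parity j * η j : ℤˣ) : ℤ) : k)

/-- The point of the Weyl line of a colouring with parameter `δ`. -/
def linePt (η : Fin (n + 1) → ℤˣ) (δ : k) : Amb k n :=
  fun j => δ * (colour k η j - (∑ l, colour k η l) / (n + 1))

/-- The sign vectors which are constant along the pairs in `E`. -/
def signings (E : Set (Fin (n + 1) × Fin (n + 1))) : Set (Fin (n + 1) → ℤˣ) :=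
  {η | ∀ p ∈ E, η p.1 = η p.2}

/-- The union of the lines given by the sign vectors which are constant along the pairs in `E`. -/
def edgeVar (E : Set (Fin (n + 1) × Fin (n + 1))) : Set (Amb k n) :=
  {x | ∃ η ∈ signings E, ∃ δ : k, x = linePt k η δ}

variable {k}

theorem one_mem_signings (E : Set (Fin (n + 1) × Fin (n + 1))) :
    (1 : Fin (n + 1) → ℤˣ) ∈ signings E := fun _ _ => rfl

theorem neg_mem_signings {E : Set (Fin (n + 1) × Fin (n + 1))} {η : Fin (n + 1) → ℤˣ}
    (h : η ∈ signings E) : -η ∈ signings E := fun p hp => congrArg Neg.neg (h p hp)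

theorem colour_eq_or (η : Fin (n + 1) → ℤˣ) (j : Fin (n + 1)) :
    colour k η j = 1 ∨ colour k η j = -1 := by
  unfold colour
  rcases Int.units_eq_one_or (parity j * η j) with h | h <;> simp [h]

theorem colour_mul_self (η : Fin (n + 1) → ℤˣ) (j : Fin (n + 1)) :
    colour k η j * colour k η j = 1 := by
  rcases colour_eq_or (k := k) η j with h | h <;> simp [h]

theorem colour_ne_zero (η : Fin (n + 1) → ℤˣ) (j : Fin (n + 1)) : colour k η j ≠ 0 :=
  left_ne_zero_of_mul_eq_one (colour_mul_self η j)

theorem colour_neg (η : Fin (n + 1) → ℤˣ) (j : Fin (n + 1)) :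
    colour k (-η) j = -colour k η j := by
  simp [colour]

theorem linePt_zero (η : Fin (n + 1) → ℤˣ) : linePt k η 0 = 0 := by
  ext j; simp [linePt]

theorem linePt_eq_smul (η : Fin (n + 1) → ℤˣ) (δ : k) : linePt k η δ = δ • linePt k η 1 := by
  ext j; simp [linePt]

/-- Differences of coordinates cancel the mean that was subtracted to land in the geometric
representation. -/
theorem linePt_sub (η : Fin (n + 1) → ℤˣ) (δ : k) (u v : Fin (n + 1)) :
    linePt k η δ u - linePt k η δ v = δ * (colour k η u - colour k η v) := by
  simp only [linePt]; ring

theorem zero_mem_edgeVar (E : Set (Fin (n + 1) × Fin (n + 1))) : (0 : Amb k n) ∈ edgeVar k E :=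
  ⟨1, one_mem_signings E, 0, (linePt_zero _).symm⟩

theorem linePt_mem_edgeVar {E : Set (Fin (n + 1) × Fin (n + 1))} {η : Fin (n + 1) → ℤˣ}
    (h : η ∈ signings E) (δ : k) : linePt k η δ ∈ edgeVar k E := ⟨η, h, δ, rfl⟩

theorem edgeVar_mono {E F : Set (Fin (n + 1) × Fin (n + 1))} (h : E ⊆ F) :
    edgeVar k F ⊆ edgeVar k E := by
  rintro _ ⟨η, hη, δ, rfl⟩
  exact linePt_mem_edgeVar (fun p hp => hη p (h hp)) δ

theorem colour_eq_neg {η : Fin (n + 1) → ℤˣ} {u v : Fin (n + 1)}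
    (h : parity u = -parity v) (hη : η u = η v) : colour k η u = -colour k η v := by
  simp [colour, h, hη]

variable [CharZero k]

theorem colour_eq_iff {η θ : Fin (n + 1) → ℤˣ} {u v : Fin (n + 1)} :
    colour k η u = colour k θ v ↔ parity u * η u = parity v * θ v := by
  rw [colour, colour, Int.cast_inj, Units.val_inj]

theorem natCast_succ_ne_zero : ((n : k) + 1) ≠ 0 := by exact_mod_cast n.succ_ne_zero

theorem linePt_mem_geomRep (η : Fin (n + 1) → ℤˣ) (δ : k) : linePt k η δ ∈ geomRep k n := by
  change ∑ j, δ * (colour k η j - (∑ l, colour k η l) / (n + 1)) = 0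
  rw [← Finset.mul_sum, Finset.sum_sub_distrib, Finset.sum_const, Finset.card_univ,
    Fintype.card_fin, nsmul_eq_mul]
  have := natCast_succ_ne_zero (k := k) (n := n)
  push_cast
  field_simp
  ring

/-- Outside the origin, a point of a Weyl line determines the sign vector up to a global sign. -/
theorem eq_or_eq_neg_of_linePt_eq {η θ : Fin (n + 1) → ℤˣ} {δ δ' : k} {a b : Fin (n + 1)}
    (hab : parity a = -parity b) (hη : η a = η b) (hδ : δ ≠ 0)
    (h : linePt k η δ = linePt k θ δ') : θ = η ∨ θ = -η := by
  have key : ∀ w, δ * (colour k η w - colour k η a) = δ' * (colour k θ w - colour k θ a) := by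
    intro w
    rw [← linePt_sub, ← linePt_sub, h]
  have hb : colour k η b = -colour k η a := by rw [colour_eq_neg hab hη, neg_neg]
  -- If `θ` gave `a` and `b` the same colour, the difference of coordinates there would vanish,
  -- whereas on the side of `η` it is `-2δ` times a colour.
  have hθb : colour k θ b = -colour k θ a := by
    have h1 := key b
    rw [hb] at h1
    by_contra hne
    have : colour k θ b = colour k θ a := by
      rcases colour_eq_or (k := k) θ a with h | h <;> rcases colour_eq_or (k := k) θ b with h' | h'
        <;> simp [h, h'] at hne ⊢
    rw [this, sub_self, mul_zero, mul_eq_zero] at h1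
    rcases h1 with h1 | h1
    · exact hδ h1
    · have : (2 : k) * colour k η a = 0 := by linear_combination -h1
      simp [colour_ne_zero] at this
  have h1 : δ * colour k η a = δ' * colour k θ a := by
    have := key b
    rw [hb, hθb] at this
    linear_combination -this / 2
  have h2 : ∀ w, δ * colour k η w = δ' * colour k θ w := fun w => by
    linear_combination key w + h1
  have hcol : (∀ w, colour k θ w = colour k η w) ∨ ∀ w, colour k θ w = -colour k η w := by
    -- Colours square to `1`, so the proportionality factor between the two colourings can be read
    -- off at `a`; it is a product of two colours and hence a sign.
    have h3 : ∀ w, δ * (colour k θ w - (colour k η a * colour k θ a) * colour k η w) = 0 := by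
      intro w
      linear_combination (-colour k η a * colour k θ a) * h2 w +
        colour k θ w * colour k η a * h1 - δ * colour k θ w * colour_mul_self (k := k) η a
    have h4 : ∀ w, colour k θ w = (colour k η a * colour k θ a) * colour k η w := fun w =>
      sub_eq_zero.1 ((mul_eq_zero.1 (h3 w)).resolve_left hδ)
    have h5 : colour k η a * colour k θ a = 1 ∨ colour k η a * colour k θ a = -1 := by
      rcases colour_eq_or (k := k) θ a with h | h <;> rcases colour_eq_or (k := k) η a with h' | h'
        <;> simp [h, h']
    rcases h5 with h5 | h5
    · left; intro w; rw [h4 w, h5, one_mul]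
    · right; intro w; rw [h4 w, h5, neg_one_mul]
  refine hcol.imp (fun h => ?_) fun h => ?_
  · ext1 w
    exact mul_left_cancel (colour_eq_iff.1 (h w))
  · ext1 w
    have := h w
    rw [← colour_neg, colour_eq_iff] at this
    exact mul_left_cancel this

theorem mem_signings_of_linePt_mem {E : Set (Fin (n + 1) × Fin (n + 1))}
    {η : Fin (n + 1) → ℤˣ} {δ : k} {a b : Fin (n + 1)} (hab : parity a = -parity b)
    (hη : η a = η b) (hδ : δ ≠ 0) (h : linePt k η δ ∈ edgeVar k E) : η ∈ signings E := by
  obtain ⟨θ, hθ, δ', h⟩ := h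
  rcases eq_or_eq_neg_of_linePt_eq hab hη hδ h with rfl | rfl
  · exact hθ
  · exact neg_neg η ▸ neg_mem_signings hθ

/-- The pair of opposite parity in `E` makes the colouring nonconstant, so a nonzero point
determines its sign vector up to sign and must satisfy both sets of equalities with that same
vector. -/
theorem edgeVar_inter {E F : Set (Fin (n + 1) × Fin (n + 1))} {a b : Fin (n + 1)}
    (hab : parity a = -parity b) (hE : (a, b) ∈ E) :
    edgeVar k E ∩ edgeVar k F = edgeVar k (E ∪ F) := by
  refine subset_antisymm ?_ (Set.subset_inter (edgeVar_mono Set.subset_union_left)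
    (edgeVar_mono Set.subset_union_right))
  rintro _ ⟨⟨η, hη, δ, rfl⟩, hF⟩
  by_cases hδ : δ = 0
  · rw [hδ, linePt_zero]; exact zero_mem_edgeVar _
  · exact linePt_mem_edgeVar (fun p hp => hp.elim (hη p)
      (mem_signings_of_linePt_mem hab (hη _ hE) hδ hF p)) δ

end Colourings

/-! ### Weyl lines correspond to colourings. -/

section Lines

variable {k : Type u} [Field k] {n : ℕ}

theorem permAct_apply (w : Equiv.Perm (Fin (n + 1))) (x : Amb k n) (j : Fin (n + 1)) :
    permAct k w x j = x (w⁻¹ j) := rfl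

theorem mem_hyperplane_swap {a b : Fin (n + 1)} {x : Amb k n} :
    x ∈ hyperplane k (Equiv.swap a b) ↔ x ∈ geomRep k n ∧ x a = x b := by
  refine and_congr_right fun _ => ?_
  change permAct k _ x = x ↔ _
  constructor
  · intro h
    have := congrFun h b
    rwa [permAct_apply, Equiv.swap_inv, Equiv.swap_apply_right] at this
  · intro h
    ext j
    rw [permAct_apply, Equiv.swap_inv]
    rcases eq_or_ne j a with rfl | ha
    · rw [Equiv.swap_apply_left, h]
    rcases eq_or_ne j b with rfl | hb
    · rw [Equiv.swap_apply_right, h]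
    · rw [Equiv.swap_apply_of_ne_of_ne ha hb]

theorem linePt_one_ne_zero {η : Fin (n + 1) → ℤˣ} {u v : Fin (n + 1)}
    (h : colour k η u ≠ colour k η v) : linePt k η 1 ≠ 0 := by
  intro h0
  have := linePt_sub η (1 : k) u v
  rw [h0] at this
  simp only [Pi.zero_apply, sub_self, one_mul] at this
  exact h (sub_eq_zero.1 this.symm)

variable [CharZero k]

/-- The reflections are those swapping two places of equal colour. A common fixed vector takes at
most two values, and the sum-zero condition leaves one parameter. -/
theorem isWeylLine_span {η : Fin (n + 1) → ℤˣ} {u v : Fin (n + 1)}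
    (h : colour k η u ≠ colour k η v) : IsWeylLine k (Submodule.span k {linePt k η 1}) := by
  refine ⟨finrank_span_singleton (linePt_one_ne_zero h),
    {t | ∃ a b, a ≠ b ∧ t = Equiv.swap a b ∧ colour k η a = colour k η b}, ?_, ?_⟩
  · rintro t ⟨a, b, hab, rfl, -⟩
    exact ⟨a, b, hab, rfl⟩
  refine le_antisymm ?_ ?_
  · rw [Submodule.span_singleton_le_iff_mem]
    refine ⟨linePt_mem_geomRep _ _, ?_⟩
    simp only [SetLike.mem_coe, Submodule.mem_iInf]
    rintro t ⟨a, b, -, rfl, hc⟩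
    refine mem_hyperplane_swap.2 ⟨linePt_mem_geomRep _ _, ?_⟩
    simp only [linePt, hc]
  · rintro y ⟨hy, hy'⟩
    simp only [SetLike.mem_coe, Submodule.mem_iInf] at hy'
    have hy2 : ∀ a b, colour k η a = colour k η b → y a = y b := by
      intro a b hc
      rcases eq_or_ne a b with rfl | hab
      · rfl
      · exact (mem_hyperplane_swap.1 (hy' _ ⟨a, b, hab, rfl, hc⟩)).2
    have hsub : colour k η u - colour k η v ≠ 0 := sub_ne_zero.2 h
    -- A vector constant on both colour classes is affine in the colour; `c` is its slope, and the
    -- sum-zero condition `hsum` fixes the constant term.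
    set c := (y u - y v) / (colour k η u - colour k η v) with hc
    have hcm : c * (colour k η u - colour k η v) = y u - y v := div_mul_cancel₀ _ hsub
    have hK : ∀ j, y j = c * colour k η j + (y u - c * colour k η u) := by
      intro j
      by_cases hj : colour k η j = colour k η u
      · rw [hy2 j u hj, hj]; ring
      · have : colour k η j = colour k η v := by
          rcases colour_eq_or (k := k) η j with h1 | h1 <;>
            rcases colour_eq_or (k := k) η u with h2 | h2 <;>
            rcases colour_eq_or (k := k) η v with h3 | h3 <;> simp_all
        rw [hy2 j v this, this]
        linear_combination hcm
    have hsum : c * ∑ j, colour k η j + (n + 1) * (y u - c * colour k η u) = 0 := by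
      have : ∑ j, y j = 0 := hy
      rw [Finset.sum_congr rfl fun j _ => hK j, Finset.sum_add_distrib, ← Finset.mul_sum,
        Finset.sum_const, Finset.card_univ, Fintype.card_fin, nsmul_eq_mul] at this
      exact_mod_cast this
    refine Submodule.mem_span_singleton.2 ⟨c, ?_⟩
    ext j
    rw [← linePt_eq_smul, hK j]
    have := natCast_succ_ne_zero (k := k) (n := n)
    simp only [linePt]
    field_simp
    linear_combination -hsum

/-- Colour the places by whether `x` takes its value at `0` there. The point of this colouring
satisfies every equation `x_a = x_b` that `x` does, so it lies on `L`; it is nonzero because a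
nonzero vector of sum zero is not constant. One-dimensionality then makes it a multiple of `x`. -/
theorem exists_linePt_of_mem {L : Submodule k (Amb k n)} (hL : IsWeylLine k L) {x : Amb k n}
    (hx : x ∈ L) (hx0 : x ≠ 0) : ∃ η : Fin (n + 1) → ℤˣ, ∃ δ : k, x = linePt k η δ := by
  obtain ⟨h1, S, hS, rfl⟩ := hL
  classical
  -- The factor `parity j` cancels the twist in the definition of `colour`.
  let η : Fin (n + 1) → ℤˣ := fun j => parity j * if x j = x 0 then 1 else -1
  have hη : ∀ j, colour k η j = if x j = x 0 then 1 else -1 := by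
    intro j
    simp only [colour, η, ← mul_assoc, units_mul_self]
    split_ifs <;> simp
  have hmem : linePt k η 1 ∈ geomRep k n ⊓ ⨅ t ∈ S, hyperplane k t := by
    refine ⟨linePt_mem_geomRep _ _, ?_⟩
    simp only [SetLike.mem_coe, Submodule.mem_iInf]
    intro t ht
    obtain ⟨a, b, hab, rfl⟩ := hS t ht
    have hx2 := hx.2
    simp only [SetLike.mem_coe, Submodule.mem_iInf] at hx2
    have := (mem_hyperplane_swap.1 (hx2 _ ht)).2
    refine mem_hyperplane_swap.2 ⟨linePt_mem_geomRep _ _, ?_⟩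
    simp only [linePt, hη, this]
  obtain ⟨c, hc⟩ := (finrank_eq_one_iff_of_nonzero' (⟨x, hx⟩ : ↥(geomRep k n ⊓ ⨅ t ∈ S,
    hyperplane k t)) (by simpa using hx0)).1 h1 ⟨_, hmem⟩
  have hc : c • x = linePt k η 1 := congrArg Subtype.val hc
  have hne : ∃ j, x j ≠ x 0 := by
    by_contra! hall
    have hsum : ∑ j, x j = 0 := hx.1
    rw [Finset.sum_congr rfl fun j _ => hall j, Finset.sum_const, Finset.card_univ,
      Fintype.card_fin, nsmul_eq_mul, mul_eq_zero] at hsum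
    have h0 : x 0 = 0 := hsum.resolve_left (by exact_mod_cast n.succ_ne_zero)
    exact hx0 (by ext j; rw [hall j, h0]; rfl)
  obtain ⟨j, hj⟩ := hne
  have hp : linePt k η 1 ≠ 0 := linePt_one_ne_zero (u := 0) (v := j) (by
    rw [hη, hη, if_pos rfl, if_neg hj]; norm_num)
  have hc0 : c ≠ 0 := by
    rintro rfl
    exact hp (by rw [← hc, zero_smul])
  exact ⟨η, c⁻¹, by rw [linePt_eq_smul, ← hc, smul_smul, inv_mul_cancel₀ hc0, one_smul]⟩

theorem parity_castSucc (i : Fin n) : parity i.castSucc = -parity i.succ := by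
  rw [parity_succ, neg_neg]

/-- The index `i` serves to guarantee `n ≥ 1`: for `n = 0` there is no Weyl line at all, while
`edgeVar k ∅` contains the origin. -/
theorem weylUnion_eq (i : Fin n) : weylUnion k n = edgeVar k ∅ := by
  ext x
  constructor
  · rintro ⟨L, hL, hx⟩
    by_cases hx0 : x = 0
    · rw [hx0]; exact zero_mem_edgeVar _
    obtain ⟨η, δ, rfl⟩ := exists_linePt_of_mem hL hx hx0
    exact linePt_mem_edgeVar (fun p hp => hp.elim) δ
  · rintro ⟨η, -, δ, rfl⟩
    by_cases h : ∃ u v, colour k η u ≠ colour k η v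
    · obtain ⟨u, v, h⟩ := h
      exact ⟨_, isWeylLine_span h, Submodule.mem_span_singleton.2 ⟨δ, (linePt_eq_smul _ _).symm⟩⟩
    · push Not at h
      -- A constant colouring equals its own mean and gives the origin, which lies on any Weyl line;
      -- the sign vector `1` supplies one, as its colours alternate.
      have h0 : linePt k η δ = 0 := by
        ext j
        have hn := natCast_succ_ne_zero (k := k) (n := n)
        simp only [linePt, fun l => h l j, Finset.sum_const, Finset.card_univ, Fintype.card_fin,
          nsmul_eq_mul, Pi.zero_apply]
        push_cast
        field_simp
        ring
      refine ⟨_, isWeylLine_span (k := k) (η := 1) (u := i.castSucc) (v := i.succ) ?_,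
        h0 ▸ zero_mem _⟩
      rw [Ne, colour_eq_iff, parity_succ]
      simp

/-- Adjacent places have opposite parity, so equality of the twisted signs means inequality of the
colours, which says that the line leaves the hyperplane. This is the reason for the twist. -/
theorem transverse_eq (i : Fin n) :
    transverse k (simple i) = edgeVar k {(i.castSucc, i.succ)} := by
  ext x
  constructor
  · rintro ⟨L, hL, hLs, hx⟩
    by_cases hx0 : x = 0
    · rw [hx0]; exact zero_mem_edgeVar _
    obtain ⟨η, δ, rfl⟩ := exists_linePt_of_mem hL hx hx0
    refine linePt_mem_edgeVar ?_ δ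
    rintro _ rfl
    by_contra hne
    refine hLs fun y hy => ?_
    obtain ⟨c, hc⟩ := (finrank_eq_one_iff_of_nonzero' (⟨_, hx⟩ : L) (by simpa using hx0)).1 hL.1
      ⟨y, hy⟩
    have hc : c • linePt k η δ = y := congrArg Subtype.val hc
    rw [← hc]
    refine Submodule.smul_mem _ c (mem_hyperplane_swap.2 ⟨linePt_mem_geomRep _ _, ?_⟩)
    have : colour k η i.castSucc = colour k η i.succ := by
      rw [colour_eq_iff, parity_succ]
      rw [Int.units_ne_iff_eq_neg.1 hne]
      simp
    simp only [linePt, this]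
  · rintro ⟨η, hη, δ, rfl⟩
    have h := hη _ rfl
    have hc : colour k η i.castSucc ≠ colour k η i.succ := by
      rw [colour_eq_neg (parity_castSucc i) h]
      intro h2
      have : (2 : k) * colour k η i.succ = 0 := by linear_combination -h2
      simp [colour_ne_zero] at this
    refine ⟨_, isWeylLine_span hc, fun hle => ?_,
      Submodule.mem_span_singleton.2 ⟨δ, (linePt_eq_smul _ _).symm⟩⟩
    have := (mem_hyperplane_swap.1 (hle (Submodule.mem_span_singleton_self _))).2
    have h2 := linePt_sub η (1 : k) i.castSucc i.succ
    rw [this, sub_self, one_mul] at h2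
    exact hc (sub_eq_zero.1 h2.symm)

end Lines
-- The passage from `W` to `V_i ∩ (W ∪ s_i W)` in terms of edges.
section Step

variable {n : ℕ}

/-- Changing the signs at the places in `C`. -/
def flipOn (C : Finset (Fin (n + 1))) (η : Fin (n + 1) → ℤˣ) (j : Fin (n + 1)) : ℤˣ :=
  if j ∈ C then -η j else η j

theorem flipOn_of_mem {C : Finset (Fin (n + 1))} {j : Fin (n + 1)} (h : j ∈ C)
    (η : Fin (n + 1) → ℤˣ) : flipOn C η j = -η j := if_pos h

theorem flipOn_of_notMem {C : Finset (Fin (n + 1))} {j : Fin (n + 1)} (h : j ∉ C)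
    (η : Fin (n + 1) → ℤˣ) : flipOn C η j = η j := if_neg h

theorem flipOn_flipOn (C : Finset (Fin (n + 1))) (η : Fin (n + 1) → ℤˣ) :
    flipOn C (flipOn C η) = η := by
  ext1 j
  by_cases h : j ∈ C <;> simp [flipOn, h]

/-- The two places moved by a simple transposition. -/
def simplePair (i : Fin n) : Finset (Fin (n + 1)) := {i.castSucc, i.succ}

theorem mem_simplePair {i : Fin n} {j : Fin (n + 1)} :
    j ∈ simplePair i ↔ j = i.castSucc ∨ j = i.succ := by
  simp [simplePair]

/-- The pairs describing `V_i ∩ (W ∪ s_i W)` in terms of those describing `W`. -/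
def stepEdges (i : Fin n) (E : Set (Fin (n + 1) × Fin (n + 1))) :
    Set (Fin (n + 1) × Fin (n + 1)) :=
  {p | p.1 ∈ simplePair i ∧ p.2 ∈ simplePair i} ∪
    {p | p.1 ∉ simplePair i ∧ p.2 ∉ simplePair i ∧
      ∀ θ ∈ signings (insert (i.castSucc, i.succ) E), θ p.1 = θ p.2}

theorem eq_of_mem_simplePair {i : Fin n} {η : Fin (n + 1) → ℤˣ}
    (h : η i.castSucc = η i.succ) {u v : Fin (n + 1)} (hu : u ∈ simplePair i)
    (hv : v ∈ simplePair i) : η u = η v := by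
  rw [mem_simplePair] at hu hv
  rcases hu with rfl | rfl <;> rcases hv with rfl | rfl <;> simp [h]

theorem castSucc_mem_simplePair (i : Fin n) : i.castSucc ∈ simplePair i := by simp [simplePair]

theorem succ_mem_simplePair (i : Fin n) : i.succ ∈ simplePair i := by simp [simplePair]

theorem flipOn_simplePair {i : Fin n} {η : Fin (n + 1) → ℤˣ} (h : η i.castSucc = η i.succ) :
    flipOn (simplePair i) η i.castSucc = flipOn (simplePair i) η i.succ := by
  rw [flipOn_of_mem (castSucc_mem_simplePair i), flipOn_of_mem (succ_mem_simplePair i), h]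

theorem mem_signings_insert {E : Set (Fin (n + 1) × Fin (n + 1))} {u v : Fin (n + 1)}
    {η : Fin (n + 1) → ℤˣ} : η ∈ signings (insert (u, v) E) ↔ η u = η v ∧ η ∈ signings E := by
  simp [signings]

/-- A condition "`η` or its flip" is in general not given by equalities; it is here because flipping
the pair only matters if `E` ties the pair to an outside place. In that case one of the two signs of
the pair always fits, and what remains is a condition on the outside places alone. -/
theorem mem_signings_stepEdges {i : Fin n} {E : Set (Fin (n + 1) × Fin (n + 1))}
    {η : Fin (n + 1) → ℤˣ} : η ∈ signings (stepEdges i E) ↔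
      η i.castSucc = η i.succ ∧ (η ∈ signings E ∨ flipOn (simplePair i) η ∈ signings E) := by
  constructor
  · intro h
    have hi : η i.castSucc = η i.succ :=
      h (i.castSucc, i.succ) (Or.inl ⟨castSucc_mem_simplePair i, succ_mem_simplePair i⟩)
    refine ⟨hi, ?_⟩
    -- The dichotomy is whether the edges force some outside place `u` to carry the sign of the
    -- pair.
    by_cases hu : ∃ u ∉ simplePair i,
        ∀ θ ∈ signings (insert (i.castSucc, i.succ) E), θ u = θ i.castSucc
    · obtain ⟨u, huS, hu⟩ := hu
      -- A vector that agrees with `η` outside and matches `u` on the pair satisfies every edge of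
      -- `E`: an edge leaving the pair ends at a place tied to `u` by an outside pair of
      -- `stepEdges`.
      have key : ∀ ζ : Fin (n + 1) → ℤˣ, ζ i.castSucc = ζ i.succ →
          (∀ v ∉ simplePair i, ζ v = η v) → ζ i.castSucc = η u → ζ ∈ signings E := by
        intro ζ hζi hζ hζu
        have hmix : ∀ v w, (v, w) ∈ E ∨ (w, v) ∈ E → v ∈ simplePair i → w ∉ simplePair i →
            ζ v = ζ w := by
          intro v w hvw hv hw
          rw [hζ w hw, eq_of_mem_simplePair hζi hv (castSucc_mem_simplePair i), hζu]
          refine h (u, w) (Or.inr ⟨huS, hw, fun θ hθ => ?_⟩)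
          have hθ' := mem_signings_insert.1 hθ
          have hθE : θ v = θ w := hvw.elim (hθ'.2 (v, w)) fun hvw => (hθ'.2 (w, v) hvw).symm
          change θ u = θ w
          rw [hu θ hθ, ← hθE, eq_of_mem_simplePair hθ'.1 hv (castSucc_mem_simplePair i)]
        rintro ⟨v, w⟩ hvw
        change ζ v = ζ w
        by_cases hv : v ∈ simplePair i <;> by_cases hw : w ∈ simplePair i
        · exact eq_of_mem_simplePair hζi hv hw
        · exact hmix v w (Or.inl hvw) hv hw
        · exact (hmix w v (Or.inr hvw) hw hv).symm
        · rw [hζ v hv, hζ w hw]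
          exact h (v, w) (Or.inr ⟨hv, hw, fun θ hθ => (mem_signings_insert.1 hθ).2 (v, w) hvw⟩)
      by_cases hηu : η i.castSucc = η u
      · exact Or.inl (key η hi (fun _ _ => rfl) hηu)
      · refine Or.inr (key _ (flipOn_simplePair hi) (fun v hv => flipOn_of_notMem hv η) ?_)
        rw [flipOn_of_mem (castSucc_mem_simplePair i), Int.units_ne_iff_eq_neg.1 hηu, neg_neg]
    · push Not at hu
      -- An edge leaving the pair would tie its outer end to the pair, so there is none, and `η`
      -- itself satisfies all of `E`.
      have hmix : ∀ v w, (v, w) ∈ E ∨ (w, v) ∈ E → v ∈ simplePair i → w ∉ simplePair i →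
          False := by
        intro v w hvw hv hw
        obtain ⟨θ, hθ, hne⟩ := hu w hw
        have hθ' := mem_signings_insert.1 hθ
        have hθE : θ v = θ w := hvw.elim (hθ'.2 (v, w)) fun hvw => (hθ'.2 (w, v) hvw).symm
        exact hne (by
          rw [← hθE, eq_of_mem_simplePair hθ'.1 hv (castSucc_mem_simplePair i)])
      refine Or.inl ?_
      rintro ⟨v, w⟩ hvw
      change η v = η w
      by_cases hv : v ∈ simplePair i <;> by_cases hw : w ∈ simplePair i
      · exact eq_of_mem_simplePair hi hv hw
      · exact (hmix v w (Or.inl hvw) hv hw).elim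
      · exact (hmix w v (Or.inr hvw) hw hv).elim
      · exact h (v, w) (Or.inr ⟨hv, hw, fun θ hθ => (mem_signings_insert.1 hθ).2 (v, w) hvw⟩)
  · rintro ⟨hi, h⟩ ⟨v, w⟩ (⟨hv, hw⟩ | ⟨hv, hw, hvw⟩)
    · exact eq_of_mem_simplePair hi hv hw
    · rcases h with h | h
      · exact hvw η (mem_signings_insert.2 ⟨hi, h⟩)
      · have := hvw _ (mem_signings_insert.2 ⟨flipOn_simplePair hi, h⟩)
        rwa [flipOn_of_notMem hv, flipOn_of_notMem hw] at this

variable {k : Type u} [Field k]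

theorem simple_inv (i : Fin n) : (simple i)⁻¹ = simple i := Equiv.swap_inv _ _

theorem simple_apply_of_notMem {i : Fin n} {j : Fin (n + 1)} (h : j ∉ simplePair i) :
    simple i j = j := by
  rw [mem_simplePair, not_or] at h
  exact Equiv.swap_apply_of_ne_of_ne h.1 h.2

theorem permAct_simple_simple (i : Fin n) (x : Amb k n) :
    permAct k (simple i) (permAct k (simple i) x) = x := by
  ext j
  rw [permAct_apply, permAct_apply, simple_inv, simple, Equiv.swap_apply_self]

/-- Swapping two opposite colours at adjacent places is the same as negating both. The set of colour
values is only permuted, so the mean does not change. -/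
theorem permAct_simple_linePt {i : Fin n} {η : Fin (n + 1) → ℤˣ}
    (h : η i.castSucc = η i.succ) (δ : k) :
    permAct k (simple i) (linePt k η δ) = linePt k (flipOn (simplePair i) η) δ := by
  have hc : ∀ j, colour k η (simple i j) = colour k (flipOn (simplePair i) η) j := by
    intro j
    by_cases hj : j ∈ simplePair i
    · unfold colour
      rw [flipOn_of_mem hj]
      rcases mem_simplePair.1 hj with rfl | rfl
      · rw [simple, Equiv.swap_apply_left, parity_succ, h]; simp
      · rw [simple, Equiv.swap_apply_right, parity_succ, h]; simp
    · unfold colour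
      rw [simple_apply_of_notMem hj, flipOn_of_notMem hj]
  ext j
  rw [permAct_apply, simple_inv]
  simp only [linePt, hc, ← Equiv.sum_comp (simple i) (colour k η)]

variable [CharZero k]

/-- Away from the origin a point determines its sign vector up to sign, so the union over a
transposition becomes the alternative "`η` or its flip", to which `mem_signings_stepEdges` applies.
-/
theorem edgeVar_stepEdges (i : Fin n) (E : Set (Fin (n + 1) × Fin (n + 1))) :
    edgeVar k {(i.castSucc, i.succ)} ∩ (edgeVar k E ∪ permAct k (simple i) '' edgeVar k E) =
      edgeVar k (stepEdges i E) := by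
  ext x
  constructor
  · rintro ⟨⟨η, hη, δ, rfl⟩, h⟩
    have hi : η i.castSucc = η i.succ := hη _ rfl
    by_cases hδ : δ = 0
    · rw [hδ, linePt_zero]; exact zero_mem_edgeVar _
    refine linePt_mem_edgeVar (mem_signings_stepEdges.2 ⟨hi, ?_⟩) δ
    rcases h with h | ⟨y, hy, h⟩
    · exact Or.inl (mem_signings_of_linePt_mem (parity_castSucc i) hi hδ h)
    · refine Or.inr (mem_signings_of_linePt_mem (k := k) (δ := δ) (parity_castSucc i)
        (flipOn_simplePair hi) hδ ?_)
      rwa [← permAct_simple_linePt hi, ← h, permAct_simple_simple]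
  · rintro ⟨η, hη, δ, rfl⟩
    obtain ⟨hi, h⟩ := mem_signings_stepEdges.1 hη
    refine ⟨linePt_mem_edgeVar (by rintro _ rfl; exact hi) δ, ?_⟩
    rcases h with h | h
    · exact Or.inl (linePt_mem_edgeVar h δ)
    · refine Or.inr ⟨_, linePt_mem_edgeVar h δ, ?_⟩
      rw [permAct_simple_linePt (flipOn_simplePair hi), flipOn_flipOn]

/-- Pairs describing the variety `W` of a sequence of indices. -/
def seqEdges : List (Fin n) → Set (Fin (n + 1) × Fin (n + 1))
  | [] => ∅
  | [i] => {(i.castSucc, i.succ)}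
  | i :: j :: l => stepEdges i (seqEdges (j :: l))

theorem mem_seqEdges (i : Fin n) (l : List (Fin n)) :
    (i.castSucc, i.succ) ∈ seqEdges (i :: l) := by
  cases l with
  | nil => rfl
  | cons j l => exact Or.inl ⟨castSucc_mem_simplePair i, succ_mem_simplePair i⟩

theorem seqVariety_cons_eq (i : Fin n) (l : List (Fin n)) :
    seqVariety k (i :: l) = edgeVar k (seqEdges (i :: l)) := by
  induction l generalizing i with
  | nil => exact transverse_eq i
  | cons j l ih =>
    change transverse k (simple i) ∩ (seqVariety k (j :: l) ∪ permAct k (simple i) ''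
      seqVariety k (j :: l)) = edgeVar k (stepEdges i (seqEdges (j :: l)))
    rw [ih, transverse_eq, edgeVar_stepEdges]

theorem seqVariety_eq {l : List (Fin n)} (hl : l ≠ []) :
    seqVariety k l = edgeVar k (seqEdges l) := by
  obtain ⟨i, l, rfl⟩ := List.exists_cons_of_ne_nil hl
  exact seqVariety_cons_eq i l

omit [CharZero k] in
theorem seqVariety_cons_subset (i : Fin n) (l : List (Fin n)) :
    seqVariety k (i :: l) ⊆ transverse k (simple i) := by
  cases l with
  | nil => exact subset_rfl
  | cons j l => exact Set.inter_subset_left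

omit [CharZero k] in
theorem seqVariety_append_subset {l : List (Fin n)} (hl : l ≠ []) (l' : List (Fin n)) :
    seqVariety k (l ++ l') ⊆ seqVariety k l := by
  induction l with
  | nil => exact (hl rfl).elim
  | cons i l ih =>
    cases l with
    | nil => exact seqVariety_cons_subset i l'
    | cons j l =>
      have := ih (List.cons_ne_nil j l)
      exact Set.inter_subset_inter_right _ (Set.union_subset_union this (Set.image_mono this))

/-- These varieties are closed in `Z`, so the support of a module with annihilator the ideal of such
a variety is the variety itself. An edge between places of equal parity is detected by a difference
of coordinates, and one between places of opposite parity by quadrics. -/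
theorem weylUnion_inter_zeroLocus (i : Fin n) (E : Set (Fin (n + 1) × Fin (n + 1))) :
    weylUnion k n ∩ MvPolynomial.zeroLocus k (MvPolynomial.vanishingIdeal k (edgeVar k E)) =
      edgeVar k E := by
  refine subset_antisymm ?_ fun x hx => ⟨weylUnion_eq (k := k) i ▸ edgeVar_mono
    (Set.empty_subset E) hx, fun p hp => hp x hx⟩
  rintro x ⟨hxZ, hx⟩
  rw [weylUnion_eq i] at hxZ
  obtain ⟨η, -, δ, rfl⟩ := hxZ
  by_cases hδ : δ = 0
  · rw [hδ, linePt_zero]; exact zero_mem_edgeVar _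
  by_cases hconst : linePt k η δ = 0
  · rw [hconst]; exact zero_mem_edgeVar _
  refine linePt_mem_edgeVar ?_ δ
  rintro ⟨u, v⟩ huv
  change η u = η v
  rcases eq_or_ne (parity u) (parity v) with hp | hp
  · have hmem : (MvPolynomial.X u - MvPolynomial.X v : MvPolynomial (Fin (n + 1)) k) ∈
        MvPolynomial.vanishingIdeal k (edgeVar k E) := by
      rintro _ ⟨θ, hθ, ε, rfl⟩
      have h : colour k θ u = colour k θ v := colour_eq_iff.2 (by rw [hp, hθ _ huv])
      rw [map_sub, MvPolynomial.aeval_X, MvPolynomial.aeval_X, linePt_sub, h, sub_self, mul_zero]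
    have := hx _ hmem
    rw [map_sub, MvPolynomial.aeval_X, MvPolynomial.aeval_X, linePt_sub, mul_eq_zero,
      sub_eq_zero, colour_eq_iff, hp] at this
    exact mul_left_cancel (this.resolve_left hδ)
  · have hp' := Int.units_ne_iff_eq_neg.1 hp
    by_contra hne
    have huv' : colour k η v = colour k η u := colour_eq_iff.2 (by
      rw [hp', Int.units_ne_iff_eq_neg.1 hne]; simp)
    have hall : ∀ w, linePt k η δ w - linePt k η δ u = 0 := by
      intro w
      -- On the variety `u` and `v` carry opposite colours, so every `w` agrees with one of them. At
      -- a point where `u` and `v` have the same colour the product is a square, and all coordinates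
      -- must coincide.
      have hmem : ((MvPolynomial.X w - MvPolynomial.X u) * (MvPolynomial.X w - MvPolynomial.X v) :
          MvPolynomial (Fin (n + 1)) k) ∈ MvPolynomial.vanishingIdeal k (edgeVar k E) := by
        rintro _ ⟨θ, hθ, ε, rfl⟩
        have h : colour k θ u = -colour k θ v := colour_eq_neg hp' (hθ _ huv)
        rw [map_mul, map_sub, map_sub, MvPolynomial.aeval_X, MvPolynomial.aeval_X,
          MvPolynomial.aeval_X, linePt_sub, linePt_sub, h]
        linear_combination ε ^ 2 * colour_mul_self (k := k) θ w
          - ε ^ 2 * colour_mul_self (k := k) θ v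
      have := hx _ hmem
      rw [map_mul, map_sub, map_sub, MvPolynomial.aeval_X, MvPolynomial.aeval_X,
        MvPolynomial.aeval_X, linePt_sub, linePt_sub, huv', ← linePt_sub] at this
      exact mul_self_eq_zero.1 this
    have hsum : ∑ w, linePt k η δ w = 0 := linePt_mem_geomRep η δ
    rw [Finset.sum_congr rfl fun w _ => sub_eq_zero.1 (hall w), Finset.sum_const,
      Finset.card_univ, Fintype.card_fin, nsmul_eq_mul, mul_eq_zero] at hsum
    have h0 := hsum.resolve_left (by exact_mod_cast n.succ_ne_zero)
    exact hconst (by ext w; rw [sub_eq_zero.1 (hall w), h0]; rfl)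

end Step

/-! ### Reducedness of scheme-theoretic intersections. -/

section SumOfIdeals

open MvPolynomial

variable {k : Type u} [Field k] {n : ℕ}

variable (k) in
/-- The linear form `2 x_j - x_a - x_b`. -/
noncomputable def centred (a b j : Fin (n + 1)) : MvPolynomial (Fin (n + 1)) k :=
  2 * X j - X a - X b

variable (k) in
/-- The linear form that vanishes on the lines where the sign vector agrees at `c` and `d`. -/
noncomputable def edgeForm (a b c d : Fin (n + 1)) : MvPolynomial (Fin (n + 1)) k :=
  C ((parity c : ℤ) : k) * centred k a b c - C ((parity d : ℤ) : k) * centred k a b d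

/-- The opposite colours at `a` and `b` cancel in `x_a + x_b`, so the form recovers the uncentred
colour, scaled by `2δ`. -/
theorem aeval_centred {a b : Fin (n + 1)} (hab : parity a = -parity b) {η : Fin (n + 1) → ℤˣ}
    (hη : η a = η b) (δ : k) (j : Fin (n + 1)) :
    aeval (linePt k η δ) (centred k a b j) = 2 * δ * colour k η j := by
  have h := colour_eq_neg (k := k) hab hη
  simp only [centred, map_sub, map_mul, aeval_X, linePt, map_ofNat]
  rw [h]
  ring

theorem parity_mul_colour (η : Fin (n + 1) → ℤˣ) (j : Fin (n + 1)) :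
    ((parity j : ℤ) : k) * colour k η j = ((η j : ℤ) : k) := by
  rw [colour, ← Int.cast_mul, ← Units.val_mul, ← mul_assoc, units_mul_self, one_mul]

theorem aeval_edgeForm {a b : Fin (n + 1)} (hab : parity a = -parity b) {η : Fin (n + 1) → ℤˣ}
    (hη : η a = η b) (δ : k) (c d : Fin (n + 1)) :
    aeval (linePt k η δ) (edgeForm k a b c d) = 2 * δ * (((η c : ℤ) : k) - ((η d : ℤ) : k)) := by
  simp only [edgeForm, map_sub, map_mul, aeval_C, Algebra.algebraMap_self, RingHom.id_apply,
    aeval_centred hab hη]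
  rw [← parity_mul_colour η c, ← parity_mul_colour η d]
  ring

variable (k) in
/-- The scalar by which a coordinate function is multiplied when the signs in `S` change. -/
def flipSign (S : Finset (Fin (n + 1))) (j : Fin (n + 1)) : k := if j ∈ S then -1 else 1

theorem colour_flipOn (S : Finset (Fin (n + 1))) (η : Fin (n + 1) → ℤˣ) (j : Fin (n + 1)) :
    colour k (flipOn S η) j = flipSign k S j * colour k η j := by
  by_cases h : j ∈ S <;> simp [colour, flipOn, flipSign, h]

variable (k) in
/-- The substitution which changes the signs in `S`. -/
noncomputable def flipHom (a b : Fin (n + 1)) (S : Finset (Fin (n + 1))) :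
    MvPolynomial (Fin (n + 1)) k →ₐ[k] MvPolynomial (Fin (n + 1)) k :=
  bind₁ fun j : Fin (n + 1) => C (1 / 2 : k) * (C (flipSign k S j) * centred k a b j -
    C (1 / (n + 1) : k) * ∑ l, C (flipSign k S l) * centred k a b l)

variable [CharZero k]

/-- The colours are linear in the point by `aeval_centred`; the substitution changes their signs on
`S`, subtracts the new mean, and halves to undo the factor `2`. -/
theorem aeval_flipHom {a b : Fin (n + 1)} (hab : parity a = -parity b) {η : Fin (n + 1) → ℤˣ}
    (hη : η a = η b) (δ : k) (S : Finset (Fin (n + 1))) (p : MvPolynomial (Fin (n + 1)) k) :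
    aeval (linePt k η δ) (flipHom k a b S p) = aeval (linePt k (flipOn S η) δ) p := by
  rw [flipHom, aeval_bind₁]
  congr 2
  ext j
  simp only [map_sub, map_mul, map_sum, aeval_C, Algebra.algebraMap_self, RingHom.id_apply,
    aeval_centred hab hη, linePt, colour_flipOn]
  have : ∑ l, flipSign k S l * (2 * δ * colour k η l)
      = 2 * δ * ∑ l, flipSign k S l * colour k η l := by
    rw [Finset.mul_sum]; exact Finset.sum_congr rfl fun l _ => by ring
  rw [this]
  have h := natCast_succ_ne_zero (k := k) (n := n)
  field_simp

/-- The substitution which changes the signs in a class `S` of places is the identity modulo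
a coordinate function of this class. -/
theorem sub_flipHom_mem {E : Set (Fin (n + 1) × Fin (n + 1))} {a b c : Fin (n + 1)}
    (hab : parity a = -parity b) (hE : (a, b) ∈ E) {S : Finset (Fin (n + 1))}
    (hS : ∀ j ∈ S, ∀ η ∈ signings E, η j = η c) (p : MvPolynomial (Fin (n + 1)) k) :
    p - flipHom k a b S p ∈
      Ideal.span {centred k a b c} ⊔ vanishingIdeal k (edgeVar k E) := by
  set K := Ideal.span {centred k a b c} ⊔ vanishingIdeal k (edgeVar k E) with hK
  suffices h : (Ideal.Quotient.mkₐ k K).comp (flipHom k a b S) = Ideal.Quotient.mkₐ k K from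
    Ideal.Quotient.eq.1 (DFunLike.congr_fun h p).symm
  refine algHom_ext fun j => (Ideal.Quotient.eq.2 ?_).symm
  -- The change of the colour at `l` as a multiple of the colour at `c`: twice a sign for `l` in
  -- `S`, where the twisted signs agree with that of `c`, and zero elsewhere. Subtracting the mean
  -- of these multiples gives `κ`.
  let s : Fin (n + 1) → k := fun l => (1 - flipSign k S l) * ((parity l * parity c : ℤˣ) : ℤ)
  let κ : k := s j - (∑ l, s l) / (n + 1)
  have hs : ∀ η ∈ signings E, ∀ l,
      (1 - flipSign k S l) * colour k η l = s l * colour k η c := by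
    intro η hη l
    by_cases hl : l ∈ S
    · have : colour k η l = ((parity l * parity c : ℤˣ) : ℤ) * colour k η c := by
        rw [colour, colour, ← Int.cast_mul, ← Units.val_mul, hS l hl η hη]
        congr 2
        rw [mul_assoc, ← mul_assoc (parity c), units_mul_self, one_mul]
      simp only [s]
      rw [this]; ring
    · simp [s, flipSign, hl]
  have hmem : X j - flipHom k a b S (X j) - C (κ / 2) * centred k a b c
      ∈ vanishingIdeal k (edgeVar k E) := by
    rintro _ ⟨η, hη, δ, rfl⟩
    have hη' : η a = η b := hη _ hE
    rw [map_sub, map_sub, aeval_flipHom hab hη', map_mul, aeval_centred hab hη', aeval_X,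
      aeval_X, aeval_C]
    have hsum : ∑ l, colour k η l - ∑ l, flipSign k S l * colour k η l
        = (∑ l, s l) * colour k η c := by
      rw [← Finset.sum_sub_distrib, Finset.sum_mul]
      exact Finset.sum_congr rfl fun l _ => by rw [← hs η hη l]; ring
    have hj := hs η hη j
    have h := natCast_succ_ne_zero (k := k) (n := n)
    simp only [linePt, colour_flipOn, Algebra.algebraMap_self, RingHom.id_apply, κ]
    field_simp
    linear_combination δ * (n + 1) * hj - δ * hsum
  have : X j - flipHom k a b S (X j) = C (κ / 2) * centred k a b c +
      (X j - flipHom k a b S (X j) - C (κ / 2) * centred k a b c) := by ring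
  change X j - flipHom k a b S (X j) ∈ K
  rw [this]
  exact Ideal.add_mem _ (Ideal.mem_sup_left (Ideal.mul_mem_left _ _
    (Ideal.mem_span_singleton_self _))) (Ideal.mem_sup_right hmem)

/-- Flipping the class `S` of places tied to `c` preserves `E` and exchanges the vectors with `η c =
η d` and those with `η c ≠ η d`, if `d` is not in `S`. If `f` vanishes on the former, then on the
latter it equals `f` minus its flip, which modulo the ideal of `E` is a multiple of the coordinate
of `c`. There this coordinate is proportional to `edgeForm`. -/
theorem vanishingIdeal_insert_le {E : Set (Fin (n + 1) × Fin (n + 1))} {a b : Fin (n + 1)}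
    (hab : parity a = -parity b) (hE : (a, b) ∈ E) (c d : Fin (n + 1)) :
    vanishingIdeal k (edgeVar k (insert (c, d) E)) ≤
      vanishingIdeal k (edgeVar k E) ⊔ Ideal.span {edgeForm k a b c d} := by
  classical
  intro f hf
  let S : Finset (Fin (n + 1)) := {j | ∀ η ∈ signings E, η j = η c}
  have hS : ∀ j, j ∈ S ↔ ∀ η ∈ signings E, η j = η c := fun j => by simp [S]
  by_cases hd : d ∈ S
  · refine Ideal.mem_sup_left ?_
    rintro _ ⟨η, hη, δ, rfl⟩
    exact hf _ (linePt_mem_edgeVar (mem_signings_insert.2 ⟨((hS d).1 hd η hη).symm, hη⟩) δ)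
  have hc : c ∈ S := (hS c).2 fun _ _ => rfl
  have hflip : ∀ η ∈ signings E, flipOn S η ∈ signings E := by
    rintro η hη ⟨u, v⟩ huv
    have : u ∈ S ↔ v ∈ S := by
      rw [hS, hS]
      exact forall₂_congr fun θ hθ => by rw [hθ (u, v) huv]
    have huv' : η u = η v := hη _ huv
    simp only [flipOn, this, huv']
  obtain ⟨g, hg, i, hi, hgi⟩ := Submodule.mem_sup.1
    (sub_flipHom_mem hab hE (fun j hj => (hS j).1 hj) f)
  obtain ⟨h, rfl⟩ := Ideal.mem_span_singleton'.1 hg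
  -- Where the signs at `c` and `d` differ, `edgeForm` is `4δ η_c` and `centred` at `c` is `2δ`
  -- times `parity c * η_c`; the factor converts one into the other.
  set m := C (((parity c : ℤ) : k) / 2) * h with hm
  have hmem : f - m * edgeForm k a b c d ∈ vanishingIdeal k (edgeVar k E) := by
    rintro _ ⟨η, hη, δ, rfl⟩
    have hη' : η a = η b := hη _ hE
    rw [map_sub, map_mul, aeval_edgeForm hab hη']
    by_cases hcd : η c = η d
    · rw [hf _ (linePt_mem_edgeVar (mem_signings_insert.2 ⟨hcd, hη⟩) δ), hcd]
      ring
    · have h1 : flipOn S η ∈ signings (insert (c, d) E) := by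
        refine mem_signings_insert.2 ⟨?_, hflip η hη⟩
        rw [flipOn_of_mem hc, flipOn_of_notMem hd, Int.units_ne_iff_eq_neg.1 hcd, neg_neg]
      have h2 := congrArg (aeval (linePt k η δ)) hgi
      rw [map_sub, aeval_flipHom hab hη', hf _ (linePt_mem_edgeVar h1 δ), map_add,
        hi _ (linePt_mem_edgeVar hη δ), map_mul, aeval_centred hab hη'] at h2
      have hd' : ((η d : ℤ) : k) = -((η c : ℤ) : k) := by
        rw [Int.units_ne_iff_eq_neg.1 hcd]; simp
      have hpc : ((parity c : ℤ) : k) * ((parity c : ℤ) : k) = 1 := by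
        rw [← Int.cast_mul, ← Units.val_mul, units_mul_self]; simp
      rw [hd', hm, map_mul, aeval_C, Algebra.algebraMap_self, RingHom.id_apply,
        ← parity_mul_colour η c]
      linear_combination -h2 - 2 * δ * colour k η c * aeval (linePt k η δ) h * hpc
  have : f = (f - m * edgeForm k a b c d) + m * edgeForm k a b c d := by ring
  rw [this]
  exact Ideal.add_mem _ (Ideal.mem_sup_left hmem) (Ideal.mem_sup_right
    (Ideal.mul_mem_left _ _ (Ideal.mem_span_singleton_self _)))

/-- The scheme-theoretic intersection of two of the varieties is reduced, provided that they are
transverse to a common reflection. -/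
theorem vanishingIdeal_union_le {E F : Set (Fin (n + 1) × Fin (n + 1))} {a b : Fin (n + 1)}
    (hab : parity a = -parity b) (hE : (a, b) ∈ E) (hF : (a, b) ∈ F) :
    vanishingIdeal k (edgeVar k (E ∪ F)) ≤
      vanishingIdeal k (edgeVar k E) ⊔ vanishingIdeal k (edgeVar k F) := by
  -- The edges of `F` are adjoined to `E` one by one; each new linear form vanishes on the variety
  -- of `F`, since `F` contains both that edge and `(a, b)`.
  have key : ∀ G : Set (Fin (n + 1) × Fin (n + 1)), G.Finite → G ⊆ F →
      vanishingIdeal k (edgeVar k (E ∪ G)) ≤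
        vanishingIdeal k (edgeVar k E) ⊔ vanishingIdeal k (edgeVar k F) := by
    intro G hG
    induction G, hG using Set.Finite.induction_on with
    | empty => intro _; rw [Set.union_empty]; exact le_sup_left
    | @insert p G _ _ ih =>
      intro hsub
      obtain ⟨c, d⟩ := p
      rw [Set.union_insert]
      refine (vanishingIdeal_insert_le hab (Or.inl hE) c d).trans (sup_le
        (ih ((Set.subset_insert _ _).trans hsub)) (le_sup_of_le_right ?_))
      rw [Ideal.span_singleton_le_iff_mem]
      rintro _ ⟨η, hη, δ, rfl⟩
      have hcd : η c = η d := hη (c, d) (hsub (Set.mem_insert _ _))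
      rw [aeval_edgeForm hab (hη _ hF), hcd, sub_self, mul_zero]
  exact key F F.toFinite subset_rfl

end SumOfIdeals
-- Formal properties of the product `∗`: functoriality, flip, associativity.
section Star

open GrBimod

variable {k : Type u} [Field k] [CharZero k] {n : ℕ}

/-- Bimodules are isomorphic if they are so after exchanging the two sides. -/
def GrBimod.Iso.unflip {A B : Type u} [CommRing A] [CommRing B] {𝒜 : ℤ → AddSubgroup A}
    {ℬ : ℤ → AddSubgroup B} {M N : GrBimod 𝒜 ℬ} (e : Iso M.flip N.flip) : Iso M N :=
  (Iso.flipFlip M).symm.trans (e.flip.trans (Iso.flipFlip N))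

/-- The bimodule `𝒪(X)` depends only on `X`. -/
noncomputable def regBimodCongr {X Y : Set (Amb k n)} (h : X = Y) (hX : IsCone X)
    (hX' : X ⊆ weylUnion k n) (hY : IsCone Y) (hY' : Y ⊆ weylUnion k n) :
    Iso (regBimod hX hX') (regBimod hY hY') := by
  subst h
  exact Iso.refl _

/-- The bimodule `𝒪(X)` is symmetric. -/
noncomputable def flipRegBimod {X : Set (Amb k n)} (hX : IsCone X) (hX' : X ⊆ weylUnion k n) :
    Iso (regBimod hX hX').flip (regBimod hX hX') :=
  Iso.ofInverse (M := (regBimod hX hX').flip) (N := regBimod hX hX')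
    (AddMonoidHom.id (Reg X)) (AddMonoidHom.id (Reg X))
    (fun _ => rfl) (fun _ => rfl) (fun _ _ => rfl) (fun _ _ => rfl) (fun _ _ h => h)
    (fun _ _ h => h)

/-- The element of the bimodule `𝒪(X)` given by a polynomial. -/
noncomputable def regElt {X : Set (Amb k n)} (hX : IsCone X) (hXZ : X ⊆ weylUnion k n) :
    MvPolynomial (Fin (n + 1)) k →+ (regBimod hX hXZ).carrier :=
  (toReg X).toAddMonoidHom

theorem regElt_surjective {X : Set (Amb k n)} (hX : IsCone X) (hXZ : X ⊆ weylUnion k n) :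
    Function.Surjective (regElt hX hXZ) := Ideal.Quotient.mk_surjective

theorem smul_regElt {X : Set (Amb k n)} (hX : IsCone X) (hXZ : X ⊆ weylUnion k n)
    (p q : MvPolynomial (Fin (n + 1)) k) :
    toReg (weylUnion k n) p • regElt hX hXZ q = regElt hX hXZ (p * q) :=
  (map_mul (toReg X) p q).symm

theorem op_smul_regElt {X : Set (Amb k n)} (hX : IsCone X) (hXZ : X ⊆ weylUnion k n)
    (p q : MvPolynomial (Fin (n + 1)) k) :
    MulOpposite.op (toReg (weylUnion k n) p) • regElt hX hXZ q = regElt hX hXZ (p * q) :=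
  (map_mul (toReg X) p q).symm

theorem regElt_eq_zero {X : Set (Amb k n)} (hX : IsCone X) (hXZ : X ⊆ weylUnion k n)
    {p : MvPolynomial (Fin (n + 1)) k} :
    regElt hX hXZ p = 0 ↔ p ∈ MvPolynomial.vanishingIdeal k X :=
  Ideal.Quotient.eq_zero_iff_mem

theorem mem_deg_regBimod {X : Set (Amb k n)} (hX : IsCone X) (hXZ : X ⊆ weylUnion k n) {i : ℤ}
    {x : (regBimod hX hXZ).carrier} : x ∈ (regBimod hX hXZ).deg i ↔
      ∃ p ∈ MvPolynomial.weightedHomogeneousSubmodule k (fun _ : Fin (n + 1) => (2 : ℤ)) i,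
        regElt hX hXZ p = x := Iff.rfl

theorem regElt_tmul {X : Set (Amb k n)} (hX : IsCone X) (hXZ : X ⊆ weylUnion k n)
    (N : BarBimod k n) (p q : MvPolynomial (Fin (n + 1)) k) (m : N.carrier) :
    tmul (regBimod hX hXZ) N (regElt hX hXZ (p * q)) m =
      tmul (regBimod hX hXZ) N (regElt hX hXZ q) (toReg (weylUnion k n) p • m) := by
  rw [← op_smul_regElt, op_smul_tmul]

/-- Biadditive maps on `𝒪(X) × N` from functions of polynomials. -/
noncomputable def regLift {X : Set (Amb k n)} (hX : IsCone X) (hXZ : X ⊆ weylUnion k n)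
    {P : Type*} [AddCommGroup P] (f : MvPolynomial (Fin (n + 1)) k →+ P)
    (hf : ∀ p ∈ MvPolynomial.vanishingIdeal k X, f p = 0) : (regBimod hX hXZ).carrier →+ P :=
  QuotientAddGroup.lift _ f hf

theorem regLift_regElt {X : Set (Amb k n)} (hX : IsCone X) (hXZ : X ⊆ weylUnion k n)
    {P : Type*} [AddCommGroup P] (f : MvPolynomial (Fin (n + 1)) k →+ P)
    (hf : ∀ p ∈ MvPolynomial.vanishingIdeal k X, f p = 0) (p : MvPolynomial (Fin (n + 1)) k) :
    regLift hX hXZ f hf (regElt hX hXZ p) = f p := rfl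

section Absorb

variable {X X' : Set (Amb k n)} (hX : IsCone X) (hXZ : X ⊆ weylUnion k n) (hX' : IsCone X')
  (hXZ' : X' ⊆ weylUnion k n) (N : BarBimod k n)

/-- Change of variety on the first factor of `𝒪(X) ⊗ N`. -/
noncomputable def changeAux
    (h : MvPolynomial.vanishingIdeal k X ≤ MvPolynomial.vanishingIdeal k X' ⊔
      (Module.annihilator (Reg (weylUnion k n)) N.carrier).comap (toReg (weylUnion k n))) :
    (regBimod hX hXZ).carrier →+ N.carrier →+ ((regBimod hX' hXZ').tensor N).carrier :=
  regLift hX hXZ ((tmulHom (regBimod hX' hXZ') N).comp (regElt hX' hXZ')) (by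
    intro p hp
    ext m
    -- The summand `u` is zero in `𝒪(X')`, and `v`, moved across the tensor sign, annihilates `N`.
    obtain ⟨u, hu, v, hv, rfl⟩ := Submodule.mem_sup.1 (h hp)
    rw [AddMonoidHom.comp_apply, map_add, (regElt_eq_zero hX' hXZ').2 hu, zero_add,
      tmulHom_apply, ← mul_one v, regElt_tmul, Module.mem_annihilator.1 hv m,
      GrBimod.tmul_zero, AddMonoidHom.zero_apply])

variable (h : MvPolynomial.vanishingIdeal k X ≤ MvPolynomial.vanishingIdeal k X' ⊔
  (Module.annihilator (Reg (weylUnion k n)) N.carrier).comap (toReg (weylUnion k n)))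

theorem changeAux_apply (p : MvPolynomial (Fin (n + 1)) k) (m : N.carrier) :
    changeAux hX hXZ hX' hXZ' N h (regElt hX hXZ p) m =
      tmul (regBimod hX' hXZ') N (regElt hX' hXZ' p) m := by
  rw [changeAux, regLift_regElt]; rfl

theorem changeAux_balanced (b : Reg (weylUnion k n)) (x : (regBimod hX hXZ).carrier)
    (m : N.carrier) : changeAux hX hXZ hX' hXZ' N h (MulOpposite.op b • x) m =
      changeAux hX hXZ hX' hXZ' N h x (b • m) := by
  obtain ⟨p, rfl⟩ := Ideal.Quotient.mk_surjective b
  obtain ⟨q, rfl⟩ := regElt_surjective hX hXZ x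
  rw [op_smul_regElt, changeAux_apply, changeAux_apply, regElt_tmul]

theorem changeAux_deg (i j : ℤ) (x : (regBimod hX hXZ).carrier)
    (hx : x ∈ (regBimod hX hXZ).deg i) (m : N.carrier) (hm : m ∈ N.deg j) :
    changeAux hX hXZ hX' hXZ' N h x m ∈ ((regBimod hX' hXZ').tensor N).deg (i + j) := by
  obtain ⟨q, hq, rfl⟩ := (mem_deg_regBimod hX hXZ).1 hx
  rw [changeAux_apply]
  exact tmul_mem rfl ((mem_deg_regBimod hX' hXZ').2 ⟨q, hq, rfl⟩) hm

theorem changeAux_changeAux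
    (h' : MvPolynomial.vanishingIdeal k X' ≤ MvPolynomial.vanishingIdeal k X ⊔
      (Module.annihilator (Reg (weylUnion k n)) N.carrier).comap (toReg (weylUnion k n)))
    (x : (regBimod hX hXZ).carrier) (m : N.carrier) :
    lift _ (changeAux_balanced hX' hXZ' hX hXZ N h') (changeAux hX hXZ hX' hXZ' N h x m) =
      tmul (regBimod hX hXZ) N x m := by
  obtain ⟨q, rfl⟩ := regElt_surjective hX hXZ x
  rw [changeAux_apply, lift_tmul, changeAux_apply]

/-- `𝒪(X) ⊗ N ≅ 𝒪(X') ⊗ N`, when `X` and `X'` have the same scheme-theoretic intersection with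
the support of `N`. -/
noncomputable def absorbLeft
    (h' : MvPolynomial.vanishingIdeal k X' ≤ MvPolynomial.vanishingIdeal k X ⊔
      (Module.annihilator (Reg (weylUnion k n)) N.carrier).comap (toReg (weylUnion k n))) :
    Iso ((regBimod hX hXZ).tensor N) ((regBimod hX' hXZ').tensor N) :=
  isoOfLift (changeAux hX hXZ hX' hXZ' N h) (changeAux_balanced hX hXZ hX' hXZ' N h)
    (lift _ (changeAux_balanced hX' hXZ' hX hXZ N h'))
    (changeAux_changeAux hX hXZ hX' hXZ' N h h')
    (fun y => by
      induction y using tensor_induction with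
      | zero => rw [map_zero, map_zero]
      | tmul x m => rw [lift_tmul, changeAux_changeAux]
      | add x y hx hy => rw [map_add, map_add, hx, hy])
    (fun a x m => by
      obtain ⟨p, rfl⟩ := Ideal.Quotient.mk_surjective a
      obtain ⟨q, rfl⟩ := regElt_surjective hX hXZ x
      rw [smul_regElt, changeAux_apply, changeAux_apply, GrBimod.smul_tmul, smul_regElt])
    (fun c x m => by
      obtain ⟨q, rfl⟩ := regElt_surjective hX hXZ x
      rw [changeAux_apply, changeAux_apply, op_smul_tmul_right])
    (changeAux_deg hX hXZ hX' hXZ' N h)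
    (map_tensor_deg_le _ _ fun i j x hx m hm => by
      rw [lift_tmul]
      exact changeAux_deg hX' hXZ' hX hXZ N h' i j x hx m hm)

/-- `N ⊗ 𝒪(X) ≅ N ⊗ 𝒪(X')`, when `X` and `X'` have the same scheme-theoretic intersection with
the right support of `N`. -/
noncomputable def absorbRight
    (h : MvPolynomial.vanishingIdeal k X ≤ MvPolynomial.vanishingIdeal k X' ⊔
      (Module.annihilator (Reg (weylUnion k n)) N.Rt).comap (toReg (weylUnion k n)))
    (h' : MvPolynomial.vanishingIdeal k X' ≤ MvPolynomial.vanishingIdeal k X ⊔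
      (Module.annihilator (Reg (weylUnion k n)) N.Rt).comap (toReg (weylUnion k n))) :
    Iso (N.tensor (regBimod hX hXZ)) (N.tensor (regBimod hX' hXZ')) :=
  Iso.unflip ((flipTensor _ _).trans <|
    (tensorCongr (flipRegBimod hX hXZ) (Iso.refl N.flip)).trans <|
    (absorbLeft hX hXZ hX' hXZ' N.flip h h').trans <|
    (tensorCongr (flipRegBimod hX' hXZ').symm (Iso.refl N.flip)).trans
    (flipTensor _ _).symm)

end Absorb

omit [CharZero k] in
theorem leftVariety_congr {B B' : BarBimod k n} (e : Iso B B') :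
    leftVariety B = leftVariety B' := by
  rw [leftVariety, leftVariety, e.leftAnn_eq]

omit [CharZero k] in
theorem rightVariety_congr {B B' : BarBimod k n} (e : Iso B B') :
    rightVariety B = rightVariety B' := by
  rw [rightVariety, rightVariety, e.rightAnn_eq]

theorem inter_isCone (B B' : BarBimod k n) : IsCone (rightVariety B ∩ leftVariety B') :=
  fun x hx c => ⟨rightVariety_isCone B x hx.1 c, leftVariety_isCone B' x hx.2 c⟩

omit [CharZero k] in
theorem inter_subset_weylUnion (B B' : BarBimod k n) :
    rightVariety B ∩ leftVariety B' ⊆ weylUnion k n := fun _ hx => hx.1.1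

/-- The product `∗` with a given description of the intersection of the supports. -/
noncomputable def starIso (B B' : BarBimod k n) {Y : Set (Amb k n)} (hY : IsCone Y)
    (hYZ : Y ⊆ weylUnion k n) (h : rightVariety B ∩ leftVariety B' = Y) :
    Iso (star B B') ((B.tensor (regBimod hY hYZ)).tensor B') :=
  tensorCongr (tensorCongr (Iso.refl B)
    (regBimodCongr h (inter_isCone B B') (inter_subset_weylUnion B B') hY hYZ)) (Iso.refl B')

/-- Functoriality of the product `∗` for isomorphisms. -/
noncomputable def starCongr {B B' C C' : BarBimod k n} (e : Iso B B') (f : Iso C C') :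
    Iso (star B C) (star B' C') :=
  (starIso B C (inter_isCone B' C') (inter_subset_weylUnion B' C')
    (by rw [rightVariety_congr e, leftVariety_congr f])).trans
    (tensorCongr (tensorCongr e (Iso.refl _)) f)

/-- Exchanging the two sides of a product. -/
noncomputable def flipStar (B B' : BarBimod k n) :
    Iso (star B B').flip (star B'.flip B.flip) :=
  (flipTensor (B.tensor (regBimod (inter_isCone B B') (inter_subset_weylUnion B B'))) B').trans <|
  (tensorCongr (Iso.refl B'.flip) ((flipTensor B _).trans
    (tensorCongr (flipRegBimod _ _) (Iso.refl B.flip)))).trans <|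
  (tensorAssoc B'.flip _ B.flip).symm.trans
  (starIso B'.flip B.flip (inter_isCone B B') (inter_subset_weylUnion B B')
    (Set.inter_comm _ _)).symm

/-- Associativity of the product `∗`, for bimodules such that the scheme-theoretic
intersections of their supports are reduced. -/
noncomputable def starAssoc (B N M : BarBimod k n)
    (hT : rightVariety (star B N) ⊆ rightVariety N)
    (hT' : leftVariety (star N M) ⊆ leftVariety N)
    (h : MvPolynomial.vanishingIdeal k (rightVariety (star B N) ∩ leftVariety M) ≤
      MvPolynomial.vanishingIdeal k (rightVariety N ∩ leftVariety M) ⊔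
      (Module.annihilator (Reg (weylUnion k n)) (star B N).Rt).comap (toReg (weylUnion k n)))
    (h' : MvPolynomial.vanishingIdeal k (rightVariety B ∩ leftVariety (star N M)) ≤
      MvPolynomial.vanishingIdeal k (rightVariety B ∩ leftVariety N) ⊔
      (Module.annihilator (Reg (weylUnion k n)) (star N M).carrier).comap
        (toReg (weylUnion k n))) :
    Iso (star (star B N) M) (star B (star N M)) :=
  -- The second middle term is enlarged from the support of `star B N` to that of `N`; the inclusion
  -- `hT` gives one containment of ideals and `h` the other.
  (tensorCongr (absorbRight (inter_isCone (star B N) M)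
    (inter_subset_weylUnion (star B N) M) (inter_isCone N M) (inter_subset_weylUnion N M)
    (star B N) h (le_sup_of_le_left (MvPolynomial.vanishingIdeal_anti_mono
      (Set.inter_subset_inter_left _ hT)))) (Iso.refl M)).trans <|
  (tensorCongr (tensorAssoc (B.tensor (regBimod (inter_isCone B N) (inter_subset_weylUnion B N)))
    N (regBimod (inter_isCone N M) (inter_subset_weylUnion N M))) (Iso.refl M)).trans <|
  (tensorAssoc (B.tensor (regBimod (inter_isCone B N) (inter_subset_weylUnion B N)))
    (N.tensor (regBimod (inter_isCone N M) (inter_subset_weylUnion N M))) M).trans <|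
  (tensorAssoc B (regBimod (inter_isCone B N) (inter_subset_weylUnion B N)) (star N M)).trans <|
  -- With the outer brackets moved, the first middle term shrinks from the support of `N` to that of
  -- `star N M`, by the mirror image of the first step.
  (tensorCongr (Iso.refl B) (absorbLeft (inter_isCone B N) (inter_subset_weylUnion B N)
    (inter_isCone B (star N M)) (inter_subset_weylUnion B (star N M)) (star N M)
    (le_sup_of_le_left (MvPolynomial.vanishingIdeal_anti_mono
      (Set.inter_subset_inter_right _ hT'))) h')).trans
  (tensorAssoc B (regBimod (inter_isCone B (star N M)) (inter_subset_weylUnion B (star N M)))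
    (star N M)).symm

/-- The bimodule `B_i` is symmetric. -/
noncomputable def flipSimple (i : Fin n) : Iso (simpleBimod k i).flip (simpleBimod k i) :=
  (flipTensor (ℬ := simpleInvDeg i) _ _).trans
    (tensorCongr (ℬ := simpleInvDeg i)
      (Iso.ofInverse (AddMonoidHom.id (Reg (transverse k (simple i))))
        (AddMonoidHom.id (Reg (transverse k (simple i))))
        (fun _ => rfl) (fun _ => rfl) (fun _ _ => rfl) (fun _ _ => rfl) (fun _ _ h => h)
        (fun _ _ h => h))
      (Iso.ofInverse (AddMonoidHom.id (Reg (transverse k (simple i))))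
        (AddMonoidHom.id (Reg (transverse k (simple i))))
        (fun _ => rfl) (fun _ => rfl) (fun _ _ => rfl) (fun _ _ => rfl) (fun _ _ h => h)
        (fun _ _ h => h)))

end Star
-- Invariant and anti-invariant parts, and the splitting of `𝒪(Y)`.
section Demazure

open MvPolynomial

variable {k : Type u} [Field k] {n : ℕ}

variable (k) in
/-- The equation of the reflecting hyperplane of a simple transposition. -/
noncomputable def simpleRoot (i : Fin n) : MvPolynomial (Fin (n + 1)) k := X i.castSucc - X i.succ

variable (k) in
/-- The action of a simple transposition on polynomials. -/
noncomputable def simpleAct (i : Fin n) :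
    MvPolynomial (Fin (n + 1)) k →ₐ[k] MvPolynomial (Fin (n + 1)) k := rename (simple i)

theorem simpleAct_simpleAct (i : Fin n) (p : MvPolynomial (Fin (n + 1)) k) :
    simpleAct k i (simpleAct k i p) = p := by
  rw [simpleAct, rename_rename]
  convert rename_id_apply p
  ext1 j
  simp [simple]

theorem simpleAct_simpleRoot (i : Fin n) : simpleAct k i (simpleRoot k i) = -simpleRoot k i := by
  simp [simpleAct, simpleRoot, simple]

theorem simpleRoot_ne_zero (i : Fin n) : simpleRoot k i ≠ 0 := by
  rw [simpleRoot, sub_ne_zero]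
  intro h
  exact (Fin.castSucc_lt_succ (i := i)).ne (X_injective h)

/-- The transposition fixes every variable modulo the root, hence acts trivially on the quotient. -/
theorem simpleRoot_dvd_sub (i : Fin n) (p : MvPolynomial (Fin (n + 1)) k) :
    simpleRoot k i ∣ p - simpleAct k i p := by
  rw [← Ideal.mem_span_singleton]
  set K := Ideal.span {simpleRoot k i} with hK
  suffices h : (Ideal.Quotient.mkₐ k K).comp (simpleAct k i) = Ideal.Quotient.mkₐ k K from
    Ideal.Quotient.eq.1 (DFunLike.congr_fun h p).symm
  refine algHom_ext fun j => Ideal.Quotient.eq.2 ?_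
  change simpleAct k i (X j) - X j ∈ K
  rw [simpleAct, rename_X]
  by_cases hj : j ∈ simplePair i
  · rcases mem_simplePair.1 hj with rfl | rfl
    · rw [simple, Equiv.swap_apply_left, hK, Ideal.mem_span_singleton]
      exact ⟨-1, by rw [simpleRoot]; ring⟩
    · rw [simple, Equiv.swap_apply_right]
      exact Ideal.mem_span_singleton_self _
  · rw [simple_apply_of_notMem hj, sub_self]
    exact zero_mem _

/-- The invariant part of a polynomial. -/
noncomputable def evenPart (i : Fin n) (p : MvPolynomial (Fin (n + 1)) k) :
    MvPolynomial (Fin (n + 1)) k := C (1 / 2 : k) * (p + simpleAct k i p)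

/-- Half the divided difference of a polynomial. -/
noncomputable def oddPart (i : Fin n) (p : MvPolynomial (Fin (n + 1)) k) :
    MvPolynomial (Fin (n + 1)) k := C (1 / 2 : k) * (simpleRoot_dvd_sub i p).choose

theorem simpleRoot_mul_oddPart (i : Fin n) (p : MvPolynomial (Fin (n + 1)) k) :
    simpleRoot k i * oddPart i p = C (1 / 2 : k) * (p - simpleAct k i p) := by
  rw [(simpleRoot_dvd_sub i p).choose_spec, oddPart]
  ring

variable [CharZero k]

theorem C_half_mul (p : MvPolynomial (Fin (n + 1)) k) : C (1 / 2 : k) * (p + p) = p := by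
  rw [← two_mul, ← mul_assoc, ← map_ofNat (C : k →+* MvPolynomial (Fin (n + 1)) k) 2, ← map_mul]
  norm_num

theorem evenPart_add_mul_oddPart (i : Fin n) (p : MvPolynomial (Fin (n + 1)) k) :
    evenPart i p + simpleRoot k i * oddPart i p = p := by
  rw [simpleRoot_mul_oddPart, evenPart]
  conv_rhs => rw [← C_half_mul p]
  ring

omit [CharZero k] in
theorem simpleAct_evenPart (i : Fin n) (p : MvPolynomial (Fin (n + 1)) k) :
    simpleAct k i (evenPart i p) = evenPart i p := by
  rw [evenPart, map_mul, map_add, simpleAct_simpleAct, add_comm (simpleAct k i p),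
    ← algebraMap_eq, AlgHom.commutes]

omit [CharZero k] in
theorem simpleAct_oddPart (i : Fin n) (p : MvPolynomial (Fin (n + 1)) k) :
    simpleAct k i (oddPart i p) = oddPart i p := by
  refine mul_left_cancel₀ (simpleRoot_ne_zero (k := k) i) ?_
  have h := congrArg (simpleAct k i) (simpleRoot_mul_oddPart i p)
  rw [map_mul, map_mul, map_sub, simpleAct_simpleAct, simpleAct_simpleRoot,
    ← algebraMap_eq, AlgHom.commutes, algebraMap_eq] at h
  rw [simpleRoot_mul_oddPart]
  linear_combination -h

/-- Uniqueness in the decomposition `p = r + α t` with `r` and `t` invariant: the root is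
anti-invariant, so averaging removes the second term. -/
theorem evenPart_eq (i : Fin n) {r t : MvPolynomial (Fin (n + 1)) k} (hr : simpleAct k i r = r)
    (ht : simpleAct k i t = t) : evenPart i (r + simpleRoot k i * t) = r := by
  conv_rhs => rw [← C_half_mul r]
  rw [evenPart, map_add, map_mul, simpleAct_simpleRoot, hr, ht]
  ring

theorem oddPart_eq (i : Fin n) {r t : MvPolynomial (Fin (n + 1)) k} (hr : simpleAct k i r = r)
    (ht : simpleAct k i t = t) : oddPart i (r + simpleRoot k i * t) = t := by
  refine mul_left_cancel₀ (simpleRoot_ne_zero (k := k) i) (add_left_cancel (a := r) ?_)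
  conv_rhs => rw [← evenPart_add_mul_oddPart i (r + simpleRoot k i * t)]
  rw [evenPart_eq i hr ht]

omit [CharZero k] in
theorem evenPart_add (i : Fin n) (p q : MvPolynomial (Fin (n + 1)) k) :
    evenPart i (p + q) = evenPart i p + evenPart i q := by
  simp only [evenPart, map_add]; ring

omit [CharZero k] in
theorem oddPart_add (i : Fin n) (p q : MvPolynomial (Fin (n + 1)) k) :
    oddPart i (p + q) = oddPart i p + oddPart i q := by
  refine mul_left_cancel₀ (simpleRoot_ne_zero (k := k) i) ?_
  rw [mul_add, simpleRoot_mul_oddPart, simpleRoot_mul_oddPart, simpleRoot_mul_oddPart, map_add]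
  ring

omit [CharZero k] in
theorem evenPart_mul (i : Fin n) {r : MvPolynomial (Fin (n + 1)) k} (hr : simpleAct k i r = r)
    (p : MvPolynomial (Fin (n + 1)) k) : evenPart i (r * p) = r * evenPart i p := by
  simp only [evenPart, map_mul, hr]; ring

omit [CharZero k] in
theorem oddPart_mul (i : Fin n) {r : MvPolynomial (Fin (n + 1)) k} (hr : simpleAct k i r = r)
    (p : MvPolynomial (Fin (n + 1)) k) : oddPart i (r * p) = r * oddPart i p := by
  refine mul_left_cancel₀ (simpleRoot_ne_zero (k := k) i) ?_
  rw [mul_left_comm, simpleRoot_mul_oddPart, simpleRoot_mul_oddPart, map_mul, hr]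
  ring

/-- A function whose product with a root vanishes on lines transverse to it vanishes there. -/
theorem mem_vanishingIdeal_of_mul {F : Set (Fin (n + 1) × Fin (n + 1))} {i : Fin n}
    (hF : (i.castSucc, i.succ) ∈ F) {q : MvPolynomial (Fin (n + 1)) k}
    (h : simpleRoot k i * q ∈ vanishingIdeal k (edgeVar k F)) :
    q ∈ vanishingIdeal k (edgeVar k F) := by
  rintro _ ⟨η, hη, δ, rfl⟩
  -- The restriction of `q` to the line, as a polynomial in its parameter. The root restricts to a
  -- nonzero multiple of the parameter, which is not a zero divisor; this covers the origin too.
  let f : Polynomial k := aeval (fun j => Polynomial.C (linePt k η 1 j) * Polynomial.X) q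
  have hf : ∀ ε : k, f.eval ε = aeval (linePt k η ε) q := by
    intro ε
    rw [← Polynomial.coe_aeval_eq_eval, ← AlgHom.comp_apply]
    refine DFunLike.congr_fun (algHom_ext fun j => ?_) q
    rw [AlgHom.comp_apply, aeval_X, aeval_X, linePt_eq_smul η ε, Pi.smul_apply, smul_eq_mul,
      map_mul, Polynomial.aeval_C, Polynomial.aeval_X, Algebra.algebraMap_self, RingHom.id_apply,
      mul_comm]
  have h0 : Polynomial.X * f = 0 := by
    refine Polynomial.funext fun ε => ?_
    have h1 := h _ (linePt_mem_edgeVar hη ε)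
    rw [map_mul, simpleRoot, map_sub, aeval_X, aeval_X, linePt_sub,
      colour_eq_neg (parity_castSucc i) (hη _ hF)] at h1
    rw [Polynomial.eval_mul, Polynomial.eval_X, hf, Polynomial.eval_zero]
    refine (mul_eq_zero.1 (show (-2 * colour k η i.succ) * (ε * aeval (linePt k η ε) q) = 0 by
      linear_combination h1)).resolve_left ?_
    exact mul_ne_zero (neg_ne_zero.2 two_ne_zero) (colour_ne_zero η i.succ)
  rw [← hf, (mul_eq_zero.1 h0).resolve_left Polynomial.X_ne_zero, Polynomial.eval_zero]

omit [CharZero k] in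
theorem simpleAct_mem {F : Set (Fin (n + 1) × Fin (n + 1))} {i : Fin n}
    (hF : (i.castSucc, i.succ) ∈ F)
    (hflip : ∀ η ∈ signings F, flipOn (simplePair i) η ∈ signings F)
    {p : MvPolynomial (Fin (n + 1)) k} (hp : p ∈ vanishingIdeal k (edgeVar k F)) :
    simpleAct k i p ∈ vanishingIdeal k (edgeVar k F) := by
  rintro _ ⟨η, hη, δ, rfl⟩
  rw [simpleAct, aeval_rename]
  have : linePt k η δ ∘ simple i = permAct k (simple i) (linePt k η δ) := by
    ext j; rw [permAct_apply, simple_inv]; rfl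
  rw [this, permAct_simple_linePt (hη _ hF)]
  exact hp _ (linePt_mem_edgeVar (hflip η hη) δ)

omit [CharZero k] in
theorem evenPart_mem {F : Set (Fin (n + 1) × Fin (n + 1))} {i : Fin n}
    (hF : (i.castSucc, i.succ) ∈ F)
    (hflip : ∀ η ∈ signings F, flipOn (simplePair i) η ∈ signings F)
    {p : MvPolynomial (Fin (n + 1)) k} (hp : p ∈ vanishingIdeal k (edgeVar k F)) :
    evenPart i p ∈ vanishingIdeal k (edgeVar k F) :=
  Ideal.mul_mem_left _ _ (Ideal.add_mem _ hp (simpleAct_mem hF hflip hp))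

/-- Dividing by the root stays inside the ideal because the root is a nonzerodivisor on functions on
lines transverse to it. -/
theorem oddPart_mem {F : Set (Fin (n + 1) × Fin (n + 1))} {i : Fin n}
    (hF : (i.castSucc, i.succ) ∈ F)
    (hflip : ∀ η ∈ signings F, flipOn (simplePair i) η ∈ signings F)
    {p : MvPolynomial (Fin (n + 1)) k} (hp : p ∈ vanishingIdeal k (edgeVar k F)) :
    oddPart i p ∈ vanishingIdeal k (edgeVar k F) := by
  refine mem_vanishingIdeal_of_mul hF ?_
  rw [simpleRoot_mul_oddPart]
  exact Ideal.mul_mem_left _ _ (Ideal.sub_mem _ hp (simpleAct_mem hF hflip hp))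

theorem mem_of_add_mul_mem {F : Set (Fin (n + 1) × Fin (n + 1))} {i : Fin n}
    (hF : (i.castSucc, i.succ) ∈ F)
    (hflip : ∀ η ∈ signings F, flipOn (simplePair i) η ∈ signings F)
    {r t : MvPolynomial (Fin (n + 1)) k} (hr : simpleAct k i r = r) (ht : simpleAct k i t = t)
    (h : r + simpleRoot k i * t ∈ vanishingIdeal k (edgeVar k F)) :
    r ∈ vanishingIdeal k (edgeVar k F) ∧ t ∈ vanishingIdeal k (edgeVar k F) :=
  ⟨evenPart_eq i hr ht ▸ evenPart_mem hF hflip h, oddPart_eq i hr ht ▸ oddPart_mem hF hflip h⟩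

/-- The functions on `Y` form, over the invariant polynomials, a direct sum of copies of the
invariant functions on `Y'`: there is an equivariant map `φ` to a power of the functions on `Y'`
for which `(a, b) ↦ φ a + α φ b` is bijective, with `α` the simple root. -/
def Splitting (i : Fin n) (Y Y' : Set (Amb k n)) : Prop :=
  ∃ (κ : Type) (_ : Finite κ) (_ : Nonempty κ) (φ : Reg Y →+ (κ → Reg Y')),
    (∀ r p, simpleAct k i r = r → φ (toReg Y (r * p)) = toReg Y' r • φ (toReg Y p)) ∧
    Function.Bijective fun x : Reg Y × Reg Y => φ x.1 + toReg Y' (simpleRoot k i) • φ x.2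

theorem injective_of_eq_zero {A B κ : Type*} [AddCommGroup A] [CommRing B] (φ : A →+ (κ → B))
    (α : B) (h : ∀ x y, φ x + α • φ y = 0 → x = 0 ∧ y = 0) :
    Function.Injective fun x : A × A => φ x.1 + α • φ x.2 := by
  rintro ⟨x, y⟩ ⟨x', y'⟩ hxy
  have hxy : φ x + α • φ y = φ x' + α • φ y' := hxy
  have h0 : φ (x - x') + α • φ (y - y') = 0 := by
    rw [map_sub, map_sub, smul_sub, ← add_sub_add_comm, hxy, sub_self]
  exact Prod.ext (sub_eq_zero.1 (h _ _ h0).1) (sub_eq_zero.1 (h _ _ h0).2)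

/-- The rank-two case: `φ` records the even and the odd part, both invariant, so recombining with
the root is the decomposition applied in each of two coordinates. -/
theorem splitting_of_stable {F : Set (Fin (n + 1) × Fin (n + 1))} {i : Fin n}
    (hF : (i.castSucc, i.succ) ∈ F)
    (hflip : ∀ η ∈ signings F, flipOn (simplePair i) η ∈ signings F) :
    Splitting i (edgeVar k F) (edgeVar k F) := by
  let φ₀ : MvPolynomial (Fin (n + 1)) k →+ (Bool → Reg (edgeVar k F)) :=
    AddMonoidHom.mk' (fun p b => toReg _ (if b then oddPart i p else evenPart i p)) (by
      intro p q
      ext1 b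
      cases b <;> simp [oddPart_add, evenPart_add])
  let φ : Reg (edgeVar k F) →+ (Bool → Reg (edgeVar k F)) := QuotientAddGroup.lift _ φ₀ (by
    intro p hp
    ext1 b
    refine Ideal.Quotient.eq_zero_iff_mem.2 ?_
    cases b
    · exact evenPart_mem hF hflip hp
    · exact oddPart_mem hF hflip hp)
  have hφ : ∀ p b, φ (toReg _ p) b = toReg _ (if b then oddPart i p else evenPart i p) :=
    fun _ _ => rfl
  refine ⟨Bool, inferInstance, inferInstance, φ, ?_, ?_, ?_⟩
  · intro r p hr
    ext1 b
    rw [hφ, Pi.smul_apply, hφ, smul_eq_mul, ← map_mul]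
    cases b <;> simp [evenPart_mul i hr, oddPart_mul i hr]
  · refine injective_of_eq_zero φ (toReg (edgeVar k F) (simpleRoot k i)) ?_
    rintro x y h
    obtain ⟨p, rfl⟩ := Ideal.Quotient.mk_surjective x
    obtain ⟨q, rfl⟩ := Ideal.Quotient.mk_surjective y
    have h1 : evenPart i p + simpleRoot k i * evenPart i q ∈ vanishingIdeal k (edgeVar k F) := by
      rw [← Ideal.Quotient.eq_zero_iff_mem, map_add, map_mul]
      exact congrFun h false
    have h2 : oddPart i p + simpleRoot k i * oddPart i q ∈ vanishingIdeal k (edgeVar k F) := by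
      rw [← Ideal.Quotient.eq_zero_iff_mem, map_add, map_mul]
      exact congrFun h true
    have h1 := mem_of_add_mul_mem hF hflip (simpleAct_evenPart i p) (simpleAct_evenPart i q) h1
    have h2 := mem_of_add_mul_mem hF hflip (simpleAct_oddPart i p) (simpleAct_oddPart i q) h2
    refine ⟨Ideal.Quotient.eq_zero_iff_mem.2 ?_, Ideal.Quotient.eq_zero_iff_mem.2 ?_⟩
    · rw [← evenPart_add_mul_oddPart i p]
      exact Ideal.add_mem _ h1.1 (Ideal.mul_mem_left _ _ h2.1)
    · rw [← evenPart_add_mul_oddPart i q]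
      exact Ideal.add_mem _ h1.2 (Ideal.mul_mem_left _ _ h2.2)
  · intro f
    obtain ⟨u, hu⟩ := Ideal.Quotient.mk_surjective (f false)
    obtain ⟨v, hv⟩ := Ideal.Quotient.mk_surjective (f true)
    -- The even parts of the two entries must reassemble `u` and their odd parts must reassemble
    -- `v`, which forces this transposed arrangement.
    refine ⟨(toReg _ (evenPart i u + simpleRoot k i * evenPart i v),
      toReg _ (oddPart i u + simpleRoot k i * oddPart i v)), ?_⟩
    ext1 b
    simp only [Pi.add_apply, Pi.smul_apply, smul_eq_mul, hφ]
    rw [← map_mul, ← map_add]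
    cases b
    · simp only [Bool.false_eq_true, if_false]
      rw [evenPart_eq i (simpleAct_evenPart i u) (simpleAct_evenPart i v),
        evenPart_eq i (simpleAct_oddPart i u) (simpleAct_oddPart i v),
        evenPart_add_mul_oddPart, hu]
    · simp only [if_true]
      rw [oddPart_eq i (simpleAct_evenPart i u) (simpleAct_evenPart i v),
        oddPart_eq i (simpleAct_oddPart i u) (simpleAct_oddPart i v),
        evenPart_add_mul_oddPart, hv]

/-- The rank-one case: `φ` sends a function on `Y` to its invariant extension to the larger variety,
unique by `hY'`, so that `𝒪(Y)` becomes the invariants there. -/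
theorem splitting_of_extension {F : Set (Fin (n + 1) × Fin (n + 1))} {i : Fin n}
    (hF : (i.castSucc, i.succ) ∈ F)
    (hflip : ∀ η ∈ signings F, flipOn (simplePair i) η ∈ signings F) {Y : Set (Amb k n)}
    (hY : Y ⊆ edgeVar k F)
    (hY' : ∀ r, simpleAct k i r = r → r ∈ vanishingIdeal k Y → r ∈ vanishingIdeal k (edgeVar k F))
    (hext : ∀ p, ∃ r, simpleAct k i r = r ∧ p - r ∈ vanishingIdeal k Y) :
    Splitting i Y (edgeVar k F) := by
  choose e he hpe using hext
  have key : ∀ p r, simpleAct k i r = r → p - r ∈ vanishingIdeal k Y →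
      toReg (edgeVar k F) (e p) = toReg (edgeVar k F) r := by
    intro p r hr hpr
    refine Ideal.Quotient.eq.2 (hY' _ (by rw [map_sub, he, hr]) ?_)
    have : e p - r = (p - r) - (p - e p) := by ring
    rw [this]
    exact Ideal.sub_mem _ hpr (hpe p)
  let φ₀ : MvPolynomial (Fin (n + 1)) k →+ (Unit → Reg (edgeVar k F)) :=
    AddMonoidHom.mk' (fun p _ => toReg _ (e p)) (by
      intro p q
      ext1 b
      rw [Pi.add_apply, ← map_add]
      refine key _ _ (by rw [map_add, he, he]) ?_
      have : p + q - (e p + e q) = (p - e p) + (q - e q) := by ring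
      rw [this]
      exact Ideal.add_mem _ (hpe p) (hpe q))
  let φ : Reg Y →+ (Unit → Reg (edgeVar k F)) := QuotientAddGroup.lift _ φ₀ (by
    intro p hp
    ext1 b
    exact (key p 0 (map_zero _) (by rwa [sub_zero])).trans (map_zero _))
  have hφ : ∀ p r, simpleAct k i r = r → p - r ∈ vanishingIdeal k Y → ∀ b,
      φ (toReg _ p) b = toReg _ r := fun p r hr hpr _ => key p r hr hpr
  refine ⟨Unit, inferInstance, inferInstance, φ, ?_, ?_, ?_⟩
  · intro r p hr
    ext1 b
    rw [hφ (r * p) (r * e p) (by rw [map_mul, hr, he])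
      (by rw [← mul_sub]; exact Ideal.mul_mem_left _ _ (hpe p)), Pi.smul_apply,
      hφ p (e p) (he p) (hpe p), smul_eq_mul, ← map_mul]
  · refine injective_of_eq_zero φ (toReg (edgeVar k F) (simpleRoot k i)) ?_
    rintro x y h
    obtain ⟨p, rfl⟩ := Ideal.Quotient.mk_surjective x
    obtain ⟨q, rfl⟩ := Ideal.Quotient.mk_surjective y
    have h1 : e p + simpleRoot k i * e q ∈ vanishingIdeal k (edgeVar k F) := by
      rw [← Ideal.Quotient.eq_zero_iff_mem, map_add, map_mul]
      exact congrFun h ()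
    have h1 := mem_of_add_mul_mem hF hflip (he p) (he q) h1
    have hle := vanishingIdeal_anti_mono (k := k) hY
    refine ⟨Ideal.Quotient.eq_zero_iff_mem.2 ?_, Ideal.Quotient.eq_zero_iff_mem.2 ?_⟩
    · rw [← sub_add_cancel p (e p)]
      exact Ideal.add_mem _ (hpe p) (hle h1.1)
    · rw [← sub_add_cancel q (e q)]
      exact Ideal.add_mem _ (hpe q) (hle h1.2)
  · intro f
    obtain ⟨u, hu⟩ := Ideal.Quotient.mk_surjective (f ())
    refine ⟨(toReg _ (evenPart i u), toReg _ (oddPart i u)), ?_⟩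
    ext1 b
    simp only [Pi.add_apply, Pi.smul_apply, smul_eq_mul]
    rw [hφ _ _ (simpleAct_evenPart i u) (by rw [sub_self]; exact zero_mem _),
      hφ _ _ (simpleAct_oddPart i u) (by rw [sub_self]; exact zero_mem _),
      ← map_mul, ← map_add, evenPart_add_mul_oddPart, hu]

-- Where `x_u = x_w` on `Y`, the variable `x_u` can be replaced by the fixed variable `x_w`, and its
-- partner in the pair by the invariant sum of the pair minus `x_w`. Polynomials in these
-- replacements are invariant.
omit [CharZero k] in
theorem exists_invariant_extension {i : Fin n} {Y : Set (Amb k n)} {u w : Fin (n + 1)}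
    (hu : u ∈ simplePair i) (hw : w ∉ simplePair i)
    (h : (X u - X w : MvPolynomial (Fin (n + 1)) k) ∈ vanishingIdeal k Y)
    (p : MvPolynomial (Fin (n + 1)) k) :
    ∃ r, simpleAct k i r = r ∧ p - r ∈ vanishingIdeal k Y := by
  have hX : ∀ j, ∃ r, simpleAct k i r = r ∧ X j - r ∈ vanishingIdeal k Y := by
    intro j
    by_cases hj : j ∈ simplePair i
    · by_cases hju : j = u
      · subst hju
        exact ⟨X w, by rw [simpleAct, rename_X, simple_apply_of_notMem hw], h⟩
      · refine ⟨X i.castSucc + X i.succ - X w, ?_, ?_⟩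
        · simp only [simpleAct, map_sub, map_add, rename_X, simple_apply_of_notMem hw]
          rw [simple, Equiv.swap_apply_left, Equiv.swap_apply_right]
          ring
        · have : (X j - (X i.castSucc + X i.succ - X w) : MvPolynomial (Fin (n + 1)) k) =
              -(X u - X w) := by
            rcases mem_simplePair.1 hj with rfl | rfl <;>
              rcases mem_simplePair.1 hu with rfl | rfl
            · exact (hju rfl).elim
            · ring
            · ring
            · exact (hju rfl).elim
          rw [this]
          exact neg_mem h
    · exact ⟨X j, by rw [simpleAct, rename_X, simple_apply_of_notMem hj], by
        rw [sub_self]; exact zero_mem _⟩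
  induction p using MvPolynomial.induction_on with
  | C a => exact ⟨C a, by rw [← algebraMap_eq, AlgHom.commutes], by
      rw [sub_self]; exact zero_mem _⟩
  | add p q hp hq =>
    obtain ⟨r, hr, hpr⟩ := hp
    obtain ⟨t, ht, hqt⟩ := hq
    refine ⟨r + t, by rw [map_add, hr, ht], ?_⟩
    rw [add_sub_add_comm]
    exact Ideal.add_mem _ hpr hqt
  | mul_X p j hp =>
    obtain ⟨r, hr, hpr⟩ := hp
    obtain ⟨t, ht, hqt⟩ := hX j
    refine ⟨r * t, by rw [map_mul, hr, ht], ?_⟩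
    have : p * X j - r * t = (p - r) * X j + r * (X j - t) := by ring
    rw [this]
    exact Ideal.add_mem _ (Ideal.mul_mem_right _ _ hpr) (Ideal.mul_mem_left _ _ hqt)

theorem flipOn_mem_stepEdges {i : Fin n} {E : Set (Fin (n + 1) × Fin (n + 1))}
    {η : Fin (n + 1) → ℤˣ} (hη : η ∈ signings (stepEdges i E)) :
    flipOn (simplePair i) η ∈ signings (stepEdges i E) := by
  rw [mem_signings_stepEdges] at hη ⊢
  rw [flipOn_flipOn]
  exact ⟨flipOn_simplePair hη.1, hη.2.symm⟩

omit [CharZero k] in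
theorem edgeVar_congr {E F : Set (Fin (n + 1) × Fin (n + 1))}
    (h : ∀ η, η ∈ signings E ↔ η ∈ signings F) : edgeVar k E = edgeVar k F := by
  simp only [edgeVar, h]

/-- An edge from the pair to an outside place gives the extension case, since an invariant function
on the union of `Y` and its reflection is determined on `Y`. Without such an edge flipping the pair
preserves `E`, so `Y` is already stable. -/
theorem splitting_stepEdges (i : Fin n) (E : Set (Fin (n + 1) × Fin (n + 1))) :
    Splitting i (edgeVar k (insert (i.castSucc, i.succ) E)) (edgeVar k (stepEdges i E)) := by
  have hmem : (i.castSucc, i.succ) ∈ stepEdges i E :=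
    Or.inl ⟨castSucc_mem_simplePair i, succ_mem_simplePair i⟩
  by_cases hE : ∃ v ∈ simplePair i, ∃ w ∉ simplePair i, (v, w) ∈ E ∨ (w, v) ∈ E
  · obtain ⟨v, hv, w, hw, hvw⟩ := hE
    have hall : ∀ η ∈ signings (insert (i.castSucc, i.succ) E), ∀ u ∈ simplePair i,
        η u = η w := by
      intro η hη u hu
      have hη' := mem_signings_insert.1 hη
      rw [eq_of_mem_simplePair hη'.1 hu hv]
      exact hvw.elim (hη'.2 (v, w)) fun hvw => (hη'.2 (w, v) hvw).symm
    -- The two places of the pair have opposite parities, so one of them shares the parity of `w`;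
    -- equal signs then mean equal coordinates.
    have hpar : ∃ u ∈ simplePair i, parity u = parity w := by
      by_cases h : parity i.castSucc = parity w
      · exact ⟨_, castSucc_mem_simplePair i, h⟩
      · exact ⟨_, succ_mem_simplePair i, by
          rw [parity_succ, Int.units_ne_iff_eq_neg.1 h, neg_neg]⟩
    obtain ⟨u, hu, hpar⟩ := hpar
    refine splitting_of_extension hmem (fun η => flipOn_mem_stepEdges) ?_ ?_
      (exists_invariant_extension hu hw ?_)
    · rintro _ ⟨η, hη, δ, rfl⟩
      have hη' := mem_signings_insert.1 hη
      exact linePt_mem_edgeVar (mem_signings_stepEdges.2 ⟨hη'.1, Or.inl hη'.2⟩) δ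
    · rintro r hr h _ ⟨η, hη, δ, rfl⟩
      obtain ⟨hi, hη | hη⟩ := mem_signings_stepEdges.1 hη
      · exact h _ (linePt_mem_edgeVar (mem_signings_insert.2 ⟨hi, hη⟩) δ)
      · have := h _ (linePt_mem_edgeVar (mem_signings_insert.2 ⟨flipOn_simplePair hi, hη⟩) δ)
        rw [← permAct_simple_linePt hi] at this
        rw [← hr, simpleAct, aeval_rename, ← this]
        congr 2
    · rintro _ ⟨η, hη, δ, rfl⟩
      have : colour k η u = colour k η w := colour_eq_iff.2 (by rw [hpar, hall η hη u hu])
      rw [map_sub, aeval_X, aeval_X, linePt_sub, this, sub_self, mul_zero]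
  · push Not at hE
    have hflip : ∀ η : Fin (n + 1) → ℤˣ, η i.castSucc = η i.succ → η ∈ signings E →
        flipOn (simplePair i) η ∈ signings E := by
      rintro η hi hη ⟨v, w⟩ hvw
      change flipOn _ η v = flipOn _ η w
      have h1 : η v = η w := hη _ hvw
      by_cases hv : v ∈ simplePair i <;> by_cases hw : w ∈ simplePair i
      · rw [flipOn_of_mem hv, flipOn_of_mem hw, h1]
      · exact ((hE v hv w hw).1 hvw).elim
      · exact ((hE w hw v hv).2 hvw).elim
      · rw [flipOn_of_notMem hv, flipOn_of_notMem hw, h1]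
    have : edgeVar k (insert (i.castSucc, i.succ) E) = edgeVar k (stepEdges i E) := by
      refine edgeVar_congr fun η => ?_
      rw [mem_signings_stepEdges, mem_signings_insert]
      refine and_congr_right fun hi => ⟨Or.inl, fun h => h.elim id fun h => ?_⟩
      rw [← flipOn_flipOn (simplePair i) η]
      exact hflip _ (flipOn_simplePair hi) h
    rw [this]
    exact splitting_of_stable hmem fun η => flipOn_mem_stepEdges

/-- Splitting for the step from `W` to `V_i ∩ (W ∪ s_i W)`. -/
theorem splitting_inter (i : Fin n) (E : Set (Fin (n + 1) × Fin (n + 1))) :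
    Splitting i (transverse k (simple i) ∩ edgeVar k E)
      (transverse k (simple i) ∩ (edgeVar k E ∪ permAct k (simple i) '' edgeVar k E)) := by
  rw [transverse_eq, edgeVar_stepEdges, edgeVar_inter (parity_castSucc i) (Set.mem_singleton _),
    Set.singleton_union]
  exact splitting_stepEdges i E

theorem splitting_transverse (i : Fin n) :
    Splitting i (transverse k (simple i)) (transverse k (simple i)) := by
  rw [transverse_eq]
  refine splitting_of_stable rfl fun η hη => ?_
  rintro _ rfl
  exact flipOn_simplePair (hη _ rfl)

end Demazure
-- Freeness of tensor products.
section Free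

open GrBimod

theorem bijective_of_generators {X T P : Type*} [AddCommGroup X] [AddCommGroup T]
    [AddCommGroup P] (g : X →+ T) (f : T →+ P) (hg : Function.Surjective g)
    (hs : ∀ y, ∃ x, f (g x) = y) (h0 : ∀ x, f (g x) = 0 → g x = 0) : Function.Bijective f := by
  refine ⟨(injective_iff_map_eq_zero f).2 fun t ht => ?_, fun y => ?_⟩
  · obtain ⟨x, rfl⟩ := hg t
    exact h0 x ht
  · obtain ⟨x, hx⟩ := hs y
    exact ⟨g x, hx⟩

/-- The biadditive map `(p, m) ↦ τ p • Φ m`. -/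
def smulComp {P N R F : Type*} [AddCommGroup P] [AddCommGroup N] [Ring R] [AddCommGroup F]
    [Module R F] (τ : P →+ R) (Φ : N →+ F) : P →+ N →+ F :=
  AddMonoidHom.mk' (fun p => (AddMonoidHom.smul (τ p)).comp Φ) fun p q => by ext m; simp [add_smul]

variable {k : Type u} [Field k] {n : ℕ}

theorem toReg_smul_smul {Y : Set (Amb k n)} {F : Type*} [AddCommGroup F] [Module (Reg Y) F]
    (p q : MvPolynomial (Fin (n + 1)) k) (x : F) :
    toReg Y p • toReg Y q • x = toReg Y (p * q) • x := by
  rw [smul_smul, map_mul]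

/-- The module `M` over `𝒪(Z)` is free and nonzero over its quotient `𝒪(Y)`. -/
def FreeOn (Y : Set (Amb k n)) (M : Type u) [AddCommGroup M] [Module (Reg (weylUnion k n)) M] :
    Prop :=
  ∃ (ι : Type u) (_ : Nonempty ι) (e : M ≃+ (ι →₀ Reg Y)),
    ∀ p m, e (toReg (weylUnion k n) p • m) = toReg Y p • e m

namespace FreeOn

variable {Y : Set (Amb k n)}

theorem of_free {M F : Type u} [AddCommGroup M] [Module (Reg (weylUnion k n)) M]
    [AddCommGroup F] [Module (Reg Y) F] [Module.Free (Reg Y) F] [Nontrivial F] (e : M ≃+ F)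
    (h : ∀ p m, e (toReg (weylUnion k n) p • m) = toReg Y p • e m) : FreeOn Y M := by
  let b := Module.Free.chooseBasis (Reg Y) F
  refine ⟨_, b.index_nonempty, e.trans b.repr.toAddEquiv, fun p m => ?_⟩
  exact (congrArg b.repr (h p m)).trans (b.repr.map_smul _ _)

variable {M : Type u} [AddCommGroup M] [Module (Reg (weylUnion k n)) M]

theorem isFreeOver (h : FreeOn Y M) : IsFreeOver (X := weylUnion k n) Y M := by
  obtain ⟨ι, -, e, he⟩ := h
  let _ : Module (Reg Y) M := e.module (Reg Y)
  have hsmul : ∀ (a : Reg Y) (m : M), e (a • m) = a • e m := fun a m => e.apply_symm_apply _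
  refine ⟨e.module (Reg Y), fun p m => e.injective ?_, ?_⟩
  · rw [hsmul, he]
  · exact Module.Free.of_equiv (e.toLinearEquiv hsmul).symm

/-- Nonemptiness of the index set makes the module faithful over `𝒪(Y)`, so the ideal of `Y`, and
with it the support, can be recovered from the module. -/
theorem comap_annihilator (h : FreeOn Y M) :
    (Module.annihilator (Reg (weylUnion k n)) M).comap (toReg (weylUnion k n)) =
      MvPolynomial.vanishingIdeal k Y := by
  obtain ⟨ι, ⟨j⟩, e, he⟩ := h
  ext p
  rw [Ideal.mem_comap, Module.mem_annihilator, ← Ideal.Quotient.eq_zero_iff_mem]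
  constructor
  · intro h
    have h1 := he p (e.symm (Finsupp.single j 1))
    rw [h, map_zero, e.apply_symm_apply] at h1
    have := DFunLike.congr_fun h1 j
    simpa using this.symm
  · intro h m
    refine e.injective ?_
    rw [he, map_zero]
    exact (congrArg (· • e m) h).trans (zero_smul (Reg Y) (e m))

theorem congr {B B' : BarBimod k n} (h : FreeOn Y B.carrier) (e : Iso B B') :
    FreeOn Y B'.carrier := by
  obtain ⟨ι, hι, f, hf⟩ := h
  exact ⟨ι, hι, e.symm.toAddEquiv.trans f, fun p m =>
    (congrArg f (e.symm.map_smul _ m)).trans (hf p _)⟩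

end FreeOn

theorem nontrivial_reg {Y : Set (Amb k n)} (hY : Y.Nonempty) : Nontrivial (Reg Y) := by
  refine Ideal.Quotient.nontrivial_iff.2 fun h => ?_
  obtain ⟨x, hx⟩ := hY
  have : (1 : MvPolynomial (Fin (n + 1)) k) ∈ MvPolynomial.vanishingIdeal k Y := h ▸ trivial
  exact one_ne_zero ((map_one (MvPolynomial.aeval x)).symm.trans (this x hx))

variable [CharZero k]

theorem FreeOn.tensor {W Y : Set (Amb k n)} {N : BarBimod k n} (h : FreeOn W N.carrier)
    (hYW : Y ⊆ W) (hY : IsCone Y) (hYZ : Y ⊆ weylUnion k n) :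
    FreeOn Y ((regBimod hY hYZ).tensor N).carrier := by
  obtain ⟨ι, hι, e, he⟩ := h
  let Φ : N.carrier →+ (ι →₀ Reg Y) :=
    (Finsupp.mapRange.addMonoidHom (restrict hYW).toAddMonoidHom).comp e.toAddMonoidHom
  have hΦ : ∀ m j, Φ m j = restrict hYW (e m j) := fun _ _ => rfl
  have hΦs : ∀ p m, Φ (toReg (weylUnion k n) p • m) = toReg Y p • Φ m := by
    intro p m
    ext j
    rw [hΦ, he, Finsupp.smul_apply, Finsupp.smul_apply, hΦ, smul_eq_mul, map_mul]
    rfl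
  let f₀ : (regBimod hY hYZ).carrier →+ N.carrier →+ (ι →₀ Reg Y) :=
    regLift hY hYZ (smulComp (toReg Y).toAddMonoidHom Φ) (by
      intro p hp
      ext1 m
      exact (congrArg (· • Φ m) (Ideal.Quotient.eq_zero_iff_mem.2 hp)).trans
        (zero_smul (Reg Y) (Φ m)))
  have hf₀ : ∀ p m, f₀ (regElt hY hYZ p) m = toReg Y p • Φ m := fun p m => rfl
  have hbal : ∀ (b : Reg (weylUnion k n)) x m, f₀ (MulOpposite.op b • x) m = f₀ x (b • m) := by
    intro b x m
    obtain ⟨p, rfl⟩ := Ideal.Quotient.mk_surjective b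
    obtain ⟨q, rfl⟩ := regElt_surjective hY hYZ x
    rw [op_smul_regElt, hf₀, hf₀, hΦs, toReg_smul_smul, mul_comm q]
  let f := lift f₀ hbal
  have hf : ∀ p m, f (tmul _ N (regElt hY hYZ p) m) = toReg Y p • Φ m := fun p m => by
    rw [lift_tmul, hf₀]
  let g : N.carrier →+ ((regBimod hY hYZ).tensor N).carrier :=
    tmulHom (regBimod hY hYZ) N (regElt hY hYZ 1)
  have hg : ∀ m, g m = tmul (regBimod hY hYZ) N (regElt hY hYZ 1) m := fun _ => rfl
  have hfg : ∀ m, f (g m) = Φ m := fun m => by rw [hg, hf, map_one, one_smul]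
  have hbij : Function.Bijective f := by
    refine bijective_of_generators g f ?_ ?_ ?_
    · intro t
      induction t using tensor_induction with
      | zero => exact ⟨0, map_zero g⟩
      | tmul x m =>
        obtain ⟨q, rfl⟩ := regElt_surjective hY hYZ x
        exact ⟨toReg (weylUnion k n) q • m, by rw [hg, ← regElt_tmul, mul_one]⟩
      | add x y hx hy =>
        obtain ⟨a, rfl⟩ := hx
        obtain ⟨b, rfl⟩ := hy
        exact ⟨a + b, map_add g a b⟩
    · intro y
      induction y using Finsupp.induction_linear with
      | zero => exact ⟨0, by rw [map_zero, map_zero]⟩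
      | add x y hx hy =>
        obtain ⟨a, rfl⟩ := hx
        obtain ⟨b, rfl⟩ := hy
        exact ⟨a + b, by rw [map_add, map_add]⟩
      | single j v =>
        classical
        obtain ⟨p, rfl⟩ := Ideal.Quotient.mk_surjective v
        refine ⟨e.symm (Finsupp.single j (toReg W p)), ?_⟩
        rw [hfg]
        ext l
        rw [hΦ, e.apply_symm_apply, Finsupp.single_apply, Finsupp.single_apply]
        split_ifs
        · rfl
        · exact map_zero _
    · intro m hm
      rw [hfg] at hm
      obtain ⟨y, rfl⟩ := e.symm.surjective m
      -- Injectivity is checked one coordinate at a time: a coefficient vanishing on `Y` lifts to a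
      -- polynomial in the ideal of `Y`, which crosses the tensor sign and dies in `𝒪(Y)`.
      rw [← y.sum_single, Finsupp.sum, map_sum, map_sum]
      refine Finset.sum_eq_zero fun j _ => ?_
      have hj : restrict hYW (y j) = 0 := by
        have := DFunLike.congr_fun hm j
        rwa [hΦ, e.apply_symm_apply] at this
      obtain ⟨p, hp⟩ := Ideal.Quotient.mk_surjective (y j)
      rw [← hp] at hj ⊢
      have hp' : p ∈ MvPolynomial.vanishingIdeal k Y := Ideal.Quotient.eq_zero_iff_mem.1 hj
      have : e.symm (Finsupp.single j (toReg W p)) =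
          toReg (weylUnion k n) p • e.symm (Finsupp.single j 1) := by
        refine e.injective ?_
        rw [he, e.apply_symm_apply, e.apply_symm_apply, Finsupp.smul_single, smul_eq_mul, mul_one]
      rw [this, hg, ← regElt_tmul, mul_one, (regElt_eq_zero hY hYZ).2 hp', ← tmulHom_apply,
        map_zero, AddMonoidHom.zero_apply]
  refine ⟨ι, hι, AddEquiv.ofBijective f hbij, fun p t => ?_⟩
  change f _ = toReg Y p • f t
  induction t using tensor_induction with
  | zero => rw [smul_zero, map_zero, smul_zero]
  | tmul x m =>
    obtain ⟨q, rfl⟩ := regElt_surjective hY hYZ x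
    rw [GrBimod.smul_tmul, smul_regElt, hf, hf, toReg_smul_smul]
  | add x y hx hy => rw [smul_add, map_add, hx, hy, map_add, smul_add]

variable (k) in
/-- The left factor `R_i` of the bimodule `B_i`. -/
noncomputable def simpleLeft (i : Fin n) : GrBimod (barDeg k n) (simpleInvDeg (k := k) i) :=
  GrBimod.ofHoms (regDeg_isInternal (transverse_isCone (simple i)))
    (restrict (transverse_subset _)) (Subring.subtype _) (restrict_mem _) (fun _ _ hb => hb)

variable (k) in
/-- The right factor `R_i` of the bimodule `B_i`. -/
noncomputable def simpleRight (i : Fin n) : GrBimod (simpleInvDeg (k := k) i) (barDeg k n) :=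
  GrBimod.ofHoms (regDeg_isInternal (transverse_isCone (simple i)))
    (Subring.subtype _) (restrict (transverse_subset _)) (fun _ _ hb => hb) (restrict_mem _)

/-- The element of `R_i^{s_i}` given by an invariant polynomial. -/
noncomputable def invElt {i : Fin n} {q : MvPolynomial (Fin (n + 1)) k}
    (hq : simpleAct k i q = q) :
    invariants (simple i) (transverse_stable (k := k) (simple i)) :=
  ⟨toReg _ q, congrArg (toReg (transverse k (simple i))) hq⟩

/-- Averaging lifts an invariant function on `V_i` to an invariant polynomial, so balancedness over
the invariants need only be tested on polynomials. -/
theorem exists_invElt {i : Fin n}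
    (r : invariants (simple i) (transverse_stable (k := k) (simple i))) :
    ∃ (q : MvPolynomial (Fin (n + 1)) k) (hq : simpleAct k i q = q), r = invElt hq := by
  obtain ⟨r, hr⟩ := r
  obtain ⟨p, rfl⟩ := Ideal.Quotient.mk_surjective r
  have hr : toReg (transverse k (simple i)) (simpleAct k i p) = toReg _ p := hr
  refine ⟨evenPart i p, simpleAct_evenPart i p, Subtype.ext ?_⟩
  change toReg _ p = toReg (transverse k (simple i)) (evenPart i p)
  rw [evenPart, map_mul, map_add, hr, ← map_add, ← map_mul, C_half_mul]

/-- The element of the left factor of `B_i` given by a polynomial. -/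
noncomputable def leftElt (i : Fin n) : MvPolynomial (Fin (n + 1)) k →+ (simpleLeft k i).carrier :=
  (toReg (transverse k (simple i))).toAddMonoidHom

/-- The element of the right factor of `B_i` given by a polynomial. -/
noncomputable def rightElt (i : Fin n) :
    MvPolynomial (Fin (n + 1)) k →+ (simpleRight k i).carrier :=
  (toReg (transverse k (simple i))).toAddMonoidHom

theorem leftElt_surjective (i : Fin n) : Function.Surjective (leftElt (k := k) i) :=
  Ideal.Quotient.mk_surjective

theorem rightElt_surjective (i : Fin n) : Function.Surjective (rightElt (k := k) i) :=
  Ideal.Quotient.mk_surjective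

theorem smul_leftElt (i : Fin n) (p q : MvPolynomial (Fin (n + 1)) k) :
    toReg (weylUnion k n) p • leftElt i q = leftElt i (p * q) :=
  (map_mul (toReg (transverse k (simple i))) p q).symm

theorem op_smul_leftElt {i : Fin n} {p : MvPolynomial (Fin (n + 1)) k}
    (hp : simpleAct k i p = p) (q : MvPolynomial (Fin (n + 1)) k) :
    MulOpposite.op (invElt hp) • leftElt i q = leftElt i (p * q) :=
  (map_mul (toReg (transverse k (simple i))) p q).symm

theorem smul_rightElt {i : Fin n} {p : MvPolynomial (Fin (n + 1)) k}
    (hp : simpleAct k i p = p) (q : MvPolynomial (Fin (n + 1)) k) :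
    invElt hp • rightElt i q = rightElt i (p * q) :=
  (map_mul (toReg (transverse k (simple i))) p q).symm

theorem op_smul_rightElt (i : Fin n) (p q : MvPolynomial (Fin (n + 1)) k) :
    MulOpposite.op (toReg (weylUnion k n) p) • rightElt i q = rightElt i (p * q) :=
  (map_mul (toReg (transverse k (simple i))) p q).symm

section Half

variable {C : Type u} [CommRing C] {𝒞 : ℤ → AddSubgroup C} {i : Fin n} {Y : Set (Amb k n)}

/-- A module over `R_i^{s_i}` which is isomorphic to a nonzero direct sum of copies of `𝒪(Y)`. -/
def HalfFreeOn (i : Fin n) (Y : Set (Amb k n)) (L : GrBimod (simpleInvDeg (k := k) i) 𝒞) : Prop :=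
  ∃ (ι : Type u) (_ : Nonempty ι) (θ : L.carrier ≃+ (ι →₀ Reg Y)),
    ∀ (q : MvPolynomial (Fin (n + 1)) k) (hq : simpleAct k i q = q) (l : L.carrier),
      θ (invElt hq • l) = toReg Y q • θ l

theorem halfFreeOn_simpleRight (i : Fin n) :
    HalfFreeOn i (transverse k (simple i)) (simpleRight k i) := by
  let θ : Reg (transverse k (simple i)) ≃+ (PUnit.{u + 1} →₀ Reg (transverse k (simple i))) :=
    (Finsupp.uniqueLinearEquiv (Reg (transverse k (simple i)))
      (Reg (transverse k (simple i))) PUnit.unit.{u + 1}).symm.toAddEquiv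
  exact ⟨PUnit, inferInstance, θ, fun q hq l =>
    (Finsupp.uniqueLinearEquiv (Reg (transverse k (simple i)))
      (Reg (transverse k (simple i))) PUnit.unit.{u + 1}).symm.map_smul (toReg _ q) l⟩

/-- The right factor `R_i` is absorbed: `𝒪(Y)` is already a quotient of `R_i`, so `R_i ⊗ K` is `K`
with its left action restricted to invariants. -/
theorem HalfFreeOn.of_freeOn {K : GrBimod (barDeg k n) 𝒞} (h : FreeOn Y K.carrier)
    (hY : Y ⊆ transverse k (simple i)) : HalfFreeOn i Y ((simpleRight k i).tensor K) := by
  obtain ⟨ι, hι, e, he⟩ := h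
  let f₀ : (simpleRight k i).carrier →+ K.carrier →+ (ι →₀ Reg Y) :=
    QuotientAddGroup.lift _ (smulComp (toReg Y).toAddMonoidHom e.toAddMonoidHom) (by
      intro p hp
      ext1 m
      exact (congrArg (· • e m) (Ideal.Quotient.eq_zero_iff_mem.2
        (MvPolynomial.vanishingIdeal_anti_mono hY hp))).trans (zero_smul (Reg Y) (e m)))
  have hf₀ : ∀ p m, f₀ (rightElt i p) m = toReg Y p • e m := fun p m => rfl
  have hbal : ∀ (b : Reg (weylUnion k n)) x m, f₀ (MulOpposite.op b • x) m = f₀ x (b • m) := by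
    intro b x m
    obtain ⟨p, rfl⟩ := Ideal.Quotient.mk_surjective b
    obtain ⟨q, rfl⟩ := rightElt_surjective i x
    rw [op_smul_rightElt, hf₀, hf₀, he, toReg_smul_smul, mul_comm q]
  let f := lift f₀ hbal
  have hf : ∀ p m, f (tmul _ K (rightElt i p) m) = toReg Y p • e m := fun p m => by
    rw [lift_tmul, hf₀]
  let g : K.carrier →+ ((simpleRight k i).tensor K).carrier :=
    tmulHom (simpleRight k i) K (rightElt i 1)
  have hg : ∀ m, g m = tmul (simpleRight k i) K (rightElt i 1) m := fun _ => rfl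
  have hfg : ∀ m, f (g m) = e m := fun m => by rw [hg, hf, map_one, one_smul]
  have hbij : Function.Bijective f := by
    refine bijective_of_generators g f ?_ (fun y => ⟨e.symm y, by rw [hfg, e.apply_symm_apply]⟩)
      (fun m hm => ?_)
    · intro t
      induction t using tensor_induction with
      | zero => exact ⟨0, map_zero g⟩
      | tmul x m =>
        obtain ⟨q, rfl⟩ := rightElt_surjective i x
        exact ⟨toReg (weylUnion k n) q • m, by
          rw [hg, ← op_smul_tmul, op_smul_rightElt, mul_one]⟩
      | add x y hx hy =>
        obtain ⟨a, rfl⟩ := hx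
        obtain ⟨b, rfl⟩ := hy
        exact ⟨a + b, map_add g a b⟩
    · rw [hfg] at hm
      rw [e.map_eq_zero_iff.1 hm, map_zero]
  refine ⟨ι, hι, AddEquiv.ofBijective f hbij, fun p hp t => ?_⟩
  change f _ = toReg Y p • f t
  induction t using tensor_induction with
  | zero => rw [smul_zero, map_zero, smul_zero]
  | tmul x m =>
    obtain ⟨q, rfl⟩ := rightElt_surjective i x
    rw [GrBimod.smul_tmul, smul_rightElt, hf, hf, toReg_smul_smul]
  | add x y hx hy => rw [smul_add, map_add, hx, hy, map_add, smul_add]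

/-- Since `R_i` is generated by `1` and the root `α` over its invariants, pairs `(a, b)` in `L` map
onto the tensor product by `1 ⊗ a + α ⊗ b`. The splitting carries these pairs bijectively onto
copies of `𝒪(Y')`, so there are no further relations. -/
theorem HalfFreeOn.freeOn {L : GrBimod (simpleInvDeg (k := k) i) 𝒞} (h : HalfFreeOn i Y L)
    {Y' : Set (Amb k n)} (hs : Splitting i Y Y') (hY' : Y' ⊆ transverse k (simple i))
    (hne : Y'.Nonempty) : FreeOn Y' ((simpleLeft k i).tensor L).carrier := by
  obtain ⟨ι, hι, θ, hθ⟩ := h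
  obtain ⟨κ, hκ, hκ', φ, hφ, hφi, hφs⟩ := hs
  let Φ : L.carrier →+ (ι →₀ κ → Reg Y') :=
    (Finsupp.mapRange.addMonoidHom φ).comp θ.toAddMonoidHom
  have hΦ : ∀ m j, Φ m j = φ (θ m j) := fun _ _ => rfl
  have hΦs : ∀ (q : MvPolynomial (Fin (n + 1)) k) (hq : simpleAct k i q = q) (l : L.carrier),
      Φ (invElt hq • l) = toReg Y' q • Φ l := by
    intro q hq l
    ext1 j
    obtain ⟨p, hp⟩ := Ideal.Quotient.mk_surjective (θ l j)
    rw [hΦ, hθ, Finsupp.smul_apply, Finsupp.smul_apply, hΦ, ← hp, smul_eq_mul, ← map_mul,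
      hφ q p hq]
  let f₀ : (simpleLeft k i).carrier →+ L.carrier →+ (ι →₀ κ → Reg Y') :=
    QuotientAddGroup.lift _ (smulComp (toReg Y').toAddMonoidHom Φ) (by
      intro p hp
      ext1 m
      exact (congrArg (· • Φ m) (Ideal.Quotient.eq_zero_iff_mem.2
        (MvPolynomial.vanishingIdeal_anti_mono hY' hp))).trans (zero_smul (Reg Y') (Φ m)))
  have hf₀ : ∀ p m, f₀ (leftElt i p) m = toReg Y' p • Φ m := fun p m => rfl
  have hbal : ∀ (b : invariants (simple i) (transverse_stable (k := k) (simple i))) x m,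
      f₀ (MulOpposite.op b • x) m = f₀ x (b • m) := by
    intro b x m
    obtain ⟨p, hp, rfl⟩ := exists_invElt b
    obtain ⟨q, rfl⟩ := leftElt_surjective i x
    rw [op_smul_leftElt, hf₀, hf₀, hΦs, toReg_smul_smul, mul_comm q]
  let f := lift f₀ hbal
  have hf : ∀ p m, f (tmul _ L (leftElt i p) m) = toReg Y' p • Φ m := fun p m => by
    rw [lift_tmul, hf₀]
  let g : L.carrier × L.carrier →+ ((simpleLeft k i).tensor L).carrier :=
    (tmulHom (simpleLeft k i) L (leftElt i 1)).coprod
      (tmulHom (simpleLeft k i) L (leftElt i (simpleRoot k i)))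
  have hg : ∀ x, g x = tmul (simpleLeft k i) L (leftElt i 1) x.1 +
      tmul (simpleLeft k i) L (leftElt i (simpleRoot k i)) x.2 := fun _ => rfl
  have hfg : ∀ x, f (g x) = Φ x.1 + toReg Y' (simpleRoot k i) • Φ x.2 := fun x => by
    rw [hg, map_add, hf, hf, map_one, one_smul]
  have hbij : Function.Bijective f := by
    refine bijective_of_generators g f ?_ ?_ ?_
    · intro t
      induction t using tensor_induction with
      | zero => exact ⟨0, map_zero g⟩
      | tmul x m =>
        obtain ⟨q, rfl⟩ := leftElt_surjective i x
        refine ⟨(invElt (simpleAct_evenPart i q) • m, invElt (simpleAct_oddPart i q) • m), ?_⟩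
        rw [hg, ← op_smul_tmul, ← op_smul_tmul, op_smul_leftElt, op_smul_leftElt,
          ← GrBimod.add_tmul, ← map_add, mul_one, mul_comm (oddPart i q),
          evenPart_add_mul_oddPart]
      | add x y hx hy =>
        obtain ⟨a, rfl⟩ := hx
        obtain ⟨b, rfl⟩ := hy
        exact ⟨a + b, map_add g a b⟩
    · intro y
      induction y using Finsupp.induction_linear with
      | zero => exact ⟨0, by rw [map_zero, map_zero]⟩
      | add x y hx hy =>
        obtain ⟨a, rfl⟩ := hx
        obtain ⟨b, rfl⟩ := hy
        exact ⟨a + b, by rw [map_add, map_add]⟩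
      | single j v =>
        classical
        obtain ⟨⟨a, b⟩, hab⟩ := hφs v
        refine ⟨(θ.symm (Finsupp.single j a), θ.symm (Finsupp.single j b)), ?_⟩
        rw [hfg]
        ext1 l
        rw [Finsupp.add_apply, Finsupp.smul_apply, hΦ, hΦ, θ.apply_symm_apply,
          θ.apply_symm_apply, Finsupp.single_apply, Finsupp.single_apply, Finsupp.single_apply]
        split_ifs
        · exact hab
        · rw [map_zero, smul_zero, add_zero]
    · rintro ⟨a, b⟩ hx
      rw [hfg] at hx
      have hz : ∀ j, θ a j = 0 ∧ θ b j = 0 := by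
        intro j
        have hj := DFunLike.congr_fun hx j
        rw [Finsupp.add_apply, Finsupp.smul_apply, hΦ, hΦ] at hj
        have : (θ a j, θ b j) = 0 := hφi (hj.trans (by
          change (0 : κ → Reg Y') = φ 0 + toReg Y' (simpleRoot k i) • φ 0
          rw [map_zero, smul_zero, add_zero]))
        exact ⟨congrArg Prod.fst this, congrArg Prod.snd this⟩
      have ha : a = 0 := θ.map_eq_zero_iff.1 (by ext1 j; exact (hz j).1)
      have hb : b = 0 := θ.map_eq_zero_iff.1 (by ext1 j; exact (hz j).2)
      rw [ha, hb]
      exact map_zero g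
  have hnt := nontrivial_reg hne
  have : Nontrivial (ι →₀ κ → Reg Y') := inferInstance
  refine FreeOn.of_free (F := ι →₀ κ → Reg Y') (AddEquiv.ofBijective f hbij) fun p t => ?_
  change f _ = toReg Y' p • f t
  induction t using tensor_induction with
  | zero => rw [smul_zero, map_zero, smul_zero]
  | tmul x m =>
    obtain ⟨q, rfl⟩ := leftElt_surjective i x
    rw [GrBimod.smul_tmul, smul_leftElt, hf, hf, toReg_smul_smul]
  | add x y hx hy => rw [smul_add, map_add, hx, hy, map_add, smul_add]

end Half

end Free
-- The induction on the length of the sequence.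
section Sequences

open GrBimod

variable {k : Type u} [Field k] [CharZero k] {n : ℕ}

theorem FreeOn.leftVariety_eq {B : BarBimod k n} {E : Set (Fin (n + 1) × Fin (n + 1))} (i : Fin n)
    (h : FreeOn (edgeVar k E) B.carrier) : leftVariety B = edgeVar k E := by
  rw [leftVariety, locus, h.comap_annihilator, weylUnion_inter_zeroLocus i]

theorem FreeOn.rightVariety_eq {B : BarBimod k n} {E : Set (Fin (n + 1) × Fin (n + 1))}
    (i : Fin n) (h : FreeOn (edgeVar k E) B.flip.carrier) : rightVariety B = edgeVar k E :=
  FreeOn.leftVariety_eq (B := B.flip) i h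

/-- The form in which reducedness enters `starAssoc`: `E` is the support of a product and `F` that
of the factor on the relevant side. As `E` lies in `F`, the left intersection is that of `F ∪ G`
with `E`, and both edge sets contain `(a, b)`. -/
theorem vanishingIdeal_inter_le {E F : Set (Fin (n + 1) × Fin (n + 1))} {a b : Fin (n + 1)}
    (hab : parity a = -parity b) (hE : (a, b) ∈ E) (hF : (a, b) ∈ F)
    (h : edgeVar k E ⊆ edgeVar k F) (G : Set (Fin (n + 1) × Fin (n + 1))) :
    MvPolynomial.vanishingIdeal k (edgeVar k E ∩ edgeVar k G) ≤
      MvPolynomial.vanishingIdeal k (edgeVar k F ∩ edgeVar k G) ⊔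
        MvPolynomial.vanishingIdeal k (edgeVar k E) := by
  have : edgeVar k E ∩ edgeVar k G = edgeVar k ((F ∪ G) ∪ E) := by
    rw [Set.union_comm, ← edgeVar_inter hab hE, ← edgeVar_inter hab hF, ← Set.inter_assoc,
      Set.inter_eq_left.2 h]
  rw [this, edgeVar_inter hab hF]
  exact vanishingIdeal_union_le hab (Or.inl hF) hE

theorem simpleBimod_freeOn (i : Fin n) :
    FreeOn (transverse k (simple i)) (simpleBimod k i).carrier :=
  (halfFreeOn_simpleRight i).freeOn (splitting_transverse i) subset_rfl
    (by rw [transverse_eq]; exact ⟨0, zero_mem_edgeVar _⟩)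

theorem rightVariety_simpleBimod (i : Fin n) :
    rightVariety (simpleBimod k i) = transverse k (simple i) := by
  have h := (simpleBimod_freeOn (k := k) i).congr (flipSimple i).symm
  rw [transverse_eq] at h ⊢
  exact h.rightVariety_eq i

theorem seqBimod_freeOn {l : List (Fin n)} (hl : l ≠ []) :
    FreeOn (seqVariety k l) (seqBimod k l).carrier := by
  obtain ⟨i, l, rfl⟩ := List.exists_cons_of_ne_nil hl
  clear hl
  induction l generalizing i with
  | nil => exact simpleBimod_freeOn i
  | cons j l ih =>
    specialize ih j
    change FreeOn (transverse k (simple i) ∩ (seqVariety k (j :: l) ∪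
      permAct k (simple i) '' seqVariety k (j :: l)))
      (star (simpleBimod k i) (seqBimod k (j :: l))).carrier
    rw [seqVariety_cons_eq] at ih ⊢
    have hl := ih.leftVariety_eq i
    have hY : rightVariety (simpleBimod k i) ∩ leftVariety (seqBimod k (j :: l)) =
        transverse k (simple i) ∩ edgeVar k (seqEdges (j :: l)) := by
      rw [rightVariety_simpleBimod, hl]
    have hc : IsCone (transverse k (simple i) ∩ edgeVar k (seqEdges (j :: l))) :=
      hY ▸ inter_isCone _ _
    have hZ : transverse k (simple i) ∩ edgeVar k (seqEdges (j :: l)) ⊆ weylUnion k n :=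
      Set.inter_subset_left.trans (transverse_subset _)
    have h1 := ih.tensor Set.inter_subset_right hc hZ
    have h2 := HalfFreeOn.of_freeOn h1 Set.inter_subset_left
    have h3 := h2.freeOn (splitting_inter i _) Set.inter_subset_left ⟨0,
      by rw [transverse_eq]; exact zero_mem_edgeVar _, Or.inl (zero_mem_edgeVar _)⟩
    -- Freeness was built up as `R_i ⊗ (R_i ⊗ (𝒪(Y) ⊗ N))`; reassociating gives the bracketing in
    -- the definition of `star`.
    exact h3.congr ((tensorAssoc (ℬ := simpleInvDeg i) (simpleLeft k i)
      (simpleRight k i) _).symm.trans ((tensorAssoc (simpleBimod k i) _ _).symm.trans (starIso _ _ hc hZ hY).symm))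

theorem IsAssociated.ne_nil {l : List (Fin n)} {B : BarBimod k n} (h : IsAssociated l B) :
    l ≠ [] := by
  induction h with
  | single i => exact List.cons_ne_nil _ _
  | mul _ _ h _ => exact List.append_ne_nil_of_left_ne_nil h _

theorem isAssociated_seqBimod {l : List (Fin n)} (hl : l ≠ []) :
    IsAssociated l (seqBimod k l) := by
  obtain ⟨i, l, rfl⟩ := List.exists_cons_of_ne_nil hl
  clear hl
  induction l generalizing i with
  | nil => exact .single i
  | cons j l ih => exact (IsAssociated.single i).mul (ih j)

variable (k) in
/-- All bimodules associated to `l` are isomorphic, and reversing `l` amounts to exchanging the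
two sides. -/
def Coherent (l : List (Fin n)) : Prop :=
  (∀ B : BarBimod k n, IsAssociated l B → Nonempty (Iso B (seqBimod k l))) ∧
    Nonempty (Iso (seqBimod k l).flip (seqBimod k l.reverse))

theorem Coherent.flip_freeOn {l : List (Fin n)} (h : Coherent k l) (hl : l ≠ []) :
    FreeOn (seqVariety k l.reverse) (seqBimod k l).flip.carrier :=
  h.2.elim fun e => (seqBimod_freeOn (List.reverse_ne_nil_iff.2 hl)).congr e.symm

/-- The product of the bimodules of two sequences is that of the concatenated sequence. -/
theorem star_seqBimod {l l' : List (Fin n)} (hl : l ≠ []) (hl' : l' ≠ [])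
    (ih : ∀ t : List (Fin n), t ≠ [] → t.length < (l ++ l').length → Coherent k t) :
    Nonempty (Iso (star (seqBimod k l) (seqBimod k l')) (seqBimod k (l ++ l'))) := by
  have hpos := List.length_pos_iff.2 hl'
  obtain ⟨i, l, rfl⟩ := List.exists_cons_of_ne_nil hl
  clear hl
  cases l with
  | nil =>
    obtain ⟨j, l', rfl⟩ := List.exists_cons_of_ne_nil hl'
    exact ⟨Iso.refl _⟩
  | cons j l =>
    rw [List.length_append] at ih
    have hjl : j :: l ≠ [] := List.cons_ne_nil _ _
    have hijl : i :: j :: l ≠ [] := List.cons_ne_nil _ _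
    -- Dropping the first letter leaves a shorter sequence, so the product of `j :: l` and `l'` is
    -- known; it remains to move the bracket past `B_i`.
    obtain ⟨e⟩ := (ih (j :: (l ++ l')) (List.cons_ne_nil _ _)
      (by simp only [List.length_cons, List.length_append]; omega)).1 _
      ((isAssociated_seqBimod hjl).mul (isAssociated_seqBimod hl'))
    -- Coherence of `i :: j :: l` is available because `l'` is nonempty; it computes the right
    -- support.
    have hB : FreeOn (seqVariety k (i :: j :: l).reverse)
        (star (simpleBimod k i) (seqBimod k (j :: l))).flip.carrier :=
      (ih _ hijl (by omega)).flip_freeOn hijl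
    have hN := (ih _ hjl (by simp only [List.length_cons]; omega)).flip_freeOn hjl
    have hN' := seqBimod_freeOn (k := k) hjl
    have hM := seqBimod_freeOn (k := k) hl'
    have hS : FreeOn (seqVariety k (j :: (l ++ l')))
        (star (seqBimod k (j :: l)) (seqBimod k l')).carrier :=
      (seqBimod_freeOn (List.cons_ne_nil _ _)).congr e.symm
    have hi := rightVariety_simpleBimod (k := k) i
    have hsub : seqVariety k (i :: j :: l).reverse ⊆ seqVariety k (j :: l).reverse := by
      rw [List.reverse_cons]
      exact seqVariety_append_subset (List.reverse_ne_nil_iff.2 hjl) _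
    have hsub' : seqVariety k (j :: (l ++ l')) ⊆ seqVariety k (j :: l) :=
      seqVariety_append_subset hjl l'
    -- The letter `c` at the right end of `j :: l` gives the edge shared by the two right supports;
    -- on the left this role is played by `j`.
    obtain ⟨c, t, hct⟩ := List.exists_cons_of_ne_nil (List.reverse_ne_nil_iff.2 hjl)
    rw [List.reverse_cons (a := i), hct, List.cons_append] at hB hsub
    rw [hct] at hN
    rw [seqVariety_cons_eq] at hB hN hN' hS
    rw [seqVariety_eq hl'] at hM
    rw [seqVariety_cons_eq, seqVariety_cons_eq] at hsub hsub'
    rw [transverse_eq] at hi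
    refine ⟨(starAssoc (simpleBimod k i) (seqBimod k (j :: l)) (seqBimod k l') ?_ ?_ ?_ ?_).trans
      (starCongr (Iso.refl _) e)⟩
    · rwa [hB.rightVariety_eq i, hN.rightVariety_eq i]
    · rwa [hS.leftVariety_eq i, hN'.leftVariety_eq i]
    · rw [hB.rightVariety_eq i, hN.rightVariety_eq i, hM.leftVariety_eq i]
      refine (vanishingIdeal_inter_le (parity_castSucc c) (mem_seqEdges _ _) (mem_seqEdges _ _)
        hsub _).trans_eq (congrArg _ hB.comap_annihilator.symm)
    · have key := vanishingIdeal_inter_le (k := k) (parity_castSucc j) (mem_seqEdges _ _)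
        (mem_seqEdges _ _) hsub' {(i.castSucc, i.succ)}
      rw [Set.inter_comm, Set.inter_comm (edgeVar k (seqEdges (j :: l)))] at key
      rw [hS.leftVariety_eq i, hN'.leftVariety_eq i, hi]
      exact key.trans_eq (congrArg _ hS.comap_annihilator.symm)

theorem nonempty_iso_seqBimod {l : List (Fin n)}
    (ih : ∀ t : List (Fin n), t ≠ [] → t.length < l.length → Coherent k t) {B : BarBimod k n}
    (hB : IsAssociated l B) : Nonempty (Iso B (seqBimod k l)) := by
  cases hB with
  | single i => exact ⟨Iso.refl _⟩
  | @mul l l' B B' h h' =>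
    have h0 := List.length_pos_iff.2 h.ne_nil
    have h0' := List.length_pos_iff.2 h'.ne_nil
    obtain ⟨e⟩ := (ih l h.ne_nil (by rw [List.length_append]; omega)).1 B h
    obtain ⟨e'⟩ := (ih l' h'.ne_nil (by rw [List.length_append]; omega)).1 B' h'
    obtain ⟨f⟩ := star_seqBimod h.ne_nil h'.ne_nil ih
    exact ⟨(starCongr e e').trans f⟩

theorem nonempty_flip_iso_seqBimod {l : List (Fin n)} (hl : l ≠ [])
    (ih : ∀ t : List (Fin n), t ≠ [] → t.length < l.length → Coherent k t) :
    Nonempty (Iso (seqBimod k l).flip (seqBimod k l.reverse)) := by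
  obtain ⟨i, l, rfl⟩ := List.exists_cons_of_ne_nil hl
  cases l with
  | nil => exact ⟨flipSimple i⟩
  | cons j l =>
    have hjl : j :: l ≠ [] := List.cons_ne_nil _ _
    obtain ⟨e⟩ := (ih (j :: l) hjl (by simp)).2
    have ha : IsAssociated (i :: j :: l).reverse
        (star (seqBimod k (j :: l).reverse) (simpleBimod k i)) := by
      rw [List.reverse_cons (a := i)]
      exact (isAssociated_seqBimod (List.reverse_ne_nil_iff.2 hjl)).mul (.single i)
    -- The flipped product is associated to the reversed sequence with another bracketing, so the
    -- first half of coherence, at the same length, identifies it.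
    obtain ⟨f⟩ := nonempty_iso_seqBimod (by rwa [List.length_reverse]) ha
    exact ⟨(flipStar (simpleBimod k i) (seqBimod k (j :: l))).trans
      ((starCongr e (flipSimple i)).trans f)⟩

theorem coherent {l : List (Fin n)} (hl : l ≠ []) : Coherent k l := by
  induction h : l.length using Nat.strong_induction_on generalizing l with
  | _ m ih =>
    have ih' : ∀ t : List (Fin n), t ≠ [] → t.length < l.length → Coherent k t :=
      fun t ht htl => ih _ (h ▸ htl) ht rfl
    exact ⟨fun B hB => nonempty_iso_seqBimod ih' hB, nonempty_flip_iso_seqBimod hl ih'⟩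

end Sequences
end WeylBimod

theorem mainTheorem4 {k : Type*} [Field k] [CharZero k] {n : ℕ} (l : List (Fin n))
    (hl : l ≠ []) :
    (∀ B B' : WeylBimod.BarBimod k n, WeylBimod.IsAssociated l B → WeylBimod.IsAssociated l B' →
      Nonempty (WeylBimod.GrBimod.Iso B B')) ∧
    WeylBimod.IsFreeOver (X := WeylBimod.weylUnion k n) (WeylBimod.seqVariety k l)
      (WeylBimod.seqBimod k l).carrier ∧
    WeylBimod.IsFreeOver (X := WeylBimod.weylUnion k n) (WeylBimod.seqVariety k l.reverse)
      (WeylBimod.seqBimod k l).Rt := by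
  have h := WeylBimod.coherent (k := k) hl
  -- Right freeness is left freeness of the flipped bimodule, which belongs to the reversed
  -- sequence.
  refine ⟨fun B B' hB hB' => ?_, (WeylBimod.seqBimod_freeOn hl).isFreeOver,
    (h.flip_freeOn hl).isFreeOver⟩
  obtain ⟨e⟩ := h.1 B hB
  obtain ⟨e'⟩ := h.1 B' hB'
  exact ⟨e.trans e'.symm⟩
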